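/- Let $(\mathcal V,\otimes,1)$ be a locally small closed symmetric monoidal category with all small colimits, and let $\mathcal V\text{-}\mathsf{Cat}$ be the 2-category of small $\mathcal V$-enriched categories, $\mathcal V$-functors and $\mathcal V$-natural transformations (families $\alpha_c\colon 1\to\mathcal D(Fc,Gc)$ such that the two induced morphisms $\mathcal C(c,c')\to\mathcal D(Fc,Gc')$ in $\mathcal V$ agree). For a small bicategory $\mathcal D$ and pseudofunctors $W\colon\mathcal D^{\mathrm{op}}\to\mathsf{Cat}$ (valued in small categories) and $X\colon\mathcal D\to\mathcal V\text{-}\mathsf{Cat}$, a $W$-weighted cocone under $X$ with vertex $L$ is a pseudonatural transformation $\lambda\colon W\Rightarrow\mathcal V\text{-}\mathsf{Cat}(X(-),L)$. It exhibits $L$ as the *$W$-weighted bicolimit* of $X$ if for every $\mathcal V$-category $\mathcal E$ the induced functor, pseudonatural in $\mathcal E$, $$\mathcal V\text{-}\mathsf{Cat}(L,\mathcal E)\longrightarrow \mathrm{Hom}_{[\mathcal D^{\mathrm{op}},\mathsf{Cat}]}\bigl(W,\ \mathcal V\text{-}\mathsf{Cat}(X(-),\mathcal E)\bigr),\qquad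 F\mapsto (F\circ-)\cdot\lambda,$$ is an equivalence of categories, where $[\mathcal D^{\mathrm{op}},\mathsf{Cat}]$ is the 2-category of pseudofunctors, pseudonatural transformations and modifications. For $\mathcal V$-categories $\mathcal A,\mathcal B$ let $\mathcal A\otimes\mathcal B$ be the $\mathcal V$-category whose objects are pairs and whose hom-objects are $\mathcal A(a,a')\otimes\mathcal B(b,b')$, with composition defined using the symmetry of $\mathcal V$. Then: 1. $\mathcal V\text{-}\mathsf{Cat}$ admits all bicolimits: for all $\mathcal D$, $W$, $X$ as above, there is a cocone exhibiting some $L$ as the $W$-weighted bicolimit of $X$. 2. The tensor product preserves all bicolimits in each variable: for every $\mathcal C\in\mathcal V\text{-}\mathsf{Cat}$, the 2-functors $\mathcal C\otimes-$ and $-\otimes\mathcal C$ on $\mathcal V\text{-}\mathsf{Cat}$ send every cocone exhibiting a weighted bicolimit to a cocone exhibiting a weighted bicolimit (of the composite diagram, with the same weight). -/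

import Mathlib

open CategoryTheory Opposite

universe u v v'

namespace VCatBicolimits

section Enriched

open MonoidalCategory

variable {V : Type v} [Category.{u} V] [MonoidalCategory V]

section Underlying

variable {C : Type u} [EnrichedCategory V C]

/-- `f ↦ f ≫ g`: the morphism `C(a, b) ⟶ C(a, c)` in `V` given by postcomposition with an arrow
`g : 𝟙_ V ⟶ C(b, c)` of the underlying category. -/
def post (a : C) {b c : C} (g : 𝟙_ V ⟶ (b ⟶[V] c)) : (a ⟶[V] b) ⟶ (a ⟶[V] c) :=
  (ρ_ (a ⟶[V] b)).inv ≫ (a ⟶[V] b) ◁ g ≫ eComp V a b c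

/-- `g ↦ f ≫ g`: the morphism `C(b, c) ⟶ C(a, c)` in `V` given by precomposition with an arrow
`f : 𝟙_ V ⟶ C(a, b)` of the underlying category. -/
def pre {a b : C} (f : 𝟙_ V ⟶ (a ⟶[V] b)) (c : C) : (b ⟶[V] c) ⟶ (a ⟶[V] c) :=
  (λ_ (b ⟶[V] c)).inv ≫ f ▷ (b ⟶[V] c) ≫ eComp V a b c

theorem pre_eId (a b : C) : pre (eId V a) b = 𝟙 (a ⟶[V] b) := e_id_comp V a b

theorem post_eId (a b : C) : post a (eId V b) = 𝟙 (a ⟶[V] b) := e_comp_id V a b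

theorem id_naturality {X : V} {a b : C} (m m' : X ⟶ (a ⟶[V] b)) (h : m = m') :
    m ≫ post a (eId V b) = m' ≫ pre (eId V a) b := by
  rw [post_eId, pre_eId, h]

/-- Composition of arrows of the underlying category, expressed in two ways. -/
theorem comp_post_eq_comp_pre {a b c : C} (f : 𝟙_ V ⟶ (a ⟶[V] b)) (g : 𝟙_ V ⟶ (b ⟶[V] c)) :
    f ≫ post a g = g ≫ pre f c := by
  unfold post pre
  rw [rightUnitor_inv_naturality_assoc, leftUnitor_inv_naturality_assoc,
    whisker_exchange_assoc, unitors_inv_equal]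

theorem eId_comp_post {a b : C} (g : 𝟙_ V ⟶ (a ⟶[V] b)) : eId V a ≫ post a g = g := by
  rw [comp_post_eq_comp_pre, pre_eId, Category.comp_id]

theorem post_comp_post (a : C) {b c d : C} (g : 𝟙_ V ⟶ (b ⟶[V] c)) (h : 𝟙_ V ⟶ (c ⟶[V] d)) :
    post a g ≫ post a h = post a (g ≫ post b h) := by
  unfold post
  simp only [Category.assoc, MonoidalCategory.whiskerLeft_comp]
  rw [rightUnitor_inv_naturality_assoc, ← whisker_exchange_assoc, ← e_assoc' V a b c d]
  simp

theorem pre_comp_pre {a b c : C} (f : 𝟙_ V ⟶ (a ⟶[V] b)) (g : 𝟙_ V ⟶ (b ⟶[V] c)) (d : C) :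
    pre g d ≫ pre f d = pre (f ≫ post a g) d := by
  rw [comp_post_eq_comp_pre]
  unfold pre
  simp only [Category.assoc, MonoidalCategory.comp_whiskerRight]
  rw [leftUnitor_inv_naturality_assoc, whisker_exchange_assoc]
  simp [← e_assoc' V a b c d]

theorem eComp_post (a b : C) {c d : C} (h : 𝟙_ V ⟶ (c ⟶[V] d)) :
    eComp V a b c ≫ post a h = (a ⟶[V] b) ◁ post b h ≫ eComp V a b d := by
  unfold post
  rw [rightUnitor_inv_naturality_assoc, ← whisker_exchange_assoc, ← e_assoc' V a b c d]
  simp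

theorem pre_comp_post {a b c d : C} (f : 𝟙_ V ⟶ (a ⟶[V] b)) (h : 𝟙_ V ⟶ (c ⟶[V] d)) :
    pre f c ≫ post a h = post b h ≫ pre f d := by
  unfold pre
  rw [leftUnitor_inv_naturality_assoc, whisker_exchange_assoc, Category.assoc, Category.assoc,
    eComp_post]

variable {D : Type u} [EnrichedCategory V D]

theorem map_post (F : EnrichedFunctor V C D) (a : C) {b c : C} (g : 𝟙_ V ⟶ (b ⟶[V] c)) :
    post a g ≫ F.map a c = F.map a b ≫ post (F.obj a) (g ≫ F.map b c) := by
  unfold post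
  simp only [Category.assoc, EnrichedFunctor.map_comp, MonoidalCategory.whiskerLeft_comp]
  rw [rightUnitor_inv_naturality_assoc, tensorHom_def', ← whisker_exchange_assoc]
  simp only [Category.assoc]
  rw [whisker_exchange_assoc]

theorem map_pre (F : EnrichedFunctor V C D) {a b : C} (f : 𝟙_ V ⟶ (a ⟶[V] b)) (c : C) :
    pre f c ≫ F.map a c = F.map b c ≫ pre (f ≫ F.map a b) (F.obj c) := by
  unfold pre
  simp only [Category.assoc, EnrichedFunctor.map_comp, MonoidalCategory.comp_whiskerRight]
  rw [leftUnitor_inv_naturality_assoc, tensorHom_def', whisker_exchange_assoc,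
    Category.assoc]

end Underlying

/-- A `V`-functor between small `V`-categories. -/
structure VFunctor (C : Type u) [EnrichedCategory V C] (D : Type u) [EnrichedCategory V D] extends
    EnrichedFunctor V C D

variable {C D E : Type u} [EnrichedCategory V C] [EnrichedCategory V D] [EnrichedCategory V E]

/-- A `V`-natural transformation: components `𝟙_ V ⟶ D(F c, G c)` making the square
`C(c, c') ⇉ D(F c, G c')` commute in `V`. (This is stronger in general than naturality of the
induced transformation between the underlying ordinary functors.) -/
@[ext]
structure VNatTrans (F G : VFunctor (V := V) C D) where
  app (c : C) : 𝟙_ V ⟶ (F.obj c ⟶[V] G.obj c)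
  naturality (c c' : C) :
    F.map c c' ≫ post (F.obj c) (app c') = G.map c c' ≫ pre (app c) (G.obj c')

/-- The category of `V`-functors `C ⟶ D` and `V`-natural transformations; the composite of `α` and
`β` has components `𝟙_ V ⟶ D(F c, G c) ⟶ D(F c, H c)`, the second arrow being postcomposition with
`β c`. -/
instance : Category (VFunctor (V := V) C D) where
  Hom F G := VNatTrans F G
  id F :=
    { app := fun c => eId V (F.obj c)
      naturality := fun c c' => by rw [post_eId, pre_eId] }
  comp {F G H} α β :=
    { app := fun c => α.app c ≫ post (F.obj c) (β.app c)
      naturality := fun c c' => by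
        rw [← post_comp_post, ← Category.assoc, α.naturality, Category.assoc, pre_comp_post,
          ← Category.assoc, β.naturality, Category.assoc, pre_comp_pre] }
  id_comp α := VNatTrans.ext (funext fun c => eId_comp_post _)
  comp_id α := VNatTrans.ext (funext fun c => by
    show α.app c ≫ post _ (eId V _) = _
    rw [post_eId, Category.comp_id])
  assoc α β γ := VNatTrans.ext (funext fun c => by
    show (α.app c ≫ post _ _) ≫ post _ _ = α.app c ≫ post _ (β.app c ≫ post _ _)
    rw [Category.assoc, post_comp_post])

@[ext]
theorem VFunctor.hom_ext {F G : VFunctor (V := V) C D} {α β : F ⟶ G}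
    (h : ∀ c, VNatTrans.app α c = VNatTrans.app β c) : α = β :=
  VNatTrans.ext (funext h)

@[simp]
theorem VFunctor.id_app (F : VFunctor (V := V) C D) (c : C) :
    VNatTrans.app (𝟙 F) c = eId V (F.obj c) := rfl

@[simp]
theorem VFunctor.comp_app {F G H : VFunctor (V := V) C D} (α : F ⟶ G) (β : G ⟶ H) (c : C) :
    VNatTrans.app (α ≫ β) c = VNatTrans.app α c ≫ post (F.obj c) (VNatTrans.app β c) := rfl

/-- The identity `V`-functor. -/
def VFunctor.id (C : Type u) [EnrichedCategory V C] : VFunctor (V := V) C C :=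
  { EnrichedFunctor.id V C with }

/-- The composite of two `V`-functors. -/
def VFunctor.comp (F : VFunctor (V := V) C D) (G : VFunctor (V := V) D E) :
    VFunctor (V := V) C E :=
  { EnrichedFunctor.comp V F.toEnrichedFunctor G.toEnrichedFunctor with }

variable (V) in
/-- The objects of `V-Cat`: small `V`-categories. -/
structure VCat where
  carrier : Type u
  [str : EnrichedCategory V carrier]

attribute [instance] VCat.str

/-- The associator of `V-Cat`, with identity components. -/
def VFunctor.associator {C D E E' : Type u} [EnrichedCategory V C] [EnrichedCategory V D]
    [EnrichedCategory V E] [EnrichedCategory V E'] (F : VFunctor (V := V) C D)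
    (G : VFunctor (V := V) D E) (H : VFunctor (V := V) E E') :
    (F.comp G).comp H ≅ F.comp (G.comp H) where
  hom :=
    { app := fun c => eId V (H.obj (G.obj (F.obj c)))
      naturality := fun _ _ => id_naturality _ _ (Category.assoc _ _ _) }
  inv :=
    { app := fun c => eId V (H.obj (G.obj (F.obj c)))
      naturality := fun _ _ => id_naturality _ _ (Category.assoc _ _ _).symm }
  hom_inv_id := VFunctor.hom_ext fun _ => eId_comp_post _
  inv_hom_id := VFunctor.hom_ext fun _ => eId_comp_post _

/-- The left unitor of `V-Cat`, with identity components. -/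
def VFunctor.leftUnitor (F : VFunctor (V := V) C D) : (VFunctor.id C).comp F ≅ F where
  hom :=
    { app := fun c => eId V (F.obj c)
      naturality := fun _ _ => id_naturality _ _ (Category.id_comp _) }
  inv :=
    { app := fun c => eId V (F.obj c)
      naturality := fun _ _ => id_naturality _ _ (Category.id_comp _).symm }
  hom_inv_id := VFunctor.hom_ext fun _ => eId_comp_post _
  inv_hom_id := VFunctor.hom_ext fun _ => eId_comp_post _

/-- The right unitor of `V-Cat`, with identity components. -/
def VFunctor.rightUnitor (F : VFunctor (V := V) C D) : F.comp (VFunctor.id D) ≅ F where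
  hom :=
    { app := fun c => eId V (F.obj c)
      naturality := fun _ _ => id_naturality _ _ (Category.comp_id _) }
  inv :=
    { app := fun c => eId V (F.obj c)
      naturality := fun _ _ => id_naturality _ _ (Category.comp_id _).symm }
  hom_inv_id := VFunctor.hom_ext fun _ => eId_comp_post _
  inv_hom_id := VFunctor.hom_ext fun _ => eId_comp_post _

/-- Whiskering of a `V`-natural transformation with a `V`-functor on the left. -/
def VFunctor.whiskerLeft (F : VFunctor (V := V) C D) {G H : VFunctor (V := V) D E}
    (α : G ⟶ H) : F.comp G ⟶ F.comp H :=
  { app := fun c => VNatTrans.app α (F.obj c)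
    naturality := fun c c' => by
      show (F.map c c' ≫ G.map _ _) ≫ post _ _ = (F.map c c' ≫ H.map _ _) ≫ pre _ _
      rw [Category.assoc, VNatTrans.naturality α, Category.assoc] }

theorem whisker_naturality {F G : VFunctor (V := V) C D} (α : VNatTrans F G)
    (H : EnrichedFunctor V D E) (c c' : C) :
    (F.map c c' ≫ H.map _ _) ≫ post _ (α.app c' ≫ H.map (F.obj c') (G.obj c')) =
      (G.map c c' ≫ H.map _ _) ≫ pre (α.app c ≫ H.map (F.obj c) (G.obj c)) _ := by
  rw [Category.assoc, ← map_post, ← Category.assoc, α.naturality, Category.assoc,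
    map_pre, Category.assoc]

/-- Whiskering of a `V`-natural transformation with a `V`-functor on the right. -/
def VFunctor.whiskerRight {F G : VFunctor (V := V) C D} (α : F ⟶ G)
    (H : VFunctor (V := V) D E) : F.comp H ⟶ G.comp H :=
  { app := fun c => VNatTrans.app α c ≫ H.map (F.obj c) (G.obj c)
    naturality := fun c c' => whisker_naturality α H.toEnrichedFunctor c c' }

/-- The 2-category `V-Cat` of small `V`-categories, `V`-functors and `V`-natural
transformations. -/
instance : Bicategory.{u, u} (VCat.{u, v} V) where
  Hom C D := VFunctor (V := V) C.carrier D.carrier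
  id C := VFunctor.id C.carrier
  comp F G := F.comp G
  homCategory C D := inferInstanceAs (Category (VFunctor (V := V) C.carrier D.carrier))
  whiskerLeft F _ _ α := VFunctor.whiskerLeft F α
  whiskerRight α H := VFunctor.whiskerRight α H
  associator := VFunctor.associator
  leftUnitor := VFunctor.leftUnitor
  rightUnitor := VFunctor.rightUnitor
  whiskerLeft_id _ _ := rfl
  whiskerLeft_comp _ _ _ _ _ _ := rfl
  id_whiskerLeft {C D F G} η := VFunctor.hom_ext fun c => by
    show VNatTrans.app η c = eId V (F.obj c) ≫ post _ (VNatTrans.app η c ≫ post _ (eId V (G.obj c)))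
    rw [eId_comp_post, post_eId, Category.comp_id]
  comp_whiskerLeft {A B C D} F G {H I} η := VFunctor.hom_ext fun c => by
    show VNatTrans.app η (G.obj (F.obj c)) =
      eId V _ ≫ post _ (VNatTrans.app η (G.obj (F.obj c)) ≫ post _ (eId V _))
    rw [eId_comp_post, post_eId, Category.comp_id]
  id_whiskerRight F G := VFunctor.hom_ext fun c => G.map_id (F.obj c)
  comp_whiskerRight {A B C F G H} η θ I := VFunctor.hom_ext fun c => by
    show (VNatTrans.app η c ≫ post _ (VNatTrans.app θ c)) ≫ I.map _ _ =
      (VNatTrans.app η c ≫ I.map _ _) ≫ post _ (VNatTrans.app θ c ≫ I.map _ _)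
    rw [Category.assoc, map_post, Category.assoc]
  whiskerRight_id {A B F G} η := VFunctor.hom_ext fun c => by
    show VNatTrans.app η c ≫ 𝟙 _ = eId V _ ≫ post _ (VNatTrans.app η c ≫ post _ (eId V (G.obj c)))
    rw [eId_comp_post, post_eId]
  whiskerRight_comp {A B C D F F'} η G H := VFunctor.hom_ext fun c => by
    show VNatTrans.app η c ≫ (G.map _ _ ≫ H.map _ _) =
      eId V _ ≫ post _ (((VNatTrans.app η c ≫ G.map _ _) ≫ H.map _ _) ≫ post _ (eId V _))
    rw [eId_comp_post, post_eId, Category.comp_id, Category.assoc]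
  whisker_assoc {A B C D} F {G G'} η H := VFunctor.hom_ext fun c => by
    show VNatTrans.app η (F.obj c) ≫ H.map _ _ =
      eId V _ ≫ post _ ((VNatTrans.app η (F.obj c) ≫ H.map _ _) ≫ post _ (eId V _))
    rw [eId_comp_post, post_eId, Category.comp_id]
  whisker_exchange {A B C F G H I} η θ := VFunctor.hom_ext fun c => by
    show VNatTrans.app θ (F.obj c) ≫ post _ (VNatTrans.app η c ≫ I.map _ _) =
      (VNatTrans.app η c ≫ H.map _ _) ≫ post _ (VNatTrans.app θ (G.obj c))
    rw [comp_post_eq_comp_pre, Category.assoc, Category.assoc, VNatTrans.naturality θ]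
  pentagon {A B C D E} F G H I := VFunctor.hom_ext fun c => by
    show (eId V _ ≫ I.map _ _) ≫ post _ (eId V _ ≫ post _ (eId V _)) = eId V _ ≫ post _ (eId V _)
    rw [I.map_id, eId_comp_post]
  triangle {A B C} F G := VFunctor.hom_ext fun c => by
    show eId V _ ≫ post _ (eId V (G.obj (F.obj c))) = eId V _ ≫ G.map _ _
    rw [eId_comp_post, G.map_id]

end Enriched

section Tensor

open MonoidalCategory

variable {V : Type v} [Category.{u} V] [MonoidalCategory V] [BraidedCategory V]

theorem tensor_pre_aux {A A' X X' Y Y' : V} (f : 𝟙_ V ⟶ A) (f' : 𝟙_ V ⟶ A') (m : A ⊗ X ⟶ Y)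
    (m' : A' ⊗ X' ⟶ Y') :
    (λ_ (X ⊗ X')).inv ≫ ((λ_ (𝟙_ V)).inv ≫ (f ⊗ₘ f')) ▷ (X ⊗ X') ≫ tensorμ A A' X X' ≫
      (m ⊗ₘ m') = ((λ_ X).inv ≫ f ▷ X ≫ m) ⊗ₘ ((λ_ X').inv ≫ f' ▷ X' ≫ m') := by
  rw [comp_whiskerRight, Category.assoc, tensorμ_natural_left_assoc, Iso.inv_comp_eq,
    tensor_left_unitality]
  simp only [Category.assoc, tensorHom_comp_tensorHom, Iso.hom_inv_id_assoc]

theorem tensor_post_aux {A A' X X' Y Y' : V} (f : 𝟙_ V ⟶ A) (f' : 𝟙_ V ⟶ A') (m : X ⊗ A ⟶ Y)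
    (m' : X' ⊗ A' ⟶ Y') :
    (ρ_ (X ⊗ X')).inv ≫ (X ⊗ X') ◁ ((λ_ (𝟙_ V)).inv ≫ (f ⊗ₘ f')) ≫ tensorμ X X' A A' ≫
      (m ⊗ₘ m') = ((ρ_ X).inv ≫ X ◁ f ≫ m) ⊗ₘ ((ρ_ X').inv ≫ X' ◁ f' ≫ m') := by
  rw [MonoidalCategory.whiskerLeft_comp, Category.assoc, tensorμ_natural_right_assoc,
    Iso.inv_comp_eq, tensor_right_unitality]
  simp only [Category.assoc, tensorHom_comp_tensorHom, Iso.hom_inv_id_assoc]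

/-- The tensor product of two `V`-categories: objects are pairs, the hom-object from `(c, d)` to
`(c', d')` is `C(c, c') ⊗ D(d, d')`, and the composition uses the symmetry of `V`. -/
instance tensorEnriched (C D : Type u) [EnrichedCategory V C] [EnrichedCategory V D] :
    EnrichedCategory V (C × D) where
  Hom x y := (x.1 ⟶[V] y.1) ⊗ (x.2 ⟶[V] y.2)
  id x := (λ_ (𝟙_ V)).inv ≫ (eId V x.1 ⊗ₘ eId V x.2)
  comp x y z := tensorμ _ _ _ _ ≫ (eComp V x.1 y.1 z.1 ⊗ₘ eComp V x.2 y.2 z.2)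
  id_comp x y := by
    rw [tensor_pre_aux, e_id_comp, e_id_comp, id_tensorHom_id]
  comp_id x y := by
    rw [tensor_post_aux, e_comp_id, e_comp_id, id_tensorHom_id]
  assoc w x y z := by
    rw [Iso.inv_comp_eq]
    simp only [comp_whiskerRight, MonoidalCategory.whiskerLeft_comp, Category.assoc]
    rw [tensorμ_natural_left_assoc, tensorμ_natural_right_assoc, ← tensor_associativity_assoc]
    simp only [tensorHom_comp_tensorHom, e_assoc']

variable {C C' D D' : Type u} [EnrichedCategory V C] [EnrichedCategory V C']
  [EnrichedCategory V D] [EnrichedCategory V D']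

/-- The arrow `(f, g)` of the underlying category of `C ⊗ D`. -/
def pair {c c' : C} {d d' : D} (f : 𝟙_ V ⟶ (c ⟶[V] c')) (g : 𝟙_ V ⟶ (d ⟶[V] d')) :
    𝟙_ V ⟶ ((c, d) ⟶[V] (c', d')) :=
  (λ_ (𝟙_ V)).inv ≫ (f ⊗ₘ g)

theorem post_pair (x : C × D) {c c' : C} {d d' : D} (f : 𝟙_ V ⟶ (c ⟶[V] c'))
    (g : 𝟙_ V ⟶ (d ⟶[V] d')) : post x (pair f g) = (post x.1 f ⊗ₘ post x.2 g) :=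
  tensor_post_aux _ _ _ _

theorem pre_pair {c c' : C} {d d' : D} (f : 𝟙_ V ⟶ (c ⟶[V] c')) (g : 𝟙_ V ⟶ (d ⟶[V] d'))
    (x : C × D) : pre (pair f g) x = (pre f x.1 ⊗ₘ pre g x.2) :=
  tensor_pre_aux _ _ _ _

/-- The tensor product of two `V`-functors. -/
def VFunctor.tensor (F : VFunctor (V := V) C C') (G : VFunctor (V := V) D D') :
    VFunctor (V := V) (C × D) (C' × D') where
  obj x := (F.obj x.1, G.obj x.2)
  map x y := F.map x.1 y.1 ⊗ₘ G.map x.2 y.2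
  map_id x := by
    show ((λ_ (𝟙_ V)).inv ≫ (eId V x.1 ⊗ₘ eId V x.2)) ≫ _ = (λ_ (𝟙_ V)).inv ≫ (eId V _ ⊗ₘ eId V _)
    rw [Category.assoc, tensorHom_comp_tensorHom, F.map_id, G.map_id]
  map_comp x y z := by
    show (tensorμ _ _ _ _ ≫ (eComp V x.1 y.1 z.1 ⊗ₘ eComp V x.2 y.2 z.2)) ≫ _ =
      _ ≫ tensorμ _ _ _ _ ≫ (eComp V _ _ _ ⊗ₘ eComp V _ _ _)
    rw [Category.assoc, tensorHom_comp_tensorHom, F.map_comp, G.map_comp, tensorμ_natural_assoc,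
      tensorHom_comp_tensorHom]

theorem tensor_naturality {X X' : V} {c₁ c₂ c₃ c₄ : C} {d₁ d₂ d₃ d₄ : D}
    (m : X ⟶ (c₁ ⟶[V] c₂)) (n : X' ⟶ (d₁ ⟶[V] d₂)) (m' : X ⟶ (c₃ ⟶[V] c₄))
    (n' : X' ⟶ (d₃ ⟶[V] d₄)) (f : 𝟙_ V ⟶ (c₂ ⟶[V] c₄)) (g : 𝟙_ V ⟶ (d₂ ⟶[V] d₄))
    (f' : 𝟙_ V ⟶ (c₁ ⟶[V] c₃)) (g' : 𝟙_ V ⟶ (d₁ ⟶[V] d₃))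
    (hm : m ≫ post c₁ f = m' ≫ pre f' c₄) (hn : n ≫ post d₁ g = n' ≫ pre g' d₄) :
    (m ⊗ₘ n : X ⊗ X' ⟶ ((c₁, d₁) ⟶[V] (c₂, d₂))) ≫ post (c₁, d₁) (pair f g) =
      (m' ⊗ₘ n' : X ⊗ X' ⟶ ((c₃, d₃) ⟶[V] (c₄, d₄))) ≫ pre (pair f' g') (c₄, d₄) := by
  rw [post_pair, pre_pair]
  refine (tensorHom_comp_tensorHom _ _ _ _).trans
    (Eq.trans ?_ (tensorHom_comp_tensorHom _ _ _ _).symm)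
  rw [hm, hn]

/-- The tensor product of two `V`-natural transformations. -/
def VFunctor.tensor₂ {F F' : VFunctor (V := V) C C'} {G G' : VFunctor (V := V) D D'}
    (α : F ⟶ F') (β : G ⟶ G') : F.tensor G ⟶ F'.tensor G' :=
  { app := fun x => pair (VNatTrans.app α x.1) (VNatTrans.app β x.2)
    naturality := fun x y => tensor_naturality _ _ _ _ _ _ _ _
      (VNatTrans.naturality α x.1 y.1) (VNatTrans.naturality β x.2 y.2) }

theorem pair_comp_post_pair {c c' c'' : C} {d d' d'' : D} (f : 𝟙_ V ⟶ (c ⟶[V] c'))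
    (g : 𝟙_ V ⟶ (d ⟶[V] d')) (f' : 𝟙_ V ⟶ (c' ⟶[V] c'')) (g' : 𝟙_ V ⟶ (d' ⟶[V] d'')) :
    pair f g ≫ post (c, d) (pair f' g') = pair (f ≫ post c f') (g ≫ post d g') := by
  rw [post_pair]
  unfold pair
  rw [Category.assoc]
  exact congrArg _ (tensorHom_comp_tensorHom _ _ _ _)

theorem pair_comp_map (F : VFunctor (V := V) C C') (G : VFunctor (V := V) D D') {c c' : C}
    {d d' : D} (f : 𝟙_ V ⟶ (c ⟶[V] c')) (g : 𝟙_ V ⟶ (d ⟶[V] d')) :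
    pair f g ≫ (F.tensor G).map (c, d) (c', d') = pair (f ≫ F.map c c') (g ≫ G.map d d') :=
  (Category.assoc _ _ _).trans (congrArg _ (tensorHom_comp_tensorHom _ _ _ _))

variable (V) in
/-- The tensor product of `V`-categories as a pseudofunctor `V-Cat × V-Cat ⥤ V-Cat`. -/
def tensor : Pseudofunctor (VCat.{u, v} V × VCat.{u, v} V) (VCat.{u, v} V) where
  obj X := ⟨X.1.carrier × X.2.carrier⟩
  map F := VFunctor.tensor F.1 F.2
  map₂ α := VFunctor.tensor₂ α.1 α.2
  map₂_id F := VFunctor.hom_ext fun x => rfl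
  map₂_comp {X Y F G H} α β := VFunctor.hom_ext fun x => (pair_comp_post_pair _ _ _ _).symm
  mapId X :=
    { hom :=
        { app := fun x => eId V x
          naturality := fun x y => id_naturality _ _ (id_tensorHom_id _ _) }
      inv :=
        { app := fun x => eId V x
          naturality := fun x y => id_naturality _ _ (id_tensorHom_id _ _).symm }
      hom_inv_id := VFunctor.hom_ext fun _ => eId_comp_post _
      inv_hom_id := VFunctor.hom_ext fun _ => eId_comp_post _ }
  mapComp {X Y Z} F G :=
    { hom :=
        { app := fun x => eId V (G.1.obj (F.1.obj x.1), G.2.obj (F.2.obj x.2))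
          naturality := fun x y => id_naturality _ _ (tensorHom_comp_tensorHom _ _ _ _).symm }
      inv :=
        { app := fun x => eId V (G.1.obj (F.1.obj x.1), G.2.obj (F.2.obj x.2))
          naturality := fun x y => id_naturality _ _ (tensorHom_comp_tensorHom _ _ _ _) }
      hom_inv_id := VFunctor.hom_ext fun _ => eId_comp_post _
      inv_hom_id := VFunctor.hom_ext fun _ => eId_comp_post _ }
  map₂_whisker_left {X Y Z} F {G H} η := VFunctor.hom_ext fun x => by
    show pair (VNatTrans.app η.1 (F.1.obj x.1)) (VNatTrans.app η.2 (F.2.obj x.2)) =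
      eId V _ ≫ post _ (pair (VNatTrans.app η.1 (F.1.obj x.1))
        (VNatTrans.app η.2 (F.2.obj x.2)) ≫ post _ (eId V _))
    rw [eId_comp_post, post_eId, Category.comp_id]
  map₂_whisker_right {X Y Z F G} η H := VFunctor.hom_ext fun x => by
    show pair (VNatTrans.app η.1 x.1 ≫ H.1.map _ _) (VNatTrans.app η.2 x.2 ≫ H.2.map _ _) =
      eId V _ ≫ post _ ((pair (VNatTrans.app η.1 x.1) (VNatTrans.app η.2 x.2) ≫
        (H.1.tensor H.2).map _ _) ≫ post _ (eId V _))
    rw [eId_comp_post, post_eId, Category.comp_id, pair_comp_map]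
  map₂_associator {X Y Z T} F G H := VFunctor.hom_ext fun x => by
    show eId V (H.1.obj (G.1.obj (F.1.obj x.1)), H.2.obj (G.2.obj (F.2.obj x.2))) =
      eId V _ ≫ post _ ((eId V (G.1.obj (F.1.obj x.1), G.2.obj (F.2.obj x.2)) ≫
        (H.1.tensor H.2).map _ _) ≫ post _ (eId V _ ≫ post _ (eId V _ ≫ post _ (eId V _))))
    rw [(H.1.tensor H.2).map_id]
    simp only [eId_comp_post]
    rfl
  map₂_left_unitor {X Y} F := VFunctor.hom_ext fun x => by
    show eId V (F.1.obj x.1, F.2.obj x.2) =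
      eId V _ ≫ post _ ((eId V (x.1, x.2) ≫ (F.1.tensor F.2).map _ _) ≫ post _ (eId V _))
    rw [(F.1.tensor F.2).map_id]
    simp only [eId_comp_post]
    rfl
  map₂_right_unitor {X Y} F := VFunctor.hom_ext fun x => by
    show eId V (F.1.obj x.1, F.2.obj x.2) =
      eId V _ ≫ post _ (eId V (F.1.obj x.1, F.2.obj x.2) ≫ post _ (eId V _))
    simp only [eId_comp_post]

variable (C₀ : VCat.{u, v} V)

/-- The pseudofunctor `C₀ ⊗ -` on `V-Cat`. -/
def tensorLeft : Pseudofunctor (VCat.{u, v} V) (VCat.{u, v} V) :=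
  (Bicategory.Prod.sectR C₀ (VCat.{u, v} V)).toPseudofunctor.comp (tensor V)

/-- The pseudofunctor `- ⊗ C₀` on `V-Cat`. -/
def tensorRight : Pseudofunctor (VCat.{u, v} V) (VCat.{u, v} V) :=
  (Bicategory.Prod.sectL (VCat.{u, v} V) C₀).toPseudofunctor.comp (tensor V)

end Tensor

section Bicolimits

open Bicategory
open scoped CategoryTheory.Pseudofunctor.StrongTrans

theorem cat_ext {C D : Cat.{u, u}} {F G : C ⟶ D} {α β : F ⟶ G}
    (h : ∀ x, α.toNatTrans.app x = β.toNatTrans.app x) : α = β :=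
  Cat.Hom₂.ext (NatTrans.ext (funext h))

section Yoneda

variable {B : Type v} [Bicategory.{u, u} B]

/-- The covariant representable pseudofunctor `B(a, -)`. -/
def corepresentable (a : B) : Pseudofunctor B Cat.{u, u} where
  obj b := Cat.of (a ⟶ b)
  map g := (postcomp a g).toCatHom
  map₂ η := ((postcomposing a _ _).map η).toCatHom₂
  map₂_id g := cat_ext fun (x : a ⟶ _) => whiskerLeft_id x g
  map₂_comp η θ := cat_ext fun (x : a ⟶ _) => whiskerLeft_comp x η θ
  mapId b := Cat.Hom.isoMk (NatIso.ofComponents (fun x => ρ_ x)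
    (fun f => rightUnitor_naturality f))
  mapComp g h := Cat.Hom.isoMk (NatIso.ofComponents (fun x => (α_ x g h).symm)
    (fun f => associator_inv_naturality_left f g h))
  map₂_whisker_left f g h η := cat_ext fun (x : a ⟶ _) => by
    show x ◁ f ◁ η = (α_ x f g).inv ≫ (x ≫ f) ◁ η ≫ (α_ x f h).hom
    simp
  map₂_whisker_right {a' b' c' f g} η h := cat_ext fun (x : a ⟶ _) => by
    show x ◁ (η ▷ h) = (α_ x f h).inv ≫ (x ◁ η) ▷ h ≫ (α_ x g h).hom
    simp
  map₂_associator f g h := cat_ext fun (x : a ⟶ _) => by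
    show x ◁ (α_ f g h).hom = (α_ x (f ≫ g) h).inv ≫ (α_ x f g).inv ▷ h ≫ 𝟙 _ ≫
      (α_ (x ≫ f) g h).hom ≫ (α_ x f (g ≫ h)).hom
    simp
  map₂_left_unitor f := cat_ext fun (x : a ⟶ _) => by
    show x ◁ (λ_ f).hom = (α_ x (𝟙 _) f).inv ≫ (ρ_ x).hom ▷ f ≫ 𝟙 _
    simp
  map₂_right_unitor f := cat_ext fun (x : a ⟶ _) => by
    show x ◁ (ρ_ f).hom = (α_ x f (𝟙 _)).inv ≫ (ρ_ (x ≫ f)).hom ≫ 𝟙 _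
    simp

/-- The bicategorical Yoneda construction: an arrow `l : w ⟶ H L` induces the pseudonatural
transformation `A(L, -) ⟶ A'(w, H -)` with components `F ↦ l ≫ H F`. -/
def yonedaTrans {B' : Type v'} [Bicategory.{u, u} B'] (H : Pseudofunctor B B') {w : B'} {L : B}
    (l : w ⟶ H.obj L) :
    Pseudofunctor.StrongTrans (corepresentable L) (H.comp (corepresentable w)) where
  app E := (H.mapFunctor L E ⋙ precomp (H.obj E) l).toCatHom
  naturality {E E'} g := Cat.Hom.isoMk (NatIso.ofComponents
    (fun (F : L ⟶ E) => whiskerLeftIso l (H.mapComp F g) ≪≫ (α_ l (H.map F) (H.map g)).symm)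
    (fun {F F' : L ⟶ E} (f : F ⟶ F') => by
      show l ◁ H.map₂ (f ▷ g) ≫ l ◁ (H.mapComp F' g).hom ≫ (α_ l (H.map F') (H.map g)).inv =
        (l ◁ (H.mapComp F g).hom ≫ (α_ l (H.map F) (H.map g)).inv) ≫ (l ◁ H.map₂ f) ▷ H.map g
      simp))
  naturality_naturality {E E' g g'} η := cat_ext fun (F : L ⟶ E) => by
    show l ◁ H.map₂ (F ◁ η) ≫ (l ◁ (H.mapComp F g').hom ≫ (α_ l (H.map F) (H.map g')).inv) =
      (l ◁ (H.mapComp F g).hom ≫ (α_ l (H.map F) (H.map g)).inv) ≫ (l ≫ H.map F) ◁ H.map₂ η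
    simp
  naturality_id E := cat_ext fun (F : L ⟶ E) => by
    show (l ◁ (H.mapComp F (𝟙 E)).hom ≫ (α_ l (H.map F) (H.map (𝟙 E))).inv) ≫
        ((l ≫ H.map F) ◁ (H.mapId E).hom ≫ (ρ_ (l ≫ H.map F)).hom) =
      l ◁ H.map₂ (ρ_ F).hom ≫ 𝟙 _ ≫ 𝟙 _
    simp
  naturality_comp {E E' E''} g h := cat_ext fun (F : L ⟶ E) => by
    show (l ◁ (H.mapComp F (g ≫ h)).hom ≫ (α_ l (H.map F) (H.map (g ≫ h))).inv) ≫
        ((l ≫ H.map F) ◁ (H.mapComp g h).hom ≫ (α_ (l ≫ H.map F) (H.map g) (H.map h)).inv) =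
      l ◁ H.map₂ (α_ F g h).inv ≫ 𝟙 _ ≫
        (l ◁ (H.mapComp (F ≫ g) h).hom ≫ (α_ l (H.map (F ≫ g)) (H.map h)).inv) ≫ 𝟙 _ ≫
        (l ◁ (H.mapComp F g).hom ≫ (α_ l (H.map F) (H.map g)).inv) ▷ H.map h ≫ 𝟙 _
    have key : H.map₂ (α_ F g h).inv =
        (H.mapComp F (g ≫ h)).hom ≫ H.map F ◁ (H.mapComp g h).hom ≫
          (α_ _ _ _).inv ≫ (H.mapComp F g).inv ▷ H.map h ≫ (H.mapComp (F ≫ g) h).inv := by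
      rw [H.mapComp_assoc_right_hom_assoc]
      simp
    rw [key]
    simp

end Yoneda

variable {D : Type u} [Bicategory.{u, u} D] {B : Type v} [Bicategory.{u, u} B]

/-- The pseudofunctor `d ↦ B(X d, E)`. -/
def homTo (X : Pseudofunctor D B) (E : B) : Pseudofunctor Dᵒᵖ Cat.{u, u} where
  obj d := Cat.of (X.obj d.unop ⟶ E)
  map f := (precomp E (X.map f.unop)).toCatHom
  map₂ η := ((precomposing _ _ E).map (X.map₂ η.unop2)).toCatHom₂
  map₂_id f := cat_ext fun (x : X.obj _ ⟶ E) => by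
    show X.map₂ (𝟙 f.unop) ▷ x = 𝟙 _
    simp
  map₂_comp η θ := cat_ext fun (x : X.obj _ ⟶ E) => by
    show X.map₂ (η.unop2 ≫ θ.unop2) ▷ x = X.map₂ η.unop2 ▷ x ≫ X.map₂ θ.unop2 ▷ x
    simp
  mapId d := Cat.Hom.isoMk (NatIso.ofComponents
    (fun x => whiskerRightIso (X.mapId d.unop) x ≪≫ λ_ x)
    (fun {x y} f => by
      show X.map (𝟙 _) ◁ f ≫ (X.mapId d.unop).hom ▷ y ≫ (λ_ y).hom =
        ((X.mapId d.unop).hom ▷ x ≫ (λ_ x).hom) ≫ f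
      rw [whisker_exchange_assoc, leftUnitor_naturality, Category.assoc]))
  mapComp f g := Cat.Hom.isoMk (NatIso.ofComponents
    (fun x => whiskerRightIso (X.mapComp g.unop f.unop) x ≪≫ α_ _ _ x)
    (fun {x y} h => by
      show X.map (g.unop ≫ f.unop) ◁ h ≫ (X.mapComp g.unop f.unop).hom ▷ y ≫ (α_ _ _ y).hom =
        ((X.mapComp g.unop f.unop).hom ▷ x ≫ (α_ _ _ x).hom) ≫ X.map g.unop ◁ X.map f.unop ◁ h
      rw [whisker_exchange_assoc]
      simp))
  map₂_whisker_left f g h η := cat_ext fun (x : X.obj _ ⟶ E) => by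
    show X.map₂ (η.unop2 ▷ f.unop) ▷ x = ((X.mapComp g.unop f.unop).hom ▷ x ≫ (α_ _ _ x).hom) ≫
      X.map₂ η.unop2 ▷ (X.map f.unop ≫ x) ≫ ((α_ _ _ x).inv ≫ (X.mapComp h.unop f.unop).inv ▷ x)
    simp
  map₂_whisker_right {a' b' c' f g} η h := cat_ext fun (x : X.obj _ ⟶ E) => by
    show X.map₂ (h.unop ◁ η.unop2) ▷ x = ((X.mapComp h.unop f.unop).hom ▷ x ≫ (α_ _ _ x).hom) ≫
      X.map h.unop ◁ X.map₂ η.unop2 ▷ x ≫ ((α_ _ _ x).inv ≫ (X.mapComp h.unop g.unop).inv ▷ x)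
    simp
  map₂_associator f g h := cat_ext fun (x : X.obj _ ⟶ E) => by
    show X.map₂ (α_ h.unop g.unop f.unop).inv ▷ x =
      ((X.mapComp h.unop (g.unop ≫ f.unop)).hom ▷ x ≫ (α_ _ _ x).hom) ≫
      X.map h.unop ◁ ((X.mapComp g.unop f.unop).hom ▷ x ≫ (α_ _ _ x).hom) ≫ 𝟙 _ ≫
      ((α_ _ _ (X.map f.unop ≫ x)).inv ≫ (X.mapComp h.unop g.unop).inv ▷ (X.map f.unop ≫ x)) ≫
      ((α_ _ _ x).inv ≫ (X.mapComp (h.unop ≫ g.unop) f.unop).inv ▷ x)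
    have key : X.map₂ (α_ h.unop g.unop f.unop).inv =
        (X.mapComp h.unop (g.unop ≫ f.unop)).hom ≫ X.map h.unop ◁ (X.mapComp g.unop f.unop).hom ≫
          (α_ _ _ _).inv ≫ (X.mapComp h.unop g.unop).inv ▷ X.map f.unop ≫
          (X.mapComp (h.unop ≫ g.unop) f.unop).inv := by
      rw [X.mapComp_assoc_right_hom_assoc]
      simp
    rw [key]
    simp
  map₂_left_unitor f := cat_ext fun (x : X.obj _ ⟶ E) => by
    show X.map₂ (ρ_ f.unop).hom ▷ x = ((X.mapComp f.unop (𝟙 _)).hom ▷ x ≫ (α_ _ _ x).hom) ≫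
      X.map f.unop ◁ ((X.mapId _).hom ▷ x ≫ (λ_ x).hom) ≫ 𝟙 _
    simp
  map₂_right_unitor f := cat_ext fun (x : X.obj _ ⟶ E) => by
    show X.map₂ (λ_ f.unop).hom ▷ x = ((X.mapComp (𝟙 _) f.unop).hom ▷ x ≫ (α_ _ _ x).hom) ≫
      ((X.mapId _).hom ▷ (X.map f.unop ≫ x) ≫ (λ_ (X.map f.unop ≫ x)).hom) ≫ 𝟙 _
    simp

/-- The pseudonatural transformation `B(X -, E) ⟶ B(X -, E')` given by composing with
`g : E ⟶ E'`. -/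
def homToMap (X : Pseudofunctor D B) {E E' : B} (g : E ⟶ E') : homTo X E ⟶ homTo X E' where
  app d := (postcomp (X.obj d.unop) g).toCatHom
  naturality f := Cat.Hom.isoMk (NatIso.ofComponents (fun x => α_ (X.map f.unop) x g)
    (fun h => associator_naturality_middle _ h g))
  naturality_naturality {a b f f'} η := cat_ext fun (x : X.obj _ ⟶ E) => by
    show (X.map₂ η.unop2 ▷ x) ▷ g ≫ (α_ (X.map f'.unop) x g).hom =
      (α_ (X.map f.unop) x g).hom ≫ X.map₂ η.unop2 ▷ (x ≫ g)
    simp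
  naturality_id a := cat_ext fun (x : X.obj _ ⟶ E) => by
    show (α_ (X.map (𝟙 _)) x g).hom ≫ ((X.mapId _).hom ▷ (x ≫ g) ≫ (λ_ (x ≫ g)).hom) =
      ((X.mapId _).hom ▷ x ≫ (λ_ x).hom) ▷ g ≫ 𝟙 _ ≫ 𝟙 _
    simp
  naturality_comp f h := cat_ext fun (x : X.obj _ ⟶ E) => by
    show (α_ (X.map (h.unop ≫ f.unop)) x g).hom ≫
        ((X.mapComp h.unop f.unop).hom ▷ (x ≫ g) ≫ (α_ _ _ (x ≫ g)).hom) =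
      ((X.mapComp h.unop f.unop).hom ▷ x ≫ (α_ _ _ x).hom) ▷ g ≫ 𝟙 _ ≫
        (α_ (X.map h.unop) (X.map f.unop ≫ x) g).hom ≫ 𝟙 _ ≫
        X.map h.unop ◁ (α_ (X.map f.unop) x g).hom ≫ 𝟙 _
    simp

/-- The modification between the transformations `B(X -, E) ⟶ B(X -, E')` induced by a 2-cell. -/
def homToMap₂ (X : Pseudofunctor D B) {E E' : B} {g g' : E ⟶ E'} (η : g ⟶ g') :
    homToMap X g ⟶ homToMap X g' where
  as :=
    { app := fun d => ((postcomposing (X.obj d.unop) E E').map η).toCatHom₂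
      naturality := fun {a b} f => cat_ext fun (x : X.obj _ ⟶ E) => by
        show (X.map f.unop ≫ x) ◁ η ≫ (α_ (X.map f.unop) x g').hom =
          (α_ (X.map f.unop) x g).hom ≫ X.map f.unop ◁ x ◁ η
        simp }

theorem strong_ext {F G : Pseudofunctor Dᵒᵖ Cat.{u, u}} {σ τ : F ⟶ G} {Γ Γ' : σ ⟶ τ}
    (h : ∀ d x, (Γ.as.app d).toNatTrans.app x = (Γ'.as.app d).toNatTrans.app x) : Γ = Γ' :=
  Pseudofunctor.StrongTrans.homCategory.ext fun d => cat_ext (h d)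

/-- The pseudofunctor `E ↦ B(X -, E)` from `B` to the 2-category of pseudofunctors
`Dᵒᵖ ⥤ Cat`, pseudonatural transformations and modifications. -/
def restrictedYoneda (X : Pseudofunctor D B) :
    Pseudofunctor B (Pseudofunctor Dᵒᵖ Cat.{u, u}) where
  obj E := homTo X E
  map g := homToMap X g
  map₂ η := homToMap₂ X η
  map₂_id g := strong_ext fun d (x : X.obj _ ⟶ _) => whiskerLeft_id x g
  map₂_comp η θ := strong_ext fun d (x : X.obj _ ⟶ _) => whiskerLeft_comp x η θ
  mapId E := Pseudofunctor.StrongTrans.isoMk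
    (fun d => Cat.Hom.isoMk (NatIso.ofComponents (fun x => ρ_ x)
      (fun f => rightUnitor_naturality f)))
    (fun {a b} f => cat_ext fun (x : X.obj _ ⟶ _) => by
      show (ρ_ (X.map f.unop ≫ x)).hom ≫ (𝟙 _ ≫ 𝟙 _) =
        (α_ (X.map f.unop) x (𝟙 E)).hom ≫ X.map f.unop ◁ (ρ_ x).hom
      simp)
  mapComp g h := Pseudofunctor.StrongTrans.isoMk
    (fun d => Cat.Hom.isoMk (NatIso.ofComponents (fun x => (α_ x g h).symm)
      (fun f => associator_inv_naturality_left f g h)))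
    (fun {a b} f => cat_ext fun (x : X.obj _ ⟶ _) => by
      show (α_ (X.map f.unop ≫ x) g h).inv ≫ (𝟙 _ ≫ (α_ (X.map f.unop) x g).hom ▷ h ≫ 𝟙 _ ≫
          (α_ (X.map f.unop) (x ≫ g) h).hom ≫ 𝟙 _) =
        (α_ (X.map f.unop) x (g ≫ h)).hom ≫ X.map f.unop ◁ (α_ x g h).inv
      simp)
  map₂_whisker_left f g h η := strong_ext fun d (x : X.obj _ ⟶ _) => by
    show x ◁ f ◁ η = (α_ x f g).inv ≫ (x ≫ f) ◁ η ≫ (α_ x f h).hom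
    simp
  map₂_whisker_right {a' b' c' f g} η h := strong_ext fun d (x : X.obj _ ⟶ _) => by
    show x ◁ (η ▷ h) = (α_ x f h).inv ≫ (x ◁ η) ▷ h ≫ (α_ x g h).hom
    simp
  map₂_associator f g h := strong_ext fun d (x : X.obj _ ⟶ _) => by
    show x ◁ (α_ f g h).hom = (α_ x (f ≫ g) h).inv ≫ (α_ x f g).inv ▷ h ≫ 𝟙 _ ≫
      (α_ (x ≫ f) g h).hom ≫ (α_ x f (g ≫ h)).hom
    simp
  map₂_left_unitor f := strong_ext fun d (x : X.obj _ ⟶ _) => by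
    show x ◁ (λ_ f).hom = (α_ x (𝟙 _) f).inv ≫ (ρ_ x).hom ▷ f ≫ 𝟙 _
    simp
  map₂_right_unitor f := strong_ext fun d (x : X.obj _ ⟶ _) => by
    show x ◁ (ρ_ f).hom = (α_ x f (𝟙 _)).inv ≫ (ρ_ (x ≫ f)).hom ≫ 𝟙 _
    simp

/-- The pseudofunctor `E ↦ Hom(W, B(X -, E))` of `W`-weighted cocones under `X`. -/
def cocones (W : Pseudofunctor Dᵒᵖ Cat.{u, u}) (X : Pseudofunctor D B) :
    Pseudofunctor B Cat.{u, u} :=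
  (restrictedYoneda X).comp (corepresentable W)

/-- A `W`-weighted cocone under `X` with vertex `L`: a pseudonatural transformation
`W ⟶ B(X -, L)`. -/
abbrev Cocone (W : Pseudofunctor Dᵒᵖ Cat.{u, u}) (X : Pseudofunctor D B) (L : B) :=
  W ⟶ homTo X L

/-- The pseudonatural transformation `B(L, -) ⟶ Hom(W, B(X -, -))` induced by a weighted cocone
with vertex `L`. -/
def Cocone.comparison {W : Pseudofunctor Dᵒᵖ Cat.{u, u}} {X : Pseudofunctor D B} {L : B}
    (l : Cocone W X L) : corepresentable L ⟶ cocones W X :=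
  yonedaTrans (restrictedYoneda X) l

/-- A weighted cocone exhibits its vertex `L` as the `W`-weighted bicolimit of `X` if the induced
transformation `B(L, E) ⟶ Hom(W, B(X -, E))`, pseudonatural in `E`, consists of equivalences of
categories. -/
def Cocone.IsBicolimit {W : Pseudofunctor Dᵒᵖ Cat.{u, u}} {X : Pseudofunctor D B} {L : B}
    (l : Cocone W X L) : Prop :=
  ∀ E : B, (l.comparison.app E).toFunctor.IsEquivalence

variable (B) in
/-- `B` admits all (small, weighted) bicolimits. -/
def HasBicolimits : Prop :=
  ∀ (D : Type u) [Bicategory.{u, u} D] (W : Pseudofunctor Dᵒᵖ Cat.{u, u}) (X : Pseudofunctor D B),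
    ∃ (L : B) (l : Cocone W X L), l.IsBicolimit

variable {B' : Type v'} [Bicategory.{u, u} B']

/-- The pseudonatural transformation `B(X -, L) ⟶ B'(T X -, T L)` given by the action of `T` on
hom-categories. -/
def homToComp (T : Pseudofunctor B B') (X : Pseudofunctor D B) (L : B) :
    homTo X L ⟶ homTo (X.comp T) (T.obj L) where
  app d := (T.mapFunctor (X.obj d.unop) L).toCatHom
  naturality {a b} f := Cat.Hom.isoMk (NatIso.ofComponents
    (fun (x : X.obj a.unop ⟶ L) => T.mapComp (X.map f.unop) x)
    (fun {x y : X.obj a.unop ⟶ L} (h : x ⟶ y) => by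
      show T.map₂ (X.map f.unop ◁ h) ≫ (T.mapComp (X.map f.unop) y).hom =
        (T.mapComp (X.map f.unop) x).hom ≫ T.map (X.map f.unop) ◁ T.map₂ h
      simp))
  naturality_naturality {a b f g} η := cat_ext fun (x : X.obj a.unop ⟶ L) => by
    show T.map₂ (X.map₂ η.unop2 ▷ x) ≫ (T.mapComp (X.map g.unop) x).hom =
      (T.mapComp (X.map f.unop) x).hom ≫ T.map₂ (X.map₂ η.unop2) ▷ T.map x
    simp
  naturality_id a := cat_ext fun (x : X.obj a.unop ⟶ L) => by
    show (T.mapComp (X.map (𝟙 _)) x).hom ≫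
        ((T.map₂ (X.mapId _).hom ≫ (T.mapId _).hom) ▷ T.map x ≫ (λ_ (T.map x)).hom) =
      T.map₂ ((X.mapId _).hom ▷ x ≫ (λ_ x).hom) ≫ 𝟙 _ ≫ 𝟙 _
    simp
  naturality_comp {a b c} f g := cat_ext fun (x : X.obj a.unop ⟶ L) => by
    show (T.mapComp (X.map (g.unop ≫ f.unop)) x).hom ≫
        ((T.map₂ (X.mapComp g.unop f.unop).hom ≫ (T.mapComp _ _).hom) ▷ T.map x ≫
          (α_ _ _ (T.map x)).hom) =
      T.map₂ ((X.mapComp g.unop f.unop).hom ▷ x ≫ (α_ _ _ x).hom) ≫ 𝟙 _ ≫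
        (T.mapComp (X.map g.unop) (X.map f.unop ≫ x)).hom ≫ 𝟙 _ ≫
        T.map (X.map g.unop) ◁ (T.mapComp (X.map f.unop) x).hom ≫ 𝟙 _
    simp

/-- The image of a weighted cocone under a pseudofunctor. -/
def Cocone.map (T : Pseudofunctor B B') {W : Pseudofunctor Dᵒᵖ Cat.{u, u}}
    {X : Pseudofunctor D B} {L : B} (l : Cocone W X L) : Cocone W (X.comp T) (T.obj L) :=
  l ≫ homToComp T X L

/-- The pseudofunctor `T` preserves all (small, weighted) bicolimits: it sends bicolimiting
weighted cocones to bicolimiting weighted cocones. -/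
def PreservesBicolimits (T : Pseudofunctor B B') : Prop :=
  ∀ (D : Type u) [Bicategory.{u, u} D] (W : Pseudofunctor Dᵒᵖ Cat.{u, u}) (X : Pseudofunctor D B)
    (L : B) (l : Cocone W X L), l.IsBicolimit → (l.map T).IsBicolimit

end Bicolimits
end VCatBicolimits

/-! The bicolimit is built by generators and relations. Written out in components, a pseudonatural
transformation from `W` to `V-Cat(X -, E)` consists of an object of `E` for every triple `(d, w, x)`
and of generalized arrows of `E` between these objects: one for each hom-object of `X d`, one for
each arrow of `W d`, and one for each constraint cell and for its inverse. They are subject to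
equations between composites. The `V`-category presented by exactly these generators and equations
(`pres`, `bicolim`) carries a tautological cocone `uData`, and every cocone extends to a `V`-functor
out of it whose values on generators are those of the cocone, on the nose. A modification of cocones
is a family of arrows indexed by the same triples and compatible with the generators, and
compatibility with generators already forces `V`-naturality on the whole presented category. Hence
the comparison functors are essentially surjective and fully faithful (`uData_isBicolimit`).

The hom-objects of a presented `V`-category are colimits in `V` of the objects attached to bracketed
formal composites, glued along the given relations and the category axioms, all closed under
composition on either side (`Closure`). Bracketing makes the object attached to a composite
literally a tensor product; associativity is imposed as a relation. Since `V` is closed, tensoring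
preserves these colimits: composition descends to them, and equations and naturality can be tested
on generators (`Presentation.comm_of_gen`).

For the tensor product, `V` is not assumed to have limits, so a `V`-category of functors `[C, E]`
need not exist and preservation cannot be read off from a right adjoint. Instead, a `V`-functor on
`C ⊗ A` is assembled from `V`-functors in each variable whose actions on hom-objects commute
(`VFunctor.glue`). A cocone under `C ⊗ X -` restricts, for each `c`, to a cocone under `X`, which
gives a `V`-functor out of the bicolimit of `X`; the hom-objects of `C` act on its values. That
these actions commute says that a family of generalized arrows with domain `C(c, c')` is natural on
the bicolimit, and this is checked on generators (`comm_tensorAct`). For this reason naturality is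
phrased through `Comm`, for arbitrary parameter objects and not only for the unit.

Finally, bicolimits are unique up to equivalence and pseudofunctors preserve equivalences, so
preservation has to be checked only for the constructed cocone (`Cocone.IsBicolimit.map_of_map`).
The case of `- ⊗ C` follows from that of `C ⊗ -` by the symmetry. -/

namespace VCatBicolimits

/-! ### Generalized arrows of a `V`-category and commuting squares of them. -/

section Calculus

open MonoidalCategory

variable {V : Type v} [Category.{u} V] [MonoidalCategory V]
variable {E : Type u} [EnrichedCategory V E] {E' : Type u} [EnrichedCategory V E']

/-- The composite of two generalized arrows `X ⟶ E(a, b)` and `Y ⟶ E(b, c)` of a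
`V`-category. -/
def star {X Y : V} {a b c : E} (f : X ⟶ (a ⟶[V] b)) (g : Y ⟶ (b ⟶[V] c)) :
    X ⊗ Y ⟶ (a ⟶[V] c) :=
  (f ⊗ₘ g) ≫ eComp V a b c

infixl:75 " ⋆ " => star

theorem comp_star_comp {X X' Y Y' : V} {a b c : E} (h : X' ⟶ X) (k : Y' ⟶ Y)
    (f : X ⟶ (a ⟶[V] b)) (g : Y ⟶ (b ⟶[V] c)) : (h ≫ f) ⋆ (k ≫ g) = (h ⊗ₘ k) ≫ (f ⋆ g) := by
  simp [star]

theorem comp_star {X X' Y : V} {a b c : E} (h : X' ⟶ X)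
    (f : X ⟶ (a ⟶[V] b)) (g : Y ⟶ (b ⟶[V] c)) : (h ≫ f) ⋆ g = h ▷ Y ≫ (f ⋆ g) := by
  simp [star, MonoidalCategory.tensorHom_def]

theorem star_comp {X Y Y' : V} {a b c : E} (k : Y' ⟶ Y)
    (f : X ⟶ (a ⟶[V] b)) (g : Y ⟶ (b ⟶[V] c)) : f ⋆ (k ≫ g) = X ◁ k ≫ (f ⋆ g) := by
  simp [star, tensorHom_def']

theorem star_assoc {X Y Z : V} {a b c d : E} (f : X ⟶ (a ⟶[V] b)) (g : Y ⟶ (b ⟶[V] c))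
    (h : Z ⟶ (c ⟶[V] d)) : (f ⋆ g) ⋆ h = (α_ X Y Z).hom ≫ (f ⋆ (g ⋆ h)) := by
  have e := e_assoc V a b c d
  rw [Iso.inv_comp_eq] at e
  unfold star
  conv_lhs => rw [← Category.comp_id h]
  conv_rhs => rw [← Category.comp_id f]
  rw [← tensorHom_comp_tensorHom_assoc, tensorHom_id, e,
    associator_naturality_assoc, ← tensorHom_comp_tensorHom_assoc, id_tensorHom]

theorem eId_star {X : V} {a b : E} (f : X ⟶ (a ⟶[V] b)) : eId V a ⋆ f = (λ_ X).hom ≫ f := by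
  unfold star
  rw [tensorHom_def', Category.assoc, ← Iso.inv_comp_eq, ← leftUnitor_inv_naturality_assoc]
  rw [e_id_comp, Category.comp_id]

theorem star_eId {X : V} {a b : E} (f : X ⟶ (a ⟶[V] b)) : f ⋆ eId V b = (ρ_ X).hom ≫ f := by
  unfold star
  rw [MonoidalCategory.tensorHom_def, Category.assoc, ← Iso.inv_comp_eq, ← rightUnitor_inv_naturality_assoc]
  rw [e_comp_id, Category.comp_id]

theorem comp_post {X : V} {a b c : E} (f : X ⟶ (a ⟶[V] b)) (g : 𝟙_ V ⟶ (b ⟶[V] c)) :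
    f ≫ post a g = (ρ_ X).inv ≫ (f ⋆ g) := by
  unfold post star
  rw [rightUnitor_inv_naturality_assoc, MonoidalCategory.tensorHom_def, Category.assoc]

theorem comp_pre {X : V} {a b c : E} (f : 𝟙_ V ⟶ (a ⟶[V] b)) (g : X ⟶ (b ⟶[V] c)) :
    g ≫ pre f c = (λ_ X).inv ≫ (f ⋆ g) := by
  unfold pre star
  rw [leftUnitor_inv_naturality_assoc, tensorHom_def', Category.assoc]

theorem star_map (F : EnrichedFunctor V E E') {X Y : V} {a b c : E} (f : X ⟶ (a ⟶[V] b))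
    (g : Y ⟶ (b ⟶[V] c)) : (f ⋆ g) ≫ F.map a c = (f ≫ F.map a b) ⋆ (g ≫ F.map b c) := by
  unfold star
  rw [Category.assoc, F.map_comp, tensorHom_comp_tensorHom_assoc]

theorem id_star_id (a b c : E) : 𝟙 (a ⟶[V] b) ⋆ 𝟙 (b ⟶[V] c) = eComp V a b c := by
  simp [star]

variable [SymmetricCategory V]

/-- The square with generalized arrows `m : K ⟶ E(a, a')`, `g : X ⟶ E(a', b')`,
`f : X ⟶ E(a, b)` and `m' : K ⟶ E(b, b')` commutes. -/
def Comm {K X : V} {a a' b b' : E} (m : K ⟶ (a ⟶[V] a')) (f : X ⟶ (a ⟶[V] b))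
    (g : X ⟶ (a' ⟶[V] b')) (m' : K ⟶ (b ⟶[V] b')) : Prop :=
  m ⋆ g = (β_ K X).hom ≫ (f ⋆ m')

namespace Comm

variable {K X Y : V} {a a' b b' c c' : E} {m : K ⟶ (a ⟶[V] a')} {f : X ⟶ (a ⟶[V] b)}
    {g : X ⟶ (a' ⟶[V] b')} {m' : K ⟶ (b ⟶[V] b')}

theorem congr {f₀ : X ⟶ (a ⟶[V] b)} {g₀ : X ⟶ (a' ⟶[V] b')} (h : Comm m f₀ g₀ m') (hf : f = f₀) (hg : g = g₀) :
    Comm m f g m' := by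
  rw [hf, hg]
  exact h

/-- Exchanging the two directions replaces the braiding by its inverse, which is the opposite
braiding because `V` is symmetric. -/
theorem symm (h : Comm m f g m') : Comm f m m' g := by
  unfold Comm at *
  rw [h, SymmetricCategory.symmetry_assoc]

theorem ofId (m : K ⟶ (a ⟶[V] a')) : Comm m (eId V a) (eId V a') m := by
  unfold Comm
  rw [star_eId, eId_star]
  simp

/-- Pasting of two squares along the common edge `m'`. It makes the arrows at which a family is
natural closed under composition, which drives the induction on formal composites in
`Presentation.comm_of_gen`. -/
theorem star {f' : Y ⟶ (b ⟶[V] c)} {g' : Y ⟶ (b' ⟶[V] c')} {m'' : K ⟶ (c ⟶[V] c')}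
    (h : Comm m f g m') (h' : Comm m' f' g' m'') : Comm m (f ⋆ f') (g ⋆ g') m'' := by
  unfold Comm at *
  have e : m ⋆ (g ⋆ g') = (α_ K X Y).inv ≫ ((m ⋆ g) ⋆ g') := by
    rw [star_assoc]; simp
  have e' : f ⋆ (f' ⋆ m'') = (α_ X Y K).inv ≫ ((f ⋆ f') ⋆ m'') := by
    rw [star_assoc]; simp
  rw [e, h, comp_star, star_assoc, h', star_comp, e']
  simp

theorem map {D : Type u} [EnrichedCategory V D] (F : EnrichedFunctor V E D)
    (h : Comm m f g m') : Comm (m ≫ F.map _ _) (f ≫ F.map _ _) (g ≫ F.map _ _)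
      (m' ≫ F.map _ _) := by
  unfold Comm at *
  rw [← star_map, ← star_map, h, Category.assoc]

/-- When `f` and `g` are ordinary arrows, the braiding with the unit is absorbed by the unitors. -/
theorem unit_iff {f : 𝟙_ V ⟶ (a ⟶[V] b)} {g : 𝟙_ V ⟶ (a' ⟶[V] b')} :
    Comm m f g m' ↔ m ≫ post a g = m' ≫ pre f b' := by
  unfold Comm
  rw [comp_post, comp_pre, Iso.inv_comp_eq]
  simp

/-- Here the unit parametrizes the family instead. With `f` and `g` the actions of two `V`-functors,
the right-hand side is the axiom of a `VNatTrans`. -/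
theorem unit_iff' {m : 𝟙_ V ⟶ (a ⟶[V] a')} {m' : 𝟙_ V ⟶ (b ⟶[V] b')} :
    Comm m f g m' ↔ f ≫ post a m' = g ≫ pre m b' :=
  ⟨fun h => unit_iff.1 h.symm, fun h => (unit_iff.2 h).symm⟩

/-- Solving the given square for `m'` yields `m' = f⁻¹ m g` in diagrammatic order, and composing
with `g⁻¹` yields the new square. Naturality at a formal inverse therefore never has to be checked
separately. -/
theorem inv {f : 𝟙_ V ⟶ (a ⟶[V] b)} {g : 𝟙_ V ⟶ (a' ⟶[V] b')} (h : Comm m f g m')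
    {fi : 𝟙_ V ⟶ (b ⟶[V] a)} {gi : 𝟙_ V ⟶ (b' ⟶[V] a')} (hf : fi ≫ post b f = eId V b)
    (hg : g ≫ post a' gi = eId V a') : Comm m' fi gi m := by
  rw [unit_iff] at *
  have h1 : m' = m ≫ post a g ≫ pre fi b' := by
    rw [reassoc_of% h, pre_comp_pre, hf, pre_eId, Category.comp_id]
  rw [h1, Category.assoc, Category.assoc, pre_comp_post, reassoc_of% (post_comp_post a g gi), hg,
    post_eId, Category.id_comp]

end Comm

end Calculus

/-! ### Arrows and `V`-functors on `C ⊗ A` in terms of the two variables. -/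

section TensorCalculus

open MonoidalCategory

variable {V : Type v} [Category.{u} V] [MonoidalCategory V] [SymmetricCategory V]
variable {C A E : Type u} [EnrichedCategory V C] [EnrichedCategory V A] [EnrichedCategory V E]

/-- The generalized arrow `(f, g)` of `C ⊗ A`. -/
def tens {X Y : V} {c c' : C} {a a' : A} (f : X ⟶ (c ⟶[V] c')) (g : Y ⟶ (a ⟶[V] a')) :
    X ⊗ Y ⟶ ((c, a) ⟶[V] (c', a')) :=
  f ⊗ₘ g

theorem tens_star_tens {X Y X' Y' : V} {c c' c'' : C} {a a' a'' : A} (f : X ⟶ (c ⟶[V] c'))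
    (g : Y ⟶ (a ⟶[V] a')) (f' : X' ⟶ (c' ⟶[V] c'')) (g' : Y' ⟶ (a' ⟶[V] a'')) :
    tens f g ⋆ tens f' g' = tensorμ X Y X' Y' ≫ tens (f ⋆ f') (g ⋆ g') := by
  show ((f ⊗ₘ g) ⊗ₘ (f' ⊗ₘ g')) ≫ (tensorμ _ _ _ _ ≫ (eComp V c c' c'' ⊗ₘ eComp V a a' a'')) =
    tensorμ _ _ _ _ ≫ (((f ⊗ₘ f') ≫ _) ⊗ₘ ((g ⊗ₘ g') ≫ _))
  rw [tensorμ_natural_assoc, tensorHom_comp_tensorHom]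

theorem comp_tens_comp {X Y X' Y' : V} {c c' : C} {a a' : A} (h : X' ⟶ X) (k : Y' ⟶ Y)
    (f : X ⟶ (c ⟶[V] c')) (g : Y ⟶ (a ⟶[V] a')) :
    tens (h ≫ f) (k ≫ g) = (h ⊗ₘ k) ≫ tens f g :=
  (tensorHom_comp_tensorHom _ _ _ _).symm

/-- Here the interchange only swaps two copies of the unit, and the braiding of the unit with itself
is the identity. -/
theorem tensorμ_rho_lambda (X Y : V) :
    ((ρ_ X).inv ⊗ₘ (λ_ Y).inv) ≫ tensorμ X (𝟙_ V) (𝟙_ V) Y ≫ ((ρ_ X).hom ⊗ₘ (λ_ Y).hom) =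
      𝟙 _ := by
  have h : tensorμ X (𝟙_ V) (𝟙_ V) Y = 𝟙 _ := by
    have hβ : (β_ (𝟙_ V) (𝟙_ V)).hom = 𝟙 _ := by
      rw [braiding_tensorUnit_left, unitors_equal, Iso.hom_inv_id]
    rw [tensorμ, hβ]
    monoidal
  rw [h, Category.id_comp, tensorHom_comp_tensorHom]
  simp

/-- Here the interchange moves `Y` past `X`, and once the units are removed it is the braiding
itself. The contrast with `tensorμ_rho_lambda` is the contrast between the two orders of composing
`(f, 1)` and `(1, g)`. -/
theorem tensorμ_lambda_rho (X Y : V) :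
    ((λ_ Y).inv ⊗ₘ (ρ_ X).inv) ≫ tensorμ (𝟙_ V) Y X (𝟙_ V) ≫ ((λ_ X).hom ⊗ₘ (ρ_ Y).hom) =
      (β_ Y X).hom := by
  dsimp only [tensorμ]
  monoidal

/-- The generalized arrow `(f, 1)` of `C ⊗ A`. -/
def tensL {X : V} {c c' : C} (f : X ⟶ (c ⟶[V] c')) (a : A) : X ⟶ ((c, a) ⟶[V] (c', a)) :=
  (ρ_ X).inv ≫ tens f (eId V a)

/-- The generalized arrow `(1, g)` of `C ⊗ A`. -/
def tensR (c : C) {X : V} {a a' : A} (g : X ⟶ (a ⟶[V] a')) : X ⟶ ((c, a) ⟶[V] (c, a')) :=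
  (λ_ X).inv ≫ tens (eId V c) g

theorem tensL_star_tensR {X Y : V} {c c' : C} {a a' : A} (f : X ⟶ (c ⟶[V] c'))
    (g : Y ⟶ (a ⟶[V] a')) : tensL f a ⋆ tensR c' g = tens f g := by
  unfold tensL tensR
  rw [comp_star_comp, tens_star_tens, star_eId, eId_star, comp_tens_comp,
    reassoc_of% tensorμ_rho_lambda X Y]

theorem tensR_star_tensL {X Y : V} {c c' : C} {a a' : A} (f : X ⟶ (c ⟶[V] c'))
    (g : Y ⟶ (a ⟶[V] a')) : tensR c g ⋆ tensL f a' = (β_ Y X).hom ≫ tens f g := by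
  unfold tensL tensR
  rw [comp_star_comp, tens_star_tens, star_eId, eId_star, comp_tens_comp,
    reassoc_of% tensorμ_lambda_rho X Y]

/-- Both orders of composition give `(f, g)`, one of them up to a braiding, and the braiding is
involutive. -/
theorem comm_tensL_tensR {X Y : V} {c c' : C} {a a' : A} (f : X ⟶ (c ⟶[V] c'))
    (g : Y ⟶ (a ⟶[V] a')) : Comm (tensL f a) (tensR c g) (tensR c' g) (tensL f a') := by
  unfold Comm
  rw [tensL_star_tensR, tensR_star_tensL, SymmetricCategory.symmetry_assoc]

theorem comp_tensL {X Y : V} {c c' : C} (k : Y ⟶ X) (f : X ⟶ (c ⟶[V] c')) (a : A) :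
    tensL (k ≫ f) a = k ≫ tensL f a := by
  unfold tensL
  rw [← Category.id_comp (eId V a), comp_tens_comp, tensorHom_id,
    rightUnitor_inv_naturality_assoc, Category.id_comp]

theorem comp_tensR (c : C) {X Y : V} {a a' : A} (k : Y ⟶ X) (g : X ⟶ (a ⟶[V] a')) :
    tensR c (k ≫ g) = k ≫ tensR c g := by
  unfold tensR
  rw [← Category.id_comp (eId V c), comp_tens_comp, id_tensorHom,
    leftUnitor_inv_naturality_assoc, Category.id_comp]

theorem tensL_star_tensL {X Y : V} {c c' c'' : C} (f : X ⟶ (c ⟶[V] c'))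
    (g : Y ⟶ (c' ⟶[V] c'')) (a : A) : tensL f a ⋆ tensL g a = tensL (f ⋆ g) a := by
  unfold tensL
  rw [comp_star_comp, tens_star_tens, star_eId, ← Category.id_comp (f ⋆ g), comp_tens_comp,
    id_tensorHom, Category.id_comp, ← Category.assoc, ← Category.assoc]
  congr 1
  have h := rightUnitor_monoidal X Y
  -- The coherence law is stated with the left unitor of `𝟙_ V`, whereas composing the two
  -- identities produced the right one; they coincide.
  rw [unitors_equal] at h
  rw [← cancel_mono (ρ_ (X ⊗ Y)).hom, Category.assoc, Category.assoc, ← h,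
    tensorHom_comp_tensorHom]
  simp

theorem tensR_star_tensR (c : C) {X Y : V} {a a' a'' : A} (f : X ⟶ (a ⟶[V] a'))
    (g : Y ⟶ (a' ⟶[V] a'')) : tensR c f ⋆ tensR c g = tensR c (f ⋆ g) := by
  unfold tensR
  rw [comp_star_comp, tens_star_tens, eId_star, ← Category.id_comp (f ⋆ g), comp_tens_comp,
    tensorHom_id, Category.id_comp, ← Category.assoc, ← Category.assoc]
  congr 1
  rw [← cancel_mono (λ_ (X ⊗ Y)).hom, Category.assoc, Category.assoc, ← leftUnitor_monoidal,
    tensorHom_comp_tensorHom]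
  simp

theorem tensL_eId (c : C) (a : A) : tensL (eId V c) a = eId V (c, a) := by
  unfold tensL tens
  rw [← unitors_inv_equal]
  rfl

theorem tensR_eId (c : C) (a : A) : tensR c (eId V a) = eId V (c, a) := rfl

/-- The inclusion `C ⟶ C ⊗ A` at an object of `A`. -/
def inclL (a : A) : VFunctor (V := V) C (C × A) where
  obj c := (c, a)
  map c c' := tensL (𝟙 _) a
  map_id c := by rw [← comp_tensL, Category.comp_id, tensL_eId]
  map_comp x y z := by
    rw [← comp_tensL, Category.comp_id]
    refine Eq.trans ?_ (tensL_star_tensL _ _ _).symm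
    rw [id_star_id]

/-- The inclusion `A ⟶ C ⊗ A` at an object of `C`. -/
def inclR (c : C) : VFunctor (V := V) A (C × A) where
  obj a := (c, a)
  map a a' := tensR c (𝟙 _)
  map_id a := by rw [← comp_tensR, Category.comp_id, tensR_eId]
  map_comp x y z := by
    rw [← comp_tensR, Category.comp_id]
    refine Eq.trans ?_ (tensR_star_tensR _ _ _).symm
    rw [id_star_id]

/-- Since `(f, g)` is `(f, 1)` followed by `(1, g)`, a `V`-functor on `C ⊗ A` is determined by its
restrictions to the two variables. -/
theorem map_eq_star (H : VFunctor (V := V) (C × A) E) (c c' : C) (a a' : A) :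
    H.map (c, a) (c', a') =
      (tensL (𝟙 (c ⟶[V] c')) a ≫ H.map _ _) ⋆ (tensR c' (𝟙 (a ⟶[V] a')) ≫ H.map _ _) := by
  rw [← star_map, tensL_star_tensR]
  unfold tens
  rw [id_tensorHom_id]
  exact (Category.id_comp _).symm

/-- A family of generalized arrows is natural on `C ⊗ A` when it is natural in both variables
separately. -/
theorem comm_of_comm {H H' : VFunctor (V := V) (C × A) E} {K : V}
    (m : ∀ x, K ⟶ (H.obj x ⟶[V] H'.obj x))
    (hL : ∀ c c' a, Comm (m (c, a)) (tensL (𝟙 (c ⟶[V] c')) a ≫ H.map _ _)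
      (tensL (𝟙 (c ⟶[V] c')) a ≫ H'.map _ _) (m (c', a)))
    (hR : ∀ c a a', Comm (m (c, a)) (tensR c (𝟙 (a ⟶[V] a')) ≫ H.map _ _)
      (tensR c (𝟙 (a ⟶[V] a')) ≫ H'.map _ _) (m (c, a'))) (x y : C × A) :
    Comm (m x) (H.map x y) (H'.map x y) (m y) := by
  obtain ⟨c, a⟩ := x
  obtain ⟨c', a'⟩ := y
  rw [map_eq_star, map_eq_star H']
  exact (hL _ _ _).star (hR _ _ _)

/-- The `V`-functor on `C ⊗ A` determined by `V`-functors in each variable whose actions on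
hom-objects commute. -/
def VFunctor.glue (obj : C → A → E) (l : ∀ a c c', (c ⟶[V] c') ⟶ (obj c a ⟶[V] obj c' a))
    (r : ∀ c a a', (a ⟶[V] a') ⟶ (obj c a ⟶[V] obj c a'))
    (l_id : ∀ a c, eId V c ≫ l a c c = eId V (obj c a))
    (r_id : ∀ c a, eId V a ≫ r c a a = eId V (obj c a))
    (l_comp : ∀ a c c' c'', eComp V c c' c'' ≫ l a c c'' = l a c c' ⋆ l a c' c'')
    (r_comp : ∀ c a a' a'', eComp V a a' a'' ≫ r c a a'' = r c a a' ⋆ r c a' a'')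
    (comm : ∀ c c' a a', Comm (l a c c') (r c a a') (r c' a a') (l a' c c')) :
    VFunctor (V := V) (C × A) E where
  obj x := obj x.1 x.2
  map x y := l x.2 x.1 y.1 ⋆ r y.1 x.2 y.2
  map_id x := by
    show ((λ_ (𝟙_ V)).inv ≫ (eId V x.1 ⊗ₘ eId V x.2)) ≫ _ = _
    rw [Category.assoc, ← comp_star_comp, l_id, r_id, eId_star]
    simp
  map_comp x y z := by
    show (tensorμ _ _ _ _ ≫ (eComp V x.1 y.1 z.1 ⊗ₘ eComp V x.2 y.2 z.2)) ≫ _ =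
      (l x.2 x.1 y.1 ⋆ r y.1 x.2 y.2) ⋆ (l y.2 y.1 z.1 ⋆ r z.1 y.2 z.2)
    rw [Category.assoc, ← comp_star_comp, l_comp, r_comp]
    -- Functoriality compares the order `l l r r` with `l r l r`. After reassociation only the two
    -- middle factors differ, and `comm` exchanges them.
    have h : l x.2 y.1 z.1 ⋆ r z.1 x.2 y.2 = _ := comm y.1 z.1 x.2 y.2
    have h1 : r y.1 x.2 y.2 ⋆ (l y.2 y.1 z.1 ⋆ r z.1 y.2 z.2) =
        (α_ _ _ _).inv ≫ ((r y.1 x.2 y.2 ⋆ l y.2 y.1 z.1) ⋆ r z.1 y.2 z.2) := by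
      rw [star_assoc, Iso.inv_hom_id_assoc]
    have h2 : l x.2 y.1 z.1 ⋆ (r z.1 x.2 y.2 ⋆ r z.1 y.2 z.2) =
        (α_ _ _ _).inv ≫ ((l x.2 y.1 z.1 ⋆ r z.1 x.2 y.2) ⋆ r z.1 y.2 z.2) := by
      rw [star_assoc, Iso.inv_hom_id_assoc]
    rw [star_assoc, star_assoc (l x.2 x.1 y.1), h1, h2, h, comp_star, star_comp, star_comp,
      star_comp]
    simp only [tensorμ, Category.assoc, Iso.inv_hom_id_assoc, whiskerLeft_hom_inv_assoc]
    -- The braiding inside `tensorμ` meets the one introduced by `comm`; by symmetry they cancel.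
    rw [← whiskerLeft_comp_assoc (x.1 ⟶[V] y.1) (_ ▷ _) (_ ▷ _), ← comp_whiskerRight,
      SymmetricCategory.symmetry, id_whiskerRight, MonoidalCategory.whiskerLeft_id,
      Category.id_comp]

end TensorCalculus

/-! ### Jointly epimorphic families under tensoring. -/

section JointlyEpi

open MonoidalCategory

variable {V : Type v} [Category.{u} V] [MonoidalCategory V] [MonoidalClosed V]

/-- `Z ⊗ -` is a left adjoint, so it preserves joint epimorphisms; the equation is tested on its
transposes. -/
theorem whiskerLeft_ext {ι : Sort*} {A Z : V} {X : ι → V} (e : ∀ i, X i ⟶ A)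
    (he : ∀ {Y : V} {f g : A ⟶ Y}, (∀ i, e i ≫ f = e i ≫ g) → f = g)
    {Y : V} {f g : Z ⊗ A ⟶ Y} (h : ∀ i, Z ◁ e i ≫ f = Z ◁ e i ≫ g) : f = g := by
  apply MonoidalClosed.curry_injective
  apply he
  intro i
  rw [← MonoidalClosed.curry_natural_left, ← MonoidalClosed.curry_natural_left, h]

theorem whiskerRight_ext [SymmetricCategory V] {ι : Sort*} {A Z : V} {X : ι → V} (e : ∀ i, X i ⟶ A)
    (he : ∀ {Y : V} {f g : A ⟶ Y}, (∀ i, e i ≫ f = e i ≫ g) → f = g)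
    {Y : V} {f g : A ⊗ Z ⟶ Y} (h : ∀ i, e i ▷ Z ≫ f = e i ▷ Z ≫ g) : f = g := by
  rw [← cancel_epi (β_ Z A).hom]
  apply whiskerLeft_ext e he
  intro i
  rw [BraidedCategory.braiding_naturality_right_assoc, h,
    BraidedCategory.braiding_naturality_right_assoc]

end JointlyEpi

/-! ### `V`-categories presented by generators and relations. -/

section Presentations

open MonoidalCategory Limits

variable (V : Type v) [Category.{u} V]

/-- A `V`-graph whose hom-objects are presented as coproducts: a family of generating arrows
between objects in `S`, each of which has a value in `V`. -/
structure Signature (S : Type u) where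
  Gen : S → S → Type u
  val {s t : S} : Gen s t → V

variable {V} {S : Type u}

/-- Formal composites of generating arrows. -/
inductive Term (G₀ : Signature V S) : S → S → Type u
  | id (s : S) : Term G₀ s s
  | gen {s t : S} (g : G₀.Gen s t) : Term G₀ s t
  | comp {s t r : S} (p : Term G₀ s t) (q : Term G₀ t r) : Term G₀ s r

variable [MonoidalCategory V]

/-- The object of `V` that parametrizes a formal composite. -/
def Term.val {G₀ : Signature V S} : ∀ {s t : S}, Term G₀ s t → V
  | _, _, .id _ => 𝟙_ V
  | _, _, .gen g => G₀.val g
  | _, _, .comp p q => p.val ⊗ q.val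

/-- A formal generalized arrow with domain `X`. -/
structure Elt (G₀ : Signature V S) (X : V) (s t : S) where
  term : Term G₀ s t
  map : X ⟶ term.val

namespace Elt

variable {G₀ : Signature V S} {X Y : V} {s t r : S}

/-- The formal identity arrow. -/
def id (s : S) : Elt G₀ (𝟙_ V) s s := ⟨.id s, 𝟙 _⟩

/-- The formal generalized arrow given by a generator. -/
def gen (g : G₀.Gen s t) : Elt G₀ (G₀.val g) s t := ⟨.gen g, 𝟙 _⟩

/-- Precomposition of a formal generalized arrow with a morphism of `V`. -/
def precomp (h : Y ⟶ X) (e : Elt G₀ X s t) : Elt G₀ Y s t := ⟨e.term, h ≫ e.map⟩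

/-- Composition of a formal generalized arrow with a formal arrow. -/
def post (e : Elt G₀ X s t) (f : Elt G₀ (𝟙_ V) t r) : Elt G₀ X s r :=
  ⟨.comp e.term f.term, (ρ_ X).inv ≫ (e.map ⊗ₘ f.map)⟩

/-- Composition of a formal arrow with a formal generalized arrow. -/
def pre (f : Elt G₀ (𝟙_ V) s t) (e : Elt G₀ X t r) : Elt G₀ X s r :=
  ⟨.comp f.term e.term, (λ_ X).inv ≫ (f.map ⊗ₘ e.map)⟩

/-- Composition of formal generalized arrows. -/
def comp (e : Elt G₀ X s t) (f : Elt G₀ Y t r) : Elt G₀ (X ⊗ Y) s r :=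
  ⟨.comp e.term f.term, e.map ⊗ₘ f.map⟩

end Elt

/-- A pair of parallel formal generalized arrows. -/
structure Relator (G₀ : Signature V S) (s t : S) where
  dom : V
  lhs : Elt G₀ dom s t
  rhs : Elt G₀ dom s t

variable (V S) in
/-- A presentation of a `V`-category with objects `S` by generators and relations. -/
structure Presentation extends Signature V S where
  Rel : S → S → Type u
  rel {s t : S} : Rel s t → Relator toSignature s t

variable (P : Presentation V S)

/-- The closure of the relations of a presentation, together with the axioms of a category, under
composition with formal arrows. -/
inductive Closure : S → S → Type u
  | base {s t : S} (c : P.Rel s t) : Closure s t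
  | assoc {s t r w : S} (p : Term P.toSignature s t) (q : Term P.toSignature t r)
      (k : Term P.toSignature r w) : Closure s w
  | idComp {s t : S} (p : Term P.toSignature s t) : Closure s t
  | compId {s t : S} (p : Term P.toSignature s t) : Closure s t
  | left {s t r : S} (p : Term P.toSignature s t) (c : Closure t r) : Closure s r
  | right {s t r : S} (c : Closure s t) (p : Term P.toSignature t r) : Closure s r

variable {P}

/-- The relation corresponding to an element of the closure. -/
def Closure.relator : ∀ {s t : S}, Closure P s t → Relator P.toSignature s t
  | _, _, .base c => P.rel c
  | _, _, .assoc p q k =>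
      ⟨(p.val ⊗ q.val) ⊗ k.val, ⟨.comp (.comp p q) k, 𝟙 _⟩,
        ⟨.comp p (.comp q k), (α_ _ _ _).hom⟩⟩
  | _, _, .idComp p => ⟨𝟙_ V ⊗ p.val, ⟨.comp (.id _) p, 𝟙 _⟩, ⟨p, (λ_ _).hom⟩⟩
  | _, _, .compId p => ⟨p.val ⊗ 𝟙_ V, ⟨.comp p (.id _), 𝟙 _⟩, ⟨p, (ρ_ _).hom⟩⟩
  | _, _, .left p c =>
      ⟨p.val ⊗ c.relator.dom, ⟨.comp p c.relator.lhs.term, p.val ◁ c.relator.lhs.map⟩,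
        ⟨.comp p c.relator.rhs.term, p.val ◁ c.relator.rhs.map⟩⟩
  | _, _, .right c p =>
      ⟨c.relator.dom ⊗ p.val, ⟨.comp c.relator.lhs.term p, c.relator.lhs.map ▷ p.val⟩,
        ⟨.comp c.relator.rhs.term p, c.relator.rhs.map ▷ p.val⟩⟩

variable (P) in
/-- The objects of the `V`-category with a given presentation. -/
def Presentation.Carrier (_ : Presentation V S) : Type u := S

namespace Presentation

variable (P) in
/-- The diagram of the formal composites and the relations between two objects. -/
def index (s t : S) : MultispanIndex
    { L := Closure P s t
      R := Term P.toSignature s t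
      fst := fun c => c.relator.lhs.term
      snd := fun c => c.relator.rhs.term } V where
  left c := c.relator.dom
  right p := p.val
  fst c := c.relator.lhs.map
  snd c := c.relator.rhs.map

variable [HasColimits V]

variable (P) in
/-- The hom-objects of the `V`-category with a given presentation. -/
noncomputable def hom (s t : S) : V := multicoequalizer (P.index s t)

/-- The generalized arrow given by a formal composite. -/
noncomputable def π {s t : S} (p : Term P.toSignature s t) : p.val ⟶ P.hom s t :=
  Multicoequalizer.π (P.index s t) p

theorem condition {s t : S} (c : Closure P s t) :
    c.relator.lhs.map ≫ π c.relator.lhs.term = c.relator.rhs.map ≫ π c.relator.rhs.term :=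
  Multicoequalizer.condition (P.index s t) c

theorem hom_ext {s t : S} {Y : V} {f g : P.hom s t ⟶ Y}
    (h : ∀ p : Term P.toSignature s t, π p ≫ f = π p ≫ g) : f = g :=
  Multicoequalizer.hom_ext (P.index s t) f g h

/-- The morphism out of a hom-object determined by its values on formal composites. -/
noncomputable def desc {s t : S} {Y : V} (k : ∀ p : Term P.toSignature s t, p.val ⟶ Y)
    (h : ∀ c : Closure P s t,
      c.relator.lhs.map ≫ k c.relator.lhs.term = c.relator.rhs.map ≫ k c.relator.rhs.term) :
    P.hom s t ⟶ Y :=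
  Multicoequalizer.desc (P.index s t) Y k h

theorem π_desc {s t : S} {Y : V} (k : ∀ p : Term P.toSignature s t, p.val ⟶ Y)
    (h : ∀ c : Closure P s t,
      c.relator.lhs.map ≫ k c.relator.lhs.term = c.relator.rhs.map ≫ k c.relator.rhs.term)
    (p : Term P.toSignature s t) : π p ≫ desc k h = k p :=
  Multicoequalizer.π_desc (P.index s t) Y k h p

variable (P) in
/-- The formal identity. -/
noncomputable def πId (s : S) : 𝟙_ V ⟶ P.hom s s := π (P := P) (.id s)

/-- The generalized arrow given by a formal composition. -/
noncomputable def πComp {s t r : S} (p : Term P.toSignature s t) (q : Term P.toSignature t r) :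
    p.val ⊗ q.val ⟶ P.hom s r :=
  π (.comp p q)

/-- The constructors `left` and `right` of `Closure` exist for this lemma and the next: they make
formal composition compatible with the relations in each variable, so that it descends to `homComp`.
-/
theorem condition_left {s t r : S} (p : Term P.toSignature s t) (c : Closure P t r) :
    p.val ◁ c.relator.lhs.map ≫ πComp p c.relator.lhs.term =
      p.val ◁ c.relator.rhs.map ≫ πComp p c.relator.rhs.term :=
  condition (.left p c)

theorem condition_right {s t r : S} (c : Closure P s t) (p : Term P.toSignature t r) :
    c.relator.lhs.map ▷ p.val ≫ πComp c.relator.lhs.term p =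
      c.relator.rhs.map ▷ p.val ≫ πComp c.relator.rhs.term p :=
  condition (.right c p)

variable [MonoidalClosed V]

theorem hom_ext_left (Z : V) {s t : S} {Y : V} {f g : Z ⊗ P.hom s t ⟶ Y}
    (h : ∀ p : Term P.toSignature s t, Z ◁ π p ≫ f = Z ◁ π p ≫ g) : f = g :=
  whiskerLeft_ext (fun p : Term P.toSignature s t => π p) hom_ext h

/-- The morphism out of `Z ⊗ P.hom s t` determined by its values on formal composites. -/
noncomputable def descLeft (Z : V) {s t : S} {Y : V}
    (k : ∀ p : Term P.toSignature s t, Z ⊗ p.val ⟶ Y)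
    (h : ∀ c : Closure P s t, Z ◁ c.relator.lhs.map ≫ k c.relator.lhs.term =
      Z ◁ c.relator.rhs.map ≫ k c.relator.rhs.term) :
    Z ⊗ P.hom s t ⟶ Y :=
  MonoidalClosed.uncurry (desc (fun p => MonoidalClosed.curry (k p)) (fun c => by
    rw [← MonoidalClosed.curry_natural_left, ← MonoidalClosed.curry_natural_left, h]))

theorem π_descLeft (Z : V) {s t : S} {Y : V}
    (k : ∀ p : Term P.toSignature s t, Z ⊗ p.val ⟶ Y)
    (h : ∀ c : Closure P s t, Z ◁ c.relator.lhs.map ≫ k c.relator.lhs.term =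
      Z ◁ c.relator.rhs.map ≫ k c.relator.rhs.term)
    (p : Term P.toSignature s t) : Z ◁ π p ≫ descLeft Z k h = k p := by
  unfold descLeft
  rw [← MonoidalClosed.uncurry_natural_left, π_desc, MonoidalClosed.uncurry_curry]

variable [SymmetricCategory V]

/-- The two variables are tested one after the other, each by joint epimorphy after tensoring with
the other. -/
theorem hom_ext₂ {s t s' t' : S} {Y : V} {f g : P.hom s t ⊗ P.hom s' t' ⟶ Y}
    (h : ∀ (p : Term P.toSignature s t) (q : Term P.toSignature s' t'),
      (π p ⊗ₘ π q) ≫ f = (π p ⊗ₘ π q) ≫ g) : f = g := by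
  apply whiskerRight_ext (fun p : Term P.toSignature s t => π p) hom_ext
  intro p
  apply hom_ext_left
  intro q
  rw [← tensorHom_def'_assoc, ← tensorHom_def'_assoc, h]

theorem hom_ext₃ {s t s' t' s'' t'' : S} {Y : V}
    {f g : (P.hom s t ⊗ P.hom s' t') ⊗ P.hom s'' t'' ⟶ Y}
    (h : ∀ (p : Term P.toSignature s t) (q : Term P.toSignature s' t')
      (k : Term P.toSignature s'' t''),
      ((π p ⊗ₘ π q) ⊗ₘ π k) ≫ f = ((π p ⊗ₘ π q) ⊗ₘ π k) ≫ g) : f = g := by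
  apply hom_ext_left
  intro k
  apply whiskerRight_ext (ι := Term P.toSignature s t × Term P.toSignature s' t')
    (fun p => π p.1 ⊗ₘ π p.2) (fun h => hom_ext₂ fun p q => h (p, q))
  intro p
  rw [← MonoidalCategory.tensorHom_def_assoc, ← MonoidalCategory.tensorHom_def_assoc, h]

/-- The morphism out of `P.hom s t ⊗ Z` determined by its values on formal composites. -/
noncomputable def descRight (Z : V) {s t : S} {Y : V}
    (k : ∀ p : Term P.toSignature s t, p.val ⊗ Z ⟶ Y)
    (h : ∀ c : Closure P s t, c.relator.lhs.map ▷ Z ≫ k c.relator.lhs.term =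
      c.relator.rhs.map ▷ Z ≫ k c.relator.rhs.term) :
    P.hom s t ⊗ Z ⟶ Y :=
  (β_ _ _).hom ≫ descLeft Z (fun p => (β_ _ _).hom ≫ k p) (fun c => by
    rw [BraidedCategory.braiding_naturality_right_assoc, h,
      BraidedCategory.braiding_naturality_right_assoc])

theorem π_descRight (Z : V) {s t : S} {Y : V}
    (k : ∀ p : Term P.toSignature s t, p.val ⊗ Z ⟶ Y)
    (h : ∀ c : Closure P s t, c.relator.lhs.map ▷ Z ≫ k c.relator.lhs.term =
      c.relator.rhs.map ▷ Z ≫ k c.relator.rhs.term)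
    (p : Term P.toSignature s t) : π p ▷ Z ≫ descRight Z k h = k p := by
  unfold descRight
  rw [BraidedCategory.braiding_naturality_left_assoc, π_descLeft,
    SymmetricCategory.symmetry_assoc]

variable (P) in
/-- Composition in the `V`-category with a given presentation. -/
noncomputable def homComp (s t r : S) : P.hom s t ⊗ P.hom t r ⟶ P.hom s r :=
  descRight _ (fun p => descLeft _ (fun q => πComp p q) (condition_left p))
    (fun c => by
      refine hom_ext_left _ fun q => ?_
      rw [whisker_exchange_assoc, whisker_exchange_assoc, π_descLeft, π_descLeft,
        condition_right])

theorem π_homComp {s t r : S} (p : Term P.toSignature s t) (q : Term P.toSignature t r) :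
    (π p ⊗ₘ π q) ≫ P.homComp s t r = πComp p q := by
  unfold homComp
  rw [tensorHom_def', Category.assoc, π_descRight, π_descLeft]

/-- Bracketed composites satisfy no law by themselves: this law, `homComp_πId` and `πComp_homComp`
hold because they were put into `Closure`. The leading identity comes from the first map of the
corresponding relator. -/
theorem πId_homComp {s t : S} (p : Term P.toSignature s t) :
    (P.πId s ⊗ₘ π p) ≫ P.homComp s s t = (λ_ p.val).hom ≫ π p :=
  (π_homComp (.id s) p).trans
    ((Category.id_comp _).symm.trans (condition (Closure.idComp (P := P) p)))

theorem homComp_πId {s t : S} (p : Term P.toSignature s t) :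
    (π p ⊗ₘ P.πId t) ≫ P.homComp s t t = (ρ_ p.val).hom ≫ π p :=
  (π_homComp p (.id t)).trans
    ((Category.id_comp _).symm.trans (condition (Closure.compId (P := P) p)))

theorem πComp_homComp {s t r w : S} (p : Term P.toSignature s t) (q : Term P.toSignature t r)
    (k : Term P.toSignature r w) : (πComp p q ⊗ₘ π k) ≫ P.homComp s r w =
      (α_ _ _ _).hom ≫ (π p ⊗ₘ πComp q k) ≫ P.homComp s t w :=
  (π_homComp (.comp p q) k).trans ((Category.id_comp _).symm.trans
    ((condition (.assoc p q k)).trans (congrArg (_ ≫ ·) (π_homComp p (.comp q k)).symm)))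

theorem id_homComp (s t : S) :
    (λ_ (P.hom s t)).inv ≫ P.πId s ▷ P.hom s t ≫ P.homComp s s t = 𝟙 _ := by
  apply hom_ext
  intro p
  rw [leftUnitor_inv_naturality_assoc, ← tensorHom_def'_assoc, πId_homComp, Category.comp_id,
    Iso.inv_hom_id_assoc]

theorem homComp_id (s t : S) :
    (ρ_ (P.hom s t)).inv ≫ P.hom s t ◁ P.πId t ≫ P.homComp s t t = 𝟙 _ := by
  apply hom_ext
  intro p
  rw [rightUnitor_inv_naturality_assoc, ← MonoidalCategory.tensorHom_def_assoc, homComp_πId,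
    Category.comp_id, Iso.inv_hom_id_assoc]

theorem homComp_assoc (s t r w : S) :
    (α_ _ _ _).inv ≫ P.homComp s t r ▷ P.hom r w ≫ P.homComp s r w =
      P.hom s t ◁ P.homComp t r w ≫ P.homComp s t w := by
  rw [Iso.inv_comp_eq]
  apply hom_ext₃
  intro p q k
  rw [← tensorHom_id, tensorHom_comp_tensorHom_assoc, π_homComp, Category.comp_id,
    πComp_homComp, associator_naturality_assoc, ← id_tensorHom,
    tensorHom_comp_tensorHom_assoc, π_homComp, Category.comp_id]

noncomputable instance : EnrichedCategory V P.Carrier where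
  Hom s t := P.hom s t
  id s := P.πId s
  comp s t r := P.homComp s t r
  id_comp s t := id_homComp s t
  comp_id s t := homComp_id s t
  assoc s t r w := homComp_assoc s t r w

/-- The generalized arrow of the presented `V`-category given by a formal composite. -/
noncomputable def arr {s t : P.Carrier} (p : Term P.toSignature s t) : p.val ⟶ (s ⟶[V] t) := π p

theorem arr_star_arr {s t r : P.Carrier} (p : Term P.toSignature s t)
    (q : Term P.toSignature t r) : arr p ⋆ arr q = arr (.comp p q) :=
  π_homComp p q

/-- The generalized arrow given by a formal one. -/
noncomputable def toHom {X : V} {s t : P.Carrier} (e : Elt P.toSignature X s t) :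
    X ⟶ (s ⟶[V] t) :=
  e.map ≫ arr e.term

theorem toHom_rel {s t : P.Carrier} (c : P.Rel s t) : toHom (P.rel c).lhs = toHom (P.rel c).rhs :=
  condition (.base c)

theorem toHom_id (s : P.Carrier) : toHom (Elt.id s) = eId V s := Category.id_comp _

/-- In this lemma and the next ones the value `e'` is a separate variable, so that a named arrow can
be substituted for the value of `e` by `rfl`. -/
theorem toHom_precomp {X Y : V} {s t : P.Carrier} (h : Y ⟶ X) {e : Elt P.toSignature X s t}
    {e' : X ⟶ (s ⟶[V] t)} (he : toHom e = e') : toHom (e.precomp h) = h ≫ e' := by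
  subst he
  exact Category.assoc _ _ _

theorem toHom_comp {X Y : V} {s t r : P.Carrier} {e : Elt P.toSignature X s t}
    {f : Elt P.toSignature Y t r} {e' : X ⟶ (s ⟶[V] t)} {f' : Y ⟶ (t ⟶[V] r)}
    (he : toHom e = e') (hf : toHom f = f') : toHom (e.comp f) = e' ⋆ f' := by
  subst he hf
  unfold toHom
  rw [comp_star_comp, arr_star_arr]
  rfl

theorem toHom_post {X : V} {s t r : P.Carrier} {e : Elt P.toSignature X s t}
    {f : Elt P.toSignature (𝟙_ V) t r} {e' : X ⟶ (s ⟶[V] t)} {f' : 𝟙_ V ⟶ (t ⟶[V] r)}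
    (he : toHom e = e') (hf : toHom f = f') : toHom (e.post f) = e' ≫ post s f' := by
  rw [comp_post, ← toHom_comp he hf]
  exact Category.assoc _ _ _

theorem toHom_pre {X : V} {s t r : P.Carrier} {f : Elt P.toSignature (𝟙_ V) s t}
    {e : Elt P.toSignature X t r} {f' : 𝟙_ V ⟶ (s ⟶[V] t)} {e' : X ⟶ (t ⟶[V] r)}
    (hf : toHom f = f') (he : toHom e = e') : toHom (f.pre e) = e' ≫ pre f' r := by
  rw [comp_pre, ← toHom_comp hf he]
  exact Category.assoc _ _ _

end Presentation

/-- An interpretation of the generators of a presentation in a `V`-category. -/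
structure Interp (P : Presentation V S) (E : Type u) [EnrichedCategory V E] where
  obj : S → E
  gen {s t : S} (g : P.Gen s t) : P.val g ⟶ (obj s ⟶[V] obj t)

namespace Interp

variable {E : Type u} [EnrichedCategory V E] (I : Interp P E)

/-- The value of a formal composite under an interpretation. -/
def eval (I : Interp P E) :
    ∀ {s t : S} (p : Term P.toSignature s t), p.val ⟶ (I.obj s ⟶[V] I.obj t)
  | _, _, .id s => eId V (I.obj s)
  | _, _, .gen g => I.gen g
  | _, _, .comp p q => I.eval p ⋆ I.eval q

/-- The value of a formal generalized arrow under an interpretation. -/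
def evalElt {X : V} {s t : S} (e : Elt P.toSignature X s t) : X ⟶ (I.obj s ⟶[V] I.obj t) :=
  e.map ≫ I.eval e.term

theorem evalElt_id (s : S) : I.evalElt (Elt.id s) = eId V (I.obj s) := Category.id_comp _

variable {I} in
theorem evalElt_precomp {X Y : V} {s t : S} (h : Y ⟶ X) {e : Elt P.toSignature X s t}
    {e' : X ⟶ (I.obj s ⟶[V] I.obj t)} (he : I.evalElt e = e') :
    I.evalElt (e.precomp h) = h ≫ e' := by
  subst he
  exact Category.assoc _ _ _

variable {I} in
theorem evalElt_comp {X Y : V} {s t r : S} {e : Elt P.toSignature X s t}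
    {f : Elt P.toSignature Y t r} {e' : X ⟶ (I.obj s ⟶[V] I.obj t)}
    {f' : Y ⟶ (I.obj t ⟶[V] I.obj r)} (he : I.evalElt e = e') (hf : I.evalElt f = f') :
    I.evalElt (e.comp f) = e' ⋆ f' := by
  subst he hf
  unfold evalElt
  rw [comp_star_comp]
  rfl

variable {I} in
theorem evalElt_post {X : V} {s t r : S} {e : Elt P.toSignature X s t}
    {f : Elt P.toSignature (𝟙_ V) t r} {e' : X ⟶ (I.obj s ⟶[V] I.obj t)}
    {f' : 𝟙_ V ⟶ (I.obj t ⟶[V] I.obj r)} (he : I.evalElt e = e') (hf : I.evalElt f = f') :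
    I.evalElt (e.post f) = e' ≫ post _ f' := by
  rw [comp_post, ← evalElt_comp he hf]
  exact Category.assoc _ _ _

variable {I} in
theorem evalElt_pre {X : V} {s t r : S} {f : Elt P.toSignature (𝟙_ V) s t}
    {e : Elt P.toSignature X t r} {f' : 𝟙_ V ⟶ (I.obj s ⟶[V] I.obj t)}
    {e' : X ⟶ (I.obj t ⟶[V] I.obj r)} (hf : I.evalElt f = f') (he : I.evalElt e = e') :
    I.evalElt (f.pre e) = e' ≫ pre f' _ := by
  rw [comp_pre, ← evalElt_comp hf he]
  exact Category.assoc _ _ _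

/-- Only the base relations need a hypothesis: the category axioms hold in `E`, and composing both
sides of an equation with a fixed arrow preserves it. -/
theorem eval_closure (h : ∀ {s t : S} (c : P.Rel s t),
    I.evalElt (P.rel c).lhs = I.evalElt (P.rel c).rhs) {s t : S} (c : Closure P s t) :
    I.evalElt c.relator.lhs = I.evalElt c.relator.rhs := by
  induction c with
  | base c => exact h c
  | assoc p q k => exact (Category.id_comp _).trans (star_assoc _ _ _)
  | idComp p => exact (Category.id_comp _).trans (eId_star _)
  | compId p => exact (Category.id_comp _).trans (star_eId _)
  | left p c ih => exact (star_comp _ _ _).symm.trans ((congrArg (_ ⋆ ·) ih).trans (star_comp _ _ _))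
  | right c p ih => exact (comp_star _ _ _).symm.trans ((congrArg (· ⋆ _) ih).trans (comp_star _ _ _))

variable [HasColimits V]

variable {I} in
/-- The action on hom-objects of the `V`-functor given by an interpretation. -/
noncomputable def liftMap (h : ∀ {s t : S} (c : P.Rel s t),
    I.evalElt (P.rel c).lhs = I.evalElt (P.rel c).rhs) (s t : S) :
    P.hom s t ⟶ (I.obj s ⟶[V] I.obj t) :=
  Presentation.desc (fun p => I.eval p) (fun c => I.eval_closure h c)

theorem π_liftMap (h : ∀ {s t : S} (c : P.Rel s t),
    I.evalElt (P.rel c).lhs = I.evalElt (P.rel c).rhs) {s t : S} (p : Term P.toSignature s t) :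
    Presentation.π p ≫ liftMap h s t = I.eval p :=
  Presentation.π_desc _ _ p

theorem πComp_liftMap (h : ∀ {s t : S} (c : P.Rel s t),
    I.evalElt (P.rel c).lhs = I.evalElt (P.rel c).rhs) {s t r : S}
    (p : Term P.toSignature s t) (q : Term P.toSignature t r) :
    Presentation.πComp p q ≫ liftMap h s r = I.eval p ⋆ I.eval q :=
  I.π_liftMap h (.comp p q)

variable [MonoidalClosed V] [SymmetricCategory V]

/-- On formal composites this is the clause of `eval` for `comp`, and these are jointly epimorphic
in both variables. -/
theorem homComp_liftMap (h : ∀ {s t : S} (c : P.Rel s t),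
    I.evalElt (P.rel c).lhs = I.evalElt (P.rel c).rhs) (s t r : S) :
    P.homComp s t r ≫ liftMap h s r = liftMap h s t ⋆ liftMap h t r := by
  apply Presentation.hom_ext₂
  intro p q
  rw [reassoc_of% Presentation.π_homComp p q, πComp_liftMap, ← comp_star_comp, π_liftMap,
    π_liftMap]

/-- The `V`-functor out of a presented `V`-category given by an interpretation that respects the
relations. -/
noncomputable def lift (h : ∀ {s t : S} (c : P.Rel s t),
    I.evalElt (P.rel c).lhs = I.evalElt (P.rel c).rhs) : VFunctor (V := V) P.Carrier E where
  obj s := I.obj s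
  map s t := liftMap h s t
  map_id s := I.π_liftMap h (.id s)
  map_comp s t r := I.homComp_liftMap h s t r

theorem arr_lift (h : ∀ {s t : S} (c : P.Rel s t),
    I.evalElt (P.rel c).lhs = I.evalElt (P.rel c).rhs) {s t : P.Carrier}
    (p : Term P.toSignature s t) : Presentation.arr p ≫ (I.lift h).map s t = I.eval p :=
  Presentation.π_desc _ _ p

theorem toHom_lift (h : ∀ {s t : S} (c : P.Rel s t),
    I.evalElt (P.rel c).lhs = I.evalElt (P.rel c).rhs) {X : V} {s t : P.Carrier}
    (e : Elt P.toSignature X s t) :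
    Presentation.toHom e ≫ (I.lift h).map s t = I.evalElt e :=
  (Category.assoc _ _ _).trans (congrArg (_ ≫ ·) (I.arr_lift h _))

end Interp

variable [HasColimits V] [MonoidalClosed V] [SymmetricCategory V]

/-- A family of generalized arrows between two `V`-functors out of a presented `V`-category is
natural when it is natural on the generators. -/
theorem Presentation.comm_of_gen {E : Type u} [EnrichedCategory V E]
    {F G : VFunctor (V := V) P.Carrier E} {K : V} (m : ∀ s, K ⟶ (F.obj s ⟶[V] G.obj s))
    (h : ∀ {s t : P.Carrier} (g : P.Gen s t), Comm (m s)
      (toHom (Elt.gen g : Elt P.toSignature _ s t) ≫ F.map s t)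
      (toHom (Elt.gen g : Elt P.toSignature _ s t) ≫ G.map s t) (m t)) (s t : P.Carrier) :
    Comm (m s) (F.map s t) (G.map s t) (m t) := by
  have key : ∀ {s t : P.Carrier} (p : Term P.toSignature s t),
      Comm (m s) (arr p ≫ F.map s t) (arr p ≫ G.map s t) (m t) := by
    intro s t p
    induction p with
    | id s =>
      exact (Comm.ofId (m s)).congr (F.map_id s) (G.map_id s)
    | gen g =>
      exact (h g).congr (congrArg (· ≫ F.map _ _) (Category.id_comp (arr (.gen g))).symm)
        (congrArg (· ≫ G.map _ _) (Category.id_comp (arr (.gen g))).symm)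
    | comp p q hp hq =>
      exact (hp.star hq).congr
        ((congrArg (· ≫ F.map _ _) (arr_star_arr p q).symm).trans
          (star_map F.toEnrichedFunctor (arr p) (arr q)))
        ((congrArg (· ≫ G.map _ _) (arr_star_arr p q).symm).trans
          (star_map G.toEnrichedFunctor (arr p) (arr q)))
  -- The formal composites remain jointly epimorphic after tensoring with `K`, so the square on the
  -- whole hom-object follows from the squares on composites.
  refine hom_ext_left (P := P) K fun p => ?_
  refine (star_comp (π p) (m s) (G.map s t)).symm.trans ((key p).trans ?_)
  refine (congrArg _ (comp_star (π p) (F.map s t) (m t))).trans ?_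
  exact (BraidedCategory.braiding_naturality_right_assoc K (π p) _).symm

end Presentations

/-! ### Weighted cocones in `V-Cat` in terms of components. -/

section Unpack

open Bicategory
open scoped CategoryTheory.Pseudofunctor.StrongTrans MonoidalCategory

variable {V : Type v} [Category.{u} V] [MonoidalCategory V]
variable {D : Type u} [Bicategory.{u, u} D] {W : Pseudofunctor Dᵒᵖ Cat.{u, u}}
  {X : Pseudofunctor D (VCat.{u, v} V)} {E : VCat.{u, v} V}

/-- The action of a pseudofunctor to `V-Cat` on an arrow, as a `V`-functor. -/
def fmap (X : Pseudofunctor D (VCat.{u, v} V)) {d d' : D} (a : d ⟶ d') :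
    VFunctor (V := V) (X.obj d).carrier (X.obj d').carrier :=
  X.map a

/-- The component of the action of a pseudofunctor to `V-Cat` on a 2-cell. -/
def fmap₂ (X : Pseudofunctor D (VCat.{u, v} V)) {d d' : D} {a b : d ⟶ d'} (η : a ⟶ b)
    (x : (X.obj d).carrier) : 𝟙_ V ⟶ ((fmap X a).obj x ⟶[V] (fmap X b).obj x) :=
  VNatTrans.app (X.map₂ η) x

/-- The component of the unit constraint of a pseudofunctor to `V-Cat`. -/
def fmapId (X : Pseudofunctor D (VCat.{u, v} V)) (d : D)
    (x : (X.obj d).carrier) : 𝟙_ V ⟶ ((fmap X (𝟙 d)).obj x ⟶[V] x) :=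
  VNatTrans.app (X.mapId d).hom x

/-- The component of the composition constraint of a pseudofunctor to `V-Cat`. -/
def fmapComp (X : Pseudofunctor D (VCat.{u, v} V)) {d d' d'' : D} (a : d ⟶ d') (b : d' ⟶ d'')
    (x : (X.obj d).carrier) :
    𝟙_ V ⟶ ((fmap X (a ≫ b)).obj x ⟶[V] (fmap X b).obj ((fmap X a).obj x)) :=
  VNatTrans.app (X.mapComp a b).hom x

/-- The action of the weight on objects. -/
abbrev wmap (W : Pseudofunctor Dᵒᵖ Cat.{u, u}) {d d' : D} (a : d ⟶ d') :
    W.obj (op d') ⥤ W.obj (op d) :=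
  (W.map a.op).toFunctor

/-- The components of a weighted cocone, as `V`-functors. -/
def leg (ν : Cocone W X E) (d : D) (w : W.obj (op d)) :
    VFunctor (V := V) (X.obj d).carrier E.carrier :=
  (ν.app (op d)).toFunctor.obj w

/-- The `V`-natural transformations that are part of a weighted cocone. -/
def legMor (ν : Cocone W X E) {d : D} {w w' : W.obj (op d)} (f : w ⟶ w')
    (x : (X.obj d).carrier) : 𝟙_ V ⟶ ((leg ν d w).obj x ⟶[V] (leg ν d w').obj x) :=
  VNatTrans.app ((ν.app (op d)).toFunctor.map f) x

/-- The components of the constraint of a weighted cocone. -/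
def cst (ν : Cocone W X E) {d d' : D} (a : d ⟶ d') (w : W.obj (op d')) (x : (X.obj d).carrier) :
    𝟙_ V ⟶ ((leg ν d ((wmap W a).obj w)).obj x ⟶[V] (leg ν d' w).obj ((fmap X a).obj x)) :=
  VNatTrans.app ((ν.naturality a.op).hom.toNatTrans.app w) x

/-- The components of the inverse of the constraint of a weighted cocone. -/
def cstInv (ν : Cocone W X E) {d d' : D} (a : d ⟶ d') (w : W.obj (op d'))
    (x : (X.obj d).carrier) :
    𝟙_ V ⟶ ((leg ν d' w).obj ((fmap X a).obj x) ⟶[V] (leg ν d ((wmap W a).obj w)).obj x) :=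
  VNatTrans.app ((ν.naturality a.op).inv.toNatTrans.app w) x

variable (ν : Cocone W X E)

theorem legMor_naturality {d : D} {w w' : W.obj (op d)} (f : w ⟶ w') (x x' : (X.obj d).carrier) :
    (leg ν d w).map x x' ≫ post _ (legMor ν f x') =
      (leg ν d w').map x x' ≫ pre (legMor ν f x) _ :=
  VNatTrans.naturality ((ν.app (op d)).toFunctor.map f) x x'

theorem legMor_id {d : D} (w : W.obj (op d)) (x : (X.obj d).carrier) :
    legMor ν (𝟙 w) x = eId V _ :=
  congrArg (fun t => VNatTrans.app t x) ((ν.app (op d)).toFunctor.map_id w)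

theorem legMor_comp {d : D} {w w' w'' : W.obj (op d)} (f : w ⟶ w') (g : w' ⟶ w'')
    (x : (X.obj d).carrier) :
    legMor ν (f ≫ g) x = legMor ν f x ≫ post _ (legMor ν g x) :=
  congrArg (fun t => VNatTrans.app t x) ((ν.app (op d)).toFunctor.map_comp f g)

theorem cst_naturality {d d' : D} (a : d ⟶ d') (w : W.obj (op d')) (x x' : (X.obj d).carrier) :
    (leg ν d ((wmap W a).obj w)).map x x' ≫ post _ (cst ν a w x') =
      ((fmap X a).map x x' ≫ (leg ν d' w).map _ _) ≫ pre (cst ν a w x) _ :=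
  VNatTrans.naturality ((ν.naturality a.op).hom.toNatTrans.app w) x x'

theorem legMor_cst {d d' : D} (a : d ⟶ d') {w w' : W.obj (op d')} (f : w ⟶ w')
    (x : (X.obj d).carrier) :
    legMor ν ((wmap W a).map f) x ≫ post _ (cst ν a w' x) =
      cst ν a w x ≫ post _ (legMor ν f ((fmap X a).obj x)) :=
  congrArg (fun t => VNatTrans.app t x) ((ν.naturality a.op).hom.toNatTrans.naturality f)

theorem cst_cstInv {d d' : D} (a : d ⟶ d') (w : W.obj (op d')) (x : (X.obj d).carrier) :
    cst ν a w x ≫ post _ (cstInv ν a w x) = eId V _ :=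
  congrArg (fun t => VNatTrans.app t x)
    (Cat.Hom.hom_inv_id_toNatTrans_app (ν.naturality a.op) w)

theorem cstInv_cst {d d' : D} (a : d ⟶ d') (w : W.obj (op d')) (x : (X.obj d).carrier) :
    cstInv ν a w x ≫ post _ (cst ν a w x) = eId V _ :=
  congrArg (fun t => VNatTrans.app t x)
    (Cat.Hom.inv_hom_id_toNatTrans_app (ν.naturality a.op) w)

theorem cst_map₂ {d d' : D} {a b : d ⟶ d'} (η : a ⟶ b) (w : W.obj (op d'))
    (x : (X.obj d).carrier) :
    legMor ν ((W.map₂ (Bicategory.Opposite.op2 η)).toNatTrans.app w) x ≫ post _ (cst ν b w x) =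
      cst ν a w x ≫ post _ (fmap₂ X η x ≫ (leg ν d' w).map _ _) :=
  congrArg (fun t => VNatTrans.app (t.toNatTrans.app w) x) (ν.naturality_naturality (Bicategory.Opposite.op2 η))

/-- The unit axiom of pseudonaturality also involves unitors of `V-Cat`. Their components are
identities, visible as `eId` in the unfolded form `h'`, and they cancel. The composition axiom below
is treated in the same way, with associators. -/
theorem cst_id (d : D) (w : W.obj (op d)) (x : (X.obj d).carrier) :
    cst ν (𝟙 d) w x ≫ post _ (fmapId X d x ≫ (leg ν d w).map _ _) =
      legMor ν ((W.mapId (op d)).hom.toNatTrans.app w) x := by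
  have h := congrArg (fun t => VNatTrans.app (t.toNatTrans.app w) x) (ν.naturality_id (op d))
  have h' : cst ν (𝟙 d) w x ≫ post _ ((fmapId X d x ≫ (leg ν d w).map _ _) ≫ post _ (eId V _)) =
    legMor ν ((W.mapId (op d)).hom.toNatTrans.app w) x ≫ post _ (eId V _ ≫ post _ (eId V _)) := h
  rw [post_eId, eId_comp_post, post_eId, Category.comp_id, Category.comp_id] at h'
  exact h'

theorem cst_comp {d d' d'' : D} (a : d ⟶ d') (b : d' ⟶ d'') (w : W.obj (op d''))
    (x : (X.obj d).carrier) :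
    cst ν (a ≫ b) w x ≫ post _ (fmapComp X a b x ≫ (leg ν d'' w).map _ _) =
      legMor ν ((W.mapComp b.op a.op).hom.toNatTrans.app w) x ≫
        post _ (cst ν a ((wmap W b).obj w) x ≫ post _ (cst ν b w ((fmap X a).obj x))) := by
  have h := congrArg (fun t => VNatTrans.app (t.toNatTrans.app w) x)
    (ν.naturality_comp b.op a.op)
  have h' : cst ν (a ≫ b) w x ≫ post _ ((fmapComp X a b x ≫ (leg ν d'' w).map _ _) ≫
      post _ (eId V _)) =
    legMor ν ((W.mapComp b.op a.op).hom.toNatTrans.app w) x ≫ post _ (eId V _ ≫ post _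
        (cst ν a ((wmap W b).obj w) x ≫ post _ (eId V _ ≫ post _
          (cst ν b w ((fmap X a).obj x) ≫ post _ (eId V _))))) := h
  simpa only [post_eId, eId_comp_post, Category.comp_id] using h'

/-- The inverse of an invertible `V`-natural family is `V`-natural. -/
theorem inv_naturality {A : Type u} [EnrichedCategory V A] {Y : V} {a a' b b' : A}
    {f : Y ⟶ (a ⟶[V] b)} {g : Y ⟶ (a' ⟶[V] b')} {m : 𝟙_ V ⟶ (a ⟶[V] a')}
    {m' : 𝟙_ V ⟶ (b ⟶[V] b')} (h : f ≫ post a m' = g ≫ pre m b')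
    {mi : 𝟙_ V ⟶ (a' ⟶[V] a)} {mi' : 𝟙_ V ⟶ (b' ⟶[V] b)} (hm : mi ≫ post a' m = eId V a')
    (hm' : m' ≫ post b mi' = eId V b) : g ≫ post a' mi' = f ≫ pre mi b := by
  have h1 : g = f ≫ post a m' ≫ pre mi b' := by
    rw [reassoc_of% h, pre_comp_pre, hm, pre_eId, Category.comp_id]
  rw [h1, Category.assoc, Category.assoc, pre_comp_post, reassoc_of% (post_comp_post a m' mi'),
    hm', post_eId, Category.id_comp]

/-- A `V`-natural isomorphism from its components. -/
def VFunctor.isoMk {A B : Type u} [EnrichedCategory V A] [EnrichedCategory V B]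
    {F G : VFunctor (V := V) A B} (hom : ∀ a, 𝟙_ V ⟶ (F.obj a ⟶[V] G.obj a))
    (inv : ∀ a, 𝟙_ V ⟶ (G.obj a ⟶[V] F.obj a))
    (naturality : ∀ a a', F.map a a' ≫ post _ (hom a') = G.map a a' ≫ pre (hom a) _)
    (hom_inv : ∀ a, hom a ≫ post _ (inv a) = eId V _)
    (inv_hom : ∀ a, inv a ≫ post _ (hom a) = eId V _) : F ≅ G where
  hom := { app := hom, naturality := naturality }
  inv :=
    { app := inv
      naturality := fun a a' => inv_naturality (naturality a a') (inv_hom a) (hom_inv a') }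
  hom_inv_id := VFunctor.hom_ext hom_inv
  inv_hom_id := VFunctor.hom_ext inv_hom

theorem map_comp_post {A B : Type u} [EnrichedCategory V A] [EnrichedCategory V B]
    (F : VFunctor (V := V) A B) {a b c : A} (f : 𝟙_ V ⟶ (a ⟶[V] b)) (g : 𝟙_ V ⟶ (b ⟶[V] c)) :
    (f ≫ post a g) ≫ F.map a c = (f ≫ F.map a b) ≫ post _ (g ≫ F.map b c) := by
  rw [Category.assoc, map_post, Category.assoc]

variable (W X E) in
/-- The data of a weighted cocone, in terms of components. -/
structure CoconeData where
  leg (d : D) (w : W.obj (op d)) : VFunctor (V := V) (X.obj d).carrier E.carrier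
  mor {d : D} {w w' : W.obj (op d)} (f : w ⟶ w') (x : (X.obj d).carrier) :
    𝟙_ V ⟶ ((leg d w).obj x ⟶[V] (leg d w').obj x)
  cst {d d' : D} (a : d ⟶ d') (w : W.obj (op d')) (x : (X.obj d).carrier) :
    𝟙_ V ⟶ ((leg d ((wmap W a).obj w)).obj x ⟶[V] (leg d' w).obj ((fmap X a).obj x))
  cstInv {d d' : D} (a : d ⟶ d') (w : W.obj (op d')) (x : (X.obj d).carrier) :
    𝟙_ V ⟶ ((leg d' w).obj ((fmap X a).obj x) ⟶[V] (leg d ((wmap W a).obj w)).obj x)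
  mor_naturality {d : D} {w w' : W.obj (op d)} (f : w ⟶ w') (x x' : (X.obj d).carrier) :
    (leg d w).map x x' ≫ post _ (mor f x') = (leg d w').map x x' ≫ pre (mor f x) _
  mor_id {d : D} (w : W.obj (op d)) (x : (X.obj d).carrier) : mor (𝟙 w) x = eId V _
  mor_comp {d : D} {w w' w'' : W.obj (op d)} (f : w ⟶ w') (g : w' ⟶ w'')
    (x : (X.obj d).carrier) : mor (f ≫ g) x = mor f x ≫ post _ (mor g x)
  cst_naturality {d d' : D} (a : d ⟶ d') (w : W.obj (op d')) (x x' : (X.obj d).carrier) :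
    (leg d ((wmap W a).obj w)).map x x' ≫ post _ (cst a w x') =
      ((fmap X a).map x x' ≫ (leg d' w).map _ _) ≫ pre (cst a w x) _
  cst_mor {d d' : D} (a : d ⟶ d') {w w' : W.obj (op d')} (f : w ⟶ w')
    (x : (X.obj d).carrier) : mor ((wmap W a).map f) x ≫ post _ (cst a w' x) =
      cst a w x ≫ post _ (mor f ((fmap X a).obj x))
  cst_cstInv {d d' : D} (a : d ⟶ d') (w : W.obj (op d')) (x : (X.obj d).carrier) :
    cst a w x ≫ post _ (cstInv a w x) = eId V _
  cstInv_cst {d d' : D} (a : d ⟶ d') (w : W.obj (op d')) (x : (X.obj d).carrier) :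
    cstInv a w x ≫ post _ (cst a w x) = eId V _
  cst_map₂ {d d' : D} {a b : d ⟶ d'} (η : a ⟶ b) (w : W.obj (op d'))
    (x : (X.obj d).carrier) :
    mor ((W.map₂ (Bicategory.Opposite.op2 η)).toNatTrans.app w) x ≫ post _ (cst b w x) =
      cst a w x ≫ post _ (fmap₂ X η x ≫ (leg d' w).map _ _)
  cst_id (d : D) (w : W.obj (op d)) (x : (X.obj d).carrier) :
    cst (𝟙 d) w x ≫ post _ (fmapId X d x ≫ (leg d w).map _ _) =
      mor ((W.mapId (op d)).hom.toNatTrans.app w) x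
  cst_comp {d d' d'' : D} (a : d ⟶ d') (b : d' ⟶ d'') (w : W.obj (op d''))
    (x : (X.obj d).carrier) :
    cst (a ≫ b) w x ≫ post _ (fmapComp X a b x ≫ (leg d'' w).map _ _) =
      mor ((W.mapComp b.op a.op).hom.toNatTrans.app w) x ≫
        post _ (cst a ((wmap W b).obj w) x ≫ post _ (cst b w ((fmap X a).obj x)))

/-- The weighted cocone with given components. -/
def CoconeData.toCocone (c : CoconeData W X E) : Cocone W X E where
  app d := Functor.toCatHom (C := W.obj d) (D := X.obj d.unop ⟶ E)
    { obj := fun w => c.leg d.unop w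
      map := fun f => { app := c.mor f, naturality := c.mor_naturality f }
      map_id := fun w => VFunctor.hom_ext (c.mor_id w)
      map_comp := fun f g => VFunctor.hom_ext (c.mor_comp f g) }
  naturality {b b'} f := Cat.Hom.isoMk (C := W.obj b) (D := X.obj b'.unop ⟶ E)
    (NatIso.ofComponents
      (fun w => VFunctor.isoMk (c.cst f.unop w) (c.cstInv f.unop w) (c.cst_naturality f.unop w)
        (c.cst_cstInv f.unop w) (c.cstInv_cst f.unop w))
      (fun g => VFunctor.hom_ext (c.cst_mor f.unop g)))
  naturality_naturality η := cat_ext fun w => VFunctor.hom_ext fun x =>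
    c.cst_map₂ η.unop2 w x
  naturality_id b := cat_ext fun w => VFunctor.hom_ext fun x => by
    show c.cst (𝟙 b.unop) w x ≫ post _ ((fmapId X b.unop x ≫ (c.leg b.unop w).map _ _) ≫
        post _ (eId V _)) =
      c.mor ((W.mapId b).hom.toNatTrans.app w) x ≫ post _ (eId V _ ≫ post _ (eId V _))
    rw [post_eId, eId_comp_post, post_eId, Category.comp_id, Category.comp_id]
    exact c.cst_id b.unop w x
  naturality_comp {b b' b''} f g := cat_ext fun w => VFunctor.hom_ext fun x => by
    show c.cst (g.unop ≫ f.unop) w x ≫ post _ ((fmapComp X g.unop f.unop x ≫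
        (c.leg b.unop w).map _ _) ≫ post _ (eId V _)) =
      c.mor ((W.mapComp f g).hom.toNatTrans.app w) x ≫ post _ (eId V _ ≫ post _
        (c.cst g.unop ((W.map f).toFunctor.obj w) x ≫ post _ (eId V _ ≫ post _
          (c.cst f.unop w ((fmap X g.unop).obj x) ≫ post _ (eId V _)))))
    simp only [post_eId, eId_comp_post, Category.comp_id]
    exact c.cst_comp g.unop f.unop w x

end Unpack

/-! ### The weighted bicolimit as a presented `V`-category. -/

section Colimit

open Bicategory
open scoped CategoryTheory.Pseudofunctor.StrongTrans MonoidalCategory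

variable {V : Type v} [Category.{u} V] [MonoidalCategory V]
variable {D : Type u} [Bicategory.{u, u} D] (W : Pseudofunctor Dᵒᵖ Cat.{u, u})
  (X : Pseudofunctor D (VCat.{u, v} V))

/-- The objects of the weighted bicolimit of `X`. -/
structure Pt where
  d : D
  w : W.obj (op d)
  x : (X.obj d).carrier

/-- The generating arrows of the weighted bicolimit of `X`. -/
inductive BGen : Pt W X → Pt W X → Type u
  | act (d : D) (w : W.obj (op d)) (x x' : (X.obj d).carrier) : BGen ⟨d, w, x⟩ ⟨d, w, x'⟩
  | mor {d : D} {w w' : W.obj (op d)} (f : w ⟶ w') (x : (X.obj d).carrier) :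
      BGen ⟨d, w, x⟩ ⟨d, w', x⟩
  | cst {d d' : D} (a : d ⟶ d') (w : W.obj (op d')) (x : (X.obj d).carrier) :
      BGen ⟨d, (wmap W a).obj w, x⟩ ⟨d', w, (fmap X a).obj x⟩
  | cstInv {d d' : D} (a : d ⟶ d') (w : W.obj (op d')) (x : (X.obj d).carrier) :
      BGen ⟨d', w, (fmap X a).obj x⟩ ⟨d, (wmap W a).obj w, x⟩

/-- The generators of the weighted bicolimit of `X`. -/
abbrev sig : Signature V (Pt W X) where
  Gen := BGen W X
  val g := match g with
    | .act _ _ x x' => (x ⟶[V] x')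
    | .mor _ _ => 𝟙_ V
    | .cst _ _ _ => 𝟙_ V
    | .cstInv _ _ _ => 𝟙_ V

variable {W X}

/-- The formal arrows given by the hom-objects of `X d`. -/
def eAct {d : D} (w : W.obj (op d)) (x x' : (X.obj d).carrier) :
    Elt (sig W X) (x ⟶[V] x') ⟨d, w, x⟩ ⟨d, w, x'⟩ :=
  Elt.gen (G₀ := sig W X) (BGen.act d w x x')

/-- The formal arrows given by the arrows of `W d`. -/
def eMor {d : D} {w w' : W.obj (op d)} (f : w ⟶ w') (x : (X.obj d).carrier) :
    Elt (sig W X) (𝟙_ V) ⟨d, w, x⟩ ⟨d, w', x⟩ :=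
  Elt.gen (G₀ := sig W X) (BGen.mor f x)

/-- The formal arrows giving the pseudonaturality constraints. -/
def eCst {d d' : D} (a : d ⟶ d') (w : W.obj (op d')) (x : (X.obj d).carrier) :
    Elt (sig W X) (𝟙_ V) ⟨d, (wmap W a).obj w, x⟩ ⟨d', w, (fmap X a).obj x⟩ :=
  Elt.gen (G₀ := sig W X) (BGen.cst a w x)

/-- The formal arrows giving the inverses of the pseudonaturality constraints. -/
def eCstInv {d d' : D} (a : d ⟶ d') (w : W.obj (op d')) (x : (X.obj d).carrier) :
    Elt (sig W X) (𝟙_ V) ⟨d', w, (fmap X a).obj x⟩ ⟨d, (wmap W a).obj w, x⟩ :=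
  Elt.gen (G₀ := sig W X) (BGen.cstInv a w x)

variable (W X)

/-- The defining relations of the weighted bicolimit of `X`. -/
inductive BRel : Pt W X → Pt W X → Type u
  | actComp (d : D) (w : W.obj (op d)) (x x' x'' : (X.obj d).carrier) :
      BRel ⟨d, w, x⟩ ⟨d, w, x''⟩
  | actId (d : D) (w : W.obj (op d)) (x : (X.obj d).carrier) : BRel ⟨d, w, x⟩ ⟨d, w, x⟩
  | morNat {d : D} {w w' : W.obj (op d)} (f : w ⟶ w') (x x' : (X.obj d).carrier) :
      BRel ⟨d, w, x⟩ ⟨d, w', x'⟩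
  | morId (d : D) (w : W.obj (op d)) (x : (X.obj d).carrier) : BRel ⟨d, w, x⟩ ⟨d, w, x⟩
  | morComp {d : D} {w w' w'' : W.obj (op d)} (f : w ⟶ w') (g : w' ⟶ w'')
      (x : (X.obj d).carrier) : BRel ⟨d, w, x⟩ ⟨d, w'', x⟩
  | cstNat {d d' : D} (a : d ⟶ d') (w : W.obj (op d')) (x x' : (X.obj d).carrier) :
      BRel ⟨d, (wmap W a).obj w, x⟩ ⟨d', w, (fmap X a).obj x'⟩
  | cstMor {d d' : D} (a : d ⟶ d') {w w' : W.obj (op d')} (f : w ⟶ w')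
      (x : (X.obj d).carrier) : BRel ⟨d, (wmap W a).obj w, x⟩ ⟨d', w', (fmap X a).obj x⟩
  | cstCstInv {d d' : D} (a : d ⟶ d') (w : W.obj (op d')) (x : (X.obj d).carrier) :
      BRel ⟨d, (wmap W a).obj w, x⟩ ⟨d, (wmap W a).obj w, x⟩
  | cstInvCst {d d' : D} (a : d ⟶ d') (w : W.obj (op d')) (x : (X.obj d).carrier) :
      BRel ⟨d', w, (fmap X a).obj x⟩ ⟨d', w, (fmap X a).obj x⟩
  | cstMap₂ {d d' : D} {a b : d ⟶ d'} (η : a ⟶ b) (w : W.obj (op d'))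
      (x : (X.obj d).carrier) : BRel ⟨d, (wmap W a).obj w, x⟩ ⟨d', w, (fmap X b).obj x⟩
  | cstId (d : D) (w : W.obj (op d)) (x : (X.obj d).carrier) :
      BRel ⟨d, (wmap W (𝟙 d)).obj w, x⟩ ⟨d, w, x⟩
  | cstComp {d d' d'' : D} (a : d ⟶ d') (b : d' ⟶ d'') (w : W.obj (op d''))
      (x : (X.obj d).carrier) :
      BRel ⟨d, (wmap W (a ≫ b)).obj w, x⟩ ⟨d'', w, (fmap X b).obj ((fmap X a).obj x)⟩

/-- The presentation of the weighted bicolimit of `X`. -/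
abbrev pres : Presentation V (Pt W X) where
  toSignature := sig W X
  Rel := BRel W X
  rel r := match r with
    | .actComp d w x x' x'' => ⟨_, (eAct w x x').comp (eAct w x' x''),
        (eAct w x x'').precomp (eComp V x x' x'')⟩
    | .actId d w x => ⟨_, (eAct w x x).precomp (eId V x), Elt.id _⟩
    | .morNat f x x' => ⟨_, (eAct _ x x').post (eMor f x'), (eMor f x).pre (eAct _ x x')⟩
    | .morId d w x => ⟨_, eMor (𝟙 w) x, Elt.id _⟩
    | .morComp f g x => ⟨_, eMor (f ≫ g) x, (eMor f x).post (eMor g x)⟩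
    | .cstNat a w x x' => ⟨_, (eAct _ x x').post (eCst a w x'),
        (eCst a w x).pre ((eAct w _ _).precomp ((fmap X a).map x x'))⟩
    | .cstMor a f x => ⟨_, (eMor ((wmap W a).map f) x).post (eCst a _ x),
        (eCst a _ x).post (eMor f _)⟩
    | .cstCstInv a w x => ⟨_, (eCst a w x).post (eCstInv a w x), Elt.id _⟩
    | .cstInvCst a w x => ⟨_, (eCstInv a w x).post (eCst a w x), Elt.id _⟩
    | .cstMap₂ η w x =>
        ⟨_, (eMor ((W.map₂ (Bicategory.Opposite.op2 η)).toNatTrans.app w) x).post (eCst _ w x),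
          (eCst _ w x).post ((eAct w _ _).precomp (fmap₂ X η x))⟩
    | .cstId d w x => ⟨_, (eCst (𝟙 d) w x).post ((eAct w _ _).precomp (fmapId X d x)),
        eMor ((W.mapId (op d)).hom.toNatTrans.app w) x⟩
    | .cstComp a b w x =>
        ⟨_, (eCst (a ≫ b) w x).post ((eAct w _ _).precomp (fmapComp X a b x)),
          (eMor ((W.mapComp b.op a.op).hom.toNatTrans.app w) x).post
            ((eCst a ((wmap W b).obj w) x).post (eCst b w ((fmap X a).obj x)))⟩

variable {W X}

/-- The interpretation of the generators of the weighted bicolimit given by a cocone. -/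
def Cocone.interp {E : VCat.{u, v} V} (ν : Cocone W X E) : Interp (pres W X) E.carrier where
  obj s := (leg ν s.d s.w).obj s.x
  gen g := match g with
    | BGen.act d w x x' => (leg ν d w).map x x'
    | BGen.mor f x => legMor ν f x
    | BGen.cst a w x => cst ν a w x
    | BGen.cstInv a w x => cstInv ν a w x

section

variable {E : VCat.{u, v} V} (ν : Cocone W X E)

theorem evalElt_eAct {d : D} (w : W.obj (op d)) (x x' : (X.obj d).carrier) :
    ν.interp.evalElt (eAct w x x') = (leg ν d w).map x x' :=
  Category.id_comp _

theorem evalElt_eMor {d : D} {w w' : W.obj (op d)} (f : w ⟶ w') (x : (X.obj d).carrier) :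
    ν.interp.evalElt (eMor f x) = legMor ν f x :=
  Category.id_comp _

theorem evalElt_eCst {d d' : D} (a : d ⟶ d') (w : W.obj (op d')) (x : (X.obj d).carrier) :
    ν.interp.evalElt (eCst a w x) = cst ν a w x :=
  Category.id_comp _

theorem evalElt_eCstInv {d d' : D} (a : d ⟶ d') (w : W.obj (op d')) (x : (X.obj d).carrier) :
    ν.interp.evalElt (eCstInv a w x) = cstInv ν a w x :=
  Category.id_comp _

/-- The relations are the componentwise axioms of a cocone, so each case is one axiom of `ν` placed
between the evaluations of the two formal sides. -/
theorem Cocone.interp_rel {s t : Pt W X} (c : BRel W X s t) :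
    ν.interp.evalElt ((pres W X).rel c).lhs = ν.interp.evalElt ((pres W X).rel c).rhs := by
  cases c with
  | actComp d w x x' x'' =>
    exact (Interp.evalElt_comp (evalElt_eAct ν w x x') (evalElt_eAct ν w x' x'')).trans
      (((leg ν d w).map_comp x x' x'').symm.trans
        (Interp.evalElt_precomp _ (evalElt_eAct ν w x x'')).symm)
  | actId d w x =>
    exact (Interp.evalElt_precomp _ (evalElt_eAct ν w x x)).trans
      (((leg ν d w).map_id x).trans (Interp.evalElt_id ν.interp (⟨d, w, x⟩ : Pt W X)).symm)
  | morNat f x x' =>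
    exact (Interp.evalElt_post (evalElt_eAct ν _ x x') (evalElt_eMor ν f x')).trans
      ((legMor_naturality ν f x x').trans
        (Interp.evalElt_pre (evalElt_eMor ν f x) (evalElt_eAct ν _ x x')).symm)
  | morId d w x =>
    exact (evalElt_eMor ν (𝟙 w) x).trans ((legMor_id ν w x).trans
      (Interp.evalElt_id ν.interp (⟨d, w, x⟩ : Pt W X)).symm)
  | morComp f g x =>
    exact (evalElt_eMor ν (f ≫ g) x).trans ((legMor_comp ν f g x).trans
      (Interp.evalElt_post (evalElt_eMor ν f x) (evalElt_eMor ν g x)).symm)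
  | cstNat a w x x' =>
    exact (Interp.evalElt_post (evalElt_eAct ν _ x x') (evalElt_eCst ν a w x')).trans
      ((cst_naturality ν a w x x').trans (Interp.evalElt_pre (evalElt_eCst ν a w x)
        (Interp.evalElt_precomp _ (evalElt_eAct ν w _ _))).symm)
  | cstMor a f x =>
    exact (Interp.evalElt_post (evalElt_eMor ν _ x) (evalElt_eCst ν a _ x)).trans
      ((legMor_cst ν a f x).trans
        (Interp.evalElt_post (evalElt_eCst ν a _ x) (evalElt_eMor ν f _)).symm)
  | cstCstInv a w x =>
    exact (Interp.evalElt_post (evalElt_eCst ν a w x) (evalElt_eCstInv ν a w x)).trans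
      ((cst_cstInv ν a w x).trans
        (Interp.evalElt_id ν.interp (⟨_, (wmap W a).obj w, x⟩ : Pt W X)).symm)
  | cstInvCst a w x =>
    exact (Interp.evalElt_post (evalElt_eCstInv ν a w x) (evalElt_eCst ν a w x)).trans
      ((cstInv_cst ν a w x).trans
        (Interp.evalElt_id ν.interp (⟨_, w, (fmap X a).obj x⟩ : Pt W X)).symm)
  | cstMap₂ η w x =>
    exact (Interp.evalElt_post (evalElt_eMor ν _ x) (evalElt_eCst ν _ w x)).trans
      ((cst_map₂ ν η w x).trans (Interp.evalElt_post (evalElt_eCst ν _ w x)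
        (Interp.evalElt_precomp _ (evalElt_eAct ν w _ _))).symm)
  | cstId d w x =>
    exact (Interp.evalElt_post (evalElt_eCst ν (𝟙 d) w x)
      (Interp.evalElt_precomp _ (evalElt_eAct ν w _ _))).trans
        ((cst_id ν d w x).trans (evalElt_eMor ν _ x).symm)
  | cstComp a b w x =>
    exact (Interp.evalElt_post (evalElt_eCst ν (a ≫ b) w x)
      (Interp.evalElt_precomp _ (evalElt_eAct ν w _ _))).trans ((cst_comp ν a b w x).trans
        (Interp.evalElt_post (evalElt_eMor ν _ x) (Interp.evalElt_post
          (evalElt_eCst ν a ((wmap W b).obj w) x) (evalElt_eCst ν b w _))).symm)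

end

variable [Limits.HasColimits V] [SymmetricCategory V] [MonoidalClosed V]

variable (W X) in
/-- The vertex of the weighted bicolimit of `X`. -/
noncomputable def bicolim : VCat.{u, v} V := ⟨(pres W X).Carrier⟩

/-- An object of the weighted bicolimit. -/
def pt (d : D) (w : W.obj (op d)) (x : (X.obj d).carrier) : (bicolim W X).carrier :=
  (⟨d, w, x⟩ : Pt W X)

section

open Presentation

/-- The action of the hom-objects of `X d` on the weighted bicolimit. -/
noncomputable def tAct {d : D} (w : W.obj (op d)) (x x' : (X.obj d).carrier) :
    (x ⟶[V] x') ⟶ (pt d w x ⟶[V] pt d w x') :=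
  toHom (P := pres W X) (s := pt d w x) (t := pt d w x') (eAct w x x')

/-- The arrow of the weighted bicolimit given by an arrow of the weight. -/
noncomputable def tMor {d : D} {w w' : W.obj (op d)} (f : w ⟶ w') (x : (X.obj d).carrier) :
    𝟙_ V ⟶ (pt d w x ⟶[V] pt d w' x) :=
  toHom (P := pres W X) (s := pt d w x) (t := pt d w' x) (eMor f x)

/-- The pseudonaturality constraint of the universal cocone. -/
noncomputable def tCst {d d' : D} (a : d ⟶ d') (w : W.obj (op d')) (x : (X.obj d).carrier) :
    𝟙_ V ⟶ (pt d ((wmap W a).obj w) x ⟶[V] pt d' w ((fmap X a).obj x)) :=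
  toHom (P := pres W X) (s := pt d ((wmap W a).obj w) x) (t := pt d' w ((fmap X a).obj x))
    (eCst a w x)

/-- The inverse of the pseudonaturality constraint of the universal cocone. -/
noncomputable def tCstInv {d d' : D} (a : d ⟶ d') (w : W.obj (op d')) (x : (X.obj d).carrier) :
    𝟙_ V ⟶ (pt d' w ((fmap X a).obj x) ⟶[V] pt d ((wmap W a).obj w) x) :=
  toHom (P := pres W X) (s := pt d' w ((fmap X a).obj x)) (t := pt d ((wmap W a).obj w) x)
    (eCstInv a w x)

/-- The components of the universal cocone. -/
noncomputable def uLeg (d : D) (w : W.obj (op d)) :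
    VFunctor (V := V) (X.obj d).carrier (bicolim W X).carrier where
  obj x := pt d w x
  map x x' := tAct w x x'
  map_id x := (toHom_precomp _ rfl).symm.trans ((toHom_rel (P := pres W X)
    (s := pt d w x) (t := pt d w x) (BRel.actId d w x)).trans (toHom_id (pt d w x)))
  map_comp x x' x'' := (toHom_precomp _ rfl).symm.trans
    ((toHom_rel (P := pres W X) (s := pt d w x) (t := pt d w x'')
      (BRel.actComp d w x x' x'')).symm.trans (toHom_comp (t := pt d w x') rfl rfl))

/-- The universal cocone. -/
noncomputable def uData : CoconeData W X (bicolim W X) where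
  leg d w := uLeg d w
  mor f x := tMor f x
  cst a w x := tCst a w x
  cstInv a w x := tCstInv a w x
  mor_naturality {d w w'} f x x' := (toHom_post rfl rfl).symm.trans
    ((toHom_rel (P := pres W X) (s := pt d w x) (t := pt d w' x') (BRel.morNat f x x')).trans
      (toHom_pre (t := pt d w' x) rfl rfl))
  mor_id w x := (toHom_rel (P := pres W X) (s := pt _ w x) (t := pt _ w x)
    (BRel.morId _ w x)).trans (toHom_id (pt _ w x))
  mor_comp {d w w' w''} f g x := (toHom_rel (P := pres W X) (s := pt d w x) (t := pt d w'' x)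
    (BRel.morComp f g x)).trans (toHom_post (t := pt d w' x) rfl rfl)
  cst_naturality {d d'} a w x x' := (toHom_post rfl rfl).symm.trans
    ((toHom_rel (P := pres W X) (s := pt d ((wmap W a).obj w) x)
      (t := pt d' w ((fmap X a).obj x')) (BRel.cstNat a w x x')).trans
        (toHom_pre (t := pt d' w ((fmap X a).obj x)) rfl (toHom_precomp _ rfl)))
  cst_mor {d d'} a w w' f x := (toHom_post rfl rfl).symm.trans
    ((toHom_rel (P := pres W X) (s := pt d ((wmap W a).obj w) x)
      (t := pt d' w' ((fmap X a).obj x)) (BRel.cstMor a f x)).trans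
        (toHom_post (t := pt d' w ((fmap X a).obj x)) rfl rfl))
  cst_cstInv {d _} a w x := (toHom_post rfl rfl).symm.trans
    ((toHom_rel (P := pres W X) (s := pt d ((wmap W a).obj w) x)
      (t := pt d ((wmap W a).obj w) x) (BRel.cstCstInv a w x)).trans (toHom_id (pt d _ x)))
  cstInv_cst {_ d'} a w x := (toHom_post rfl rfl).symm.trans
    ((toHom_rel (P := pres W X) (s := pt d' w ((fmap X a).obj x))
      (t := pt d' w ((fmap X a).obj x)) (BRel.cstInvCst a w x)).trans (toHom_id (pt d' w _)))
  cst_map₂ {d d' a b} η w x := (toHom_post rfl rfl).symm.trans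
    ((toHom_rel (P := pres W X) (s := pt d ((wmap W a).obj w) x)
      (t := pt d' w ((fmap X b).obj x)) (BRel.cstMap₂ η w x)).trans
        (toHom_post (t := pt d' w ((fmap X a).obj x)) rfl (toHom_precomp _ rfl)))
  cst_id d w x := (toHom_post rfl (toHom_precomp _ rfl)).symm.trans
    (toHom_rel (P := pres W X) (s := pt d ((wmap W (𝟙 d)).obj w) x) (t := pt d w x)
      (BRel.cstId d w x))
  cst_comp {d d' d''} a b w x := (toHom_post rfl (toHom_precomp _ rfl)).symm.trans
    ((toHom_rel (P := pres W X) (s := pt d ((wmap W (a ≫ b)).obj w) x)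
      (t := pt d'' w ((fmap X b).obj ((fmap X a).obj x))) (BRel.cstComp a b w x)).trans
        (toHom_post (t := pt d ((wmap W a).obj ((wmap W b).obj w)) x) rfl
          (toHom_post (t := pt d' ((wmap W b).obj w) ((fmap X a).obj x)) rfl rfl)))

/-- The `V`-functor out of the weighted bicolimit given by a cocone. -/
noncomputable def Cocone.lift {E : VCat.{u, v} V} (ν : Cocone W X E) :
    VFunctor (V := V) (bicolim W X).carrier E.carrier :=
  ν.interp.lift ν.interp_rel

/-- This and the next two lemmas say that the lift restricts to `ν` strictly along the universal
cocone, so the isomorphism required for essential surjectivity can be given identity components. -/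
theorem tAct_lift {E : VCat.{u, v} V} (ν : Cocone W X E) {d : D} (w : W.obj (op d))
    (x x' : (X.obj d).carrier) : tAct w x x' ≫ ν.lift.map _ _ = (leg ν d w).map x x' :=
  (Interp.toHom_lift _ _ _).trans (evalElt_eAct ν w x x')

theorem tMor_lift {E : VCat.{u, v} V} (ν : Cocone W X E) {d : D} {w w' : W.obj (op d)}
    (f : w ⟶ w') (x : (X.obj d).carrier) : tMor f x ≫ ν.lift.map _ _ = legMor ν f x :=
  (Interp.toHom_lift _ _ _).trans (evalElt_eMor ν f x)

theorem tCst_lift {E : VCat.{u, v} V} (ν : Cocone W X E) {d d' : D} (a : d ⟶ d')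
    (w : W.obj (op d')) (x : (X.obj d).carrier) : tCst a w x ≫ ν.lift.map _ _ = cst ν a w x :=
  (Interp.toHom_lift _ _ _).trans (evalElt_eCst ν a w x)

/-- A family of generalized arrows between two `V`-functors out of the weighted bicolimit is
natural when it is natural on the generating arrows. -/
theorem comm_bicolim {E : VCat.{u, v} V}
    {F G : VFunctor (V := V) (bicolim W X).carrier E.carrier} {K : V}
    (m : ∀ s, K ⟶ (F.obj s ⟶[V] G.obj s))
    (hAct : ∀ {d : D} (w : W.obj (op d)) (x x' : (X.obj d).carrier),
      Comm (m (pt d w x)) (tAct w x x' ≫ F.map _ _) (tAct w x x' ≫ G.map _ _) (m (pt d w x')))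
    (hMor : ∀ {d : D} {w w' : W.obj (op d)} (f : w ⟶ w') (x : (X.obj d).carrier),
      Comm (m (pt d w x)) (tMor f x ≫ F.map _ _) (tMor f x ≫ G.map _ _) (m (pt d w' x)))
    (hCst : ∀ {d d' : D} (a : d ⟶ d') (w : W.obj (op d')) (x : (X.obj d).carrier),
      Comm (m (pt d _ x)) (tCst a w x ≫ F.map _ _) (tCst a w x ≫ G.map _ _) (m (pt d' w _)))
    (s t : (bicolim W X).carrier) : Comm (m s) (F.map s t) (G.map s t) (m t) := by
  refine Presentation.comm_of_gen (P := pres W X) m ?_ s t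
  intro s t g
  cases g with
  | act d w x x' => exact hAct w x x'
  | mor f x => exact hMor f x
  | cst a w x => exact hCst a w x
  | cstInv a w x =>
    -- No hypothesis is made for the inverse generators: naturality there follows from naturality at
    -- `tCst`, as `V`-functors preserve the inverse relations.
    refine (hCst a w x).inv (fi := tCstInv a w x ≫ F.map _ _) (gi := tCstInv a w x ≫ G.map _ _)
      ?_ ?_
    · exact (map_comp_post F _ _).symm.trans
        ((congrArg (· ≫ F.map _ _) (uData.cstInv_cst a w x)).trans (F.map_id _))
    · exact (map_comp_post G _ _).symm.trans
        ((congrArg (· ≫ G.map _ _) (uData.cst_cstInv a w x)).trans (G.map_id _))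

end

end Colimit

/-! ### Modifications of weighted cocones in terms of components. -/

section Modifications

open Bicategory
open scoped CategoryTheory.Pseudofunctor.StrongTrans MonoidalCategory

variable {V : Type v} [Category.{u} V] [MonoidalCategory V]
variable {D : Type u} [Bicategory.{u, u} D] {W : Pseudofunctor Dᵒᵖ Cat.{u, u}}
  {X : Pseudofunctor D (VCat.{u, v} V)} {E : VCat.{u, v} V}

/-- The components of a modification between weighted cocones. -/
def modApp {μ ν : Cocone W X E} (Γ : μ ⟶ ν) (d : D) (w : W.obj (op d)) (x : (X.obj d).carrier) :
    𝟙_ V ⟶ ((leg μ d w).obj x ⟶[V] (leg ν d w).obj x) :=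
  VNatTrans.app ((Γ.as.app (op d)).toNatTrans.app w) x

variable {μ ν : Cocone W X E}

theorem modApp_naturality (Γ : μ ⟶ ν) (d : D) (w : W.obj (op d)) (x x' : (X.obj d).carrier) :
    (leg μ d w).map x x' ≫ post _ (modApp Γ d w x') =
      (leg ν d w).map x x' ≫ pre (modApp Γ d w x) _ :=
  VNatTrans.naturality ((Γ.as.app (op d)).toNatTrans.app w) x x'

theorem legMor_modApp (Γ : μ ⟶ ν) {d : D} {w w' : W.obj (op d)} (f : w ⟶ w')
    (x : (X.obj d).carrier) :
    legMor μ f x ≫ post _ (modApp Γ d w' x) = modApp Γ d w x ≫ post _ (legMor ν f x) :=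
  congrArg (fun t => VNatTrans.app t x) ((Γ.as.app (op d)).toNatTrans.naturality f)

theorem cst_modApp (Γ : μ ⟶ ν) {d d' : D} (a : d ⟶ d') (w : W.obj (op d'))
    (x : (X.obj d).carrier) :
    cst μ a w x ≫ post _ (modApp Γ d' w ((fmap X a).obj x)) =
      modApp Γ d ((wmap W a).obj w) x ≫ post _ (cst ν a w x) :=
  (congrArg (fun t => VNatTrans.app (t.toNatTrans.app w) x) (Γ.as.naturality a.op)).symm

theorem cocone_hom_ext {Γ Γ' : μ ⟶ ν} (h : ∀ d w x, modApp Γ d w x = modApp Γ' d w x) : Γ = Γ' :=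
  strong_ext fun d w => VFunctor.hom_ext fun x => h d.unop w x

/-- An isomorphism of weighted cocones from its components. -/
def Cocone.isoMk (e : ∀ d w, leg μ d w ≅ leg ν d w)
    (mor : ∀ {d : D} {w w' : W.obj (op d)} (f : w ⟶ w') (x : (X.obj d).carrier),
      legMor μ f x ≫ post _ (VNatTrans.app (e d w').hom x) =
        VNatTrans.app (e d w).hom x ≫ post _ (legMor ν f x))
    (constraint : ∀ {d d' : D} (a : d ⟶ d') (w : W.obj (op d')) (x : (X.obj d).carrier),
      cst μ a w x ≫ post _ (VNatTrans.app (e d' w).hom ((fmap X a).obj x)) =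
        VNatTrans.app (e d ((wmap W a).obj w)).hom x ≫ post _ (cst ν a w x)) : μ ≅ ν :=
  Pseudofunctor.StrongTrans.isoMk
    (fun d => Cat.Hom.isoMk (NatIso.ofComponents (fun w => e d.unop w)
      (fun f => VFunctor.hom_ext fun x => mor f x)))
    (fun {_ _} f => cat_ext fun w => VFunctor.hom_ext fun x => (constraint f.unop w x).symm)

end Modifications

/-! ### Constraints of the diagram `C ⊗ X -` and of the image of a cocone. -/

section TensorBicolimit

open Bicategory
open scoped CategoryTheory.Pseudofunctor.StrongTrans MonoidalCategory

variable {V : Type v} [Category.{u} V] [MonoidalCategory V] [SymmetricCategory V]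
variable {D : Type u} [Bicategory.{u, u} D] {W : Pseudofunctor Dᵒᵖ Cat.{u, u}}
  {X : Pseudofunctor D (VCat.{u, v} V)} {E : VCat.{u, v} V} (C : VCat.{u, v} V)

theorem tensR_map_tensor {A B : Type u} [EnrichedCategory V A] [EnrichedCategory V B]
    (F : VFunctor (V := V) A B) (c : C.carrier) {Y : V} {a a' : A} (g : Y ⟶ (a ⟶[V] a')) :
    tensR c g ≫ ((VFunctor.id C.carrier).tensor F).map (c, a) (c, a') =
      tensR c (g ≫ F.map a a') := by
  refine (Category.assoc _ _ _).trans (congrArg (_ ≫ ·) ?_)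
  refine (MonoidalCategory.tensorHom_comp_tensorHom _ _ _ _).trans ?_
  exact congrArg (fun t => MonoidalCategory.tensorHom t _) (Category.comp_id _)

theorem tensL_map_tensor {A B : Type u} [EnrichedCategory V A] [EnrichedCategory V B]
    (F : VFunctor (V := V) A B) {Y : V} {c c' : C.carrier} (g : Y ⟶ (c ⟶[V] c')) (a : A) :
    tensL g a ≫ ((VFunctor.id C.carrier).tensor F).map (c, a) (c', a) = tensL g (F.obj a) := by
  refine (Category.assoc _ _ _).trans (congrArg (_ ≫ ·) ?_)
  refine (MonoidalCategory.tensorHom_comp_tensorHom _ _ _ _).trans ?_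
  exact congrArg₂ MonoidalCategory.tensorHom (Category.comp_id _) (F.map_id a)

theorem fmapId_tensorLeft (d : D) (c : C.carrier) (x : (X.obj d).carrier) :
    fmapId (X.comp (tensorLeft C)) d (c, x) = tensR c (fmapId X d x) := by
  have h : fmapId (X.comp (tensorLeft C)) d (c, x) =
    tensR c (fmapId X d x) ≫ post _ (eId V _ ≫ post _ (eId V _)) := rfl
  rw [h, eId_comp_post, post_eId, Category.comp_id]

theorem fmapComp_tensorLeft {d d' d'' : D} (a : d ⟶ d') (b : d' ⟶ d'') (c : C.carrier)
    (x : (X.obj d).carrier) :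
    fmapComp (X.comp (tensorLeft C)) a b (c, x) = tensR c (fmapComp X a b x) := by
  have h : fmapComp (X.comp (tensorLeft C)) a b (c, x) =
    tensR c (fmapComp X a b x) ≫ post _ (eId V _ ≫ post _ (eId V _)) := rfl
  rw [h, eId_comp_post, post_eId, Category.comp_id]

/-- The constraint of this composite transformation is a long pasting, displayed in `h`. Everything
in it is a coherence cell with identity components, apart from the constraint of `l` paired with an
identity and then sent through `F`. -/
theorem cst_tensor {L : VCat.{u, v} V} (l : Cocone W X L) (F : (tensorLeft C).obj L ⟶ E)
    {d d' : D} (a : d ⟶ d') (w : W.obj (op d')) (c : C.carrier) (x : (X.obj d).carrier) :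
    cst (l.map (tensorLeft C) ≫ homToMap _ F) a w (c, x) =
      tensR c (cst l a w x) ≫ F.map (c, (leg l d ((wmap W a).obj w)).obj x)
        (c, (leg l d' w).obj ((fmap X a).obj x)) := by
  have h : cst (l.map (tensorLeft C) ≫ homToMap _ F) a w (c, x) =
    eId V _ ≫ post _ (((eId V _ ≫ post _ (tensR c (cst l a w x) ≫ post _
      (eId V _ ≫ post _ ((eId V _ ≫ post _ (eId V (c, (leg l d' w).obj ((fmap X a).obj x)))) ≫
        post _ (eId V _))))) ≫ F.map _ _) ≫
      post _ (eId V _ ≫ post _ (eId V _ ≫ post _ (eId V _)))) := rfl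
  rw [h]
  simp only [post_eId, eId_comp_post, Category.comp_id]
  rfl

end TensorBicolimit

/-! ### Extending a cocone under `C ⊗ X -` to `C ⊗ bicolim W X`. -/

section Slices

open Bicategory
open scoped CategoryTheory.Pseudofunctor.StrongTrans MonoidalCategory

variable {V : Type v} [Category.{u} V] [MonoidalCategory V] [SymmetricCategory V]
variable {D : Type u} [Bicategory.{u, u} D] {W : Pseudofunctor Dᵒᵖ Cat.{u, u}}
  {X : Pseudofunctor D (VCat.{u, v} V)} {E : VCat.{u, v} V} {C : VCat.{u, v} V}
  (μ : Cocone W (X.comp (tensorLeft C)) E)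

/-- The restriction of a weighted cocone under `C ⊗ X -` to an object of `C`. -/
def sliceData (c : C.carrier) : CoconeData W X E where
  leg d w := (inclR c).comp (leg μ d w)
  mor f x := legMor μ f (c, x)
  cst a w x := cst μ a w (c, x)
  cstInv a w x := cstInv μ a w (c, x)
  mor_naturality f x x' := by
    have h := congrArg (tensR c (𝟙 _) ≫ ·) (legMor_naturality μ f (c, x) (c, x'))
    exact (Category.assoc _ _ _).trans (h.trans (Category.assoc _ _ _).symm)
  mor_id w x := legMor_id μ w (c, x)
  mor_comp f g x := legMor_comp μ f g (c, x)
  cst_naturality {d d'} a w x x' := by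
    have h := congrArg (tensR c (𝟙 _) ≫ ·) (cst_naturality μ a w (c, x) (c, x'))
    refine (Category.assoc _ _ _).trans (h.trans ((Category.assoc _ _ _).symm.trans ?_))
    refine congrArg (· ≫ pre _ _) ?_
    refine (Category.assoc _ _ _).symm.trans ?_
    -- The inclusion at `c` followed by `1 ⊗ X a` equals `X a` followed by the inclusion at `c`.
    refine (congrArg (· ≫ (leg μ d' w).map _ _)
      (tensR_map_tensor C (fmap X a) c (𝟙 (x ⟶[V] x')))).trans ?_
    refine Eq.trans ?_ (Category.assoc _ _ _)
    refine congrArg (· ≫ (leg μ d' w).map _ _) ?_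
    exact (congrArg (tensR c) ((Category.id_comp _).trans (Category.comp_id _).symm)).trans
      (comp_tensR c _ _)
  cst_mor a _ _ f x := legMor_cst μ a f (c, x)
  cst_cstInv a w x := cst_cstInv μ a w (c, x)
  cstInv_cst a w x := cstInv_cst μ a w (c, x)
  cst_map₂ {d d' a b} η w x := by
    refine (cst_map₂ μ η w (c, x)).trans (congrArg (_ ≫ post _ ·) ?_)
    refine Eq.trans ?_ (Category.assoc _ _ _)
    refine congrArg (· ≫ (leg μ d' w).map _ _) ?_
    exact (congrArg (tensR c) (Category.comp_id _).symm).trans (comp_tensR c _ _)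
  cst_id d w x := by
    refine Eq.trans (congrArg (_ ≫ post _ ·) ?_) (cst_id μ d w (c, x))
    refine (Category.assoc _ _ _).symm.trans ?_
    refine congrArg (· ≫ (leg μ d w).map _ _) ?_
    refine Eq.trans ?_ (fmapId_tensorLeft C d c x).symm
    exact (comp_tensR c _ _).symm.trans (congrArg (tensR c) (Category.comp_id _))
  cst_comp {d d' d''} a b w x := by
    refine Eq.trans (congrArg (_ ≫ post _ ·) ?_) (cst_comp μ a b w (c, x))
    refine (Category.assoc _ _ _).symm.trans ?_
    refine congrArg (· ≫ (leg μ d'' w).map _ _) ?_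
    refine Eq.trans ?_ (fmapComp_tensorLeft C a b c x).symm
    exact (comp_tensR c _ _).symm.trans (congrArg (tensR c) (Category.comp_id _))

variable [Limits.HasColimits V] [MonoidalClosed V]

/-- The `V`-functor `bicolim W X ⟶ E` given by the restriction of a cocone to an object of `C`. -/
noncomputable def sliceLift (c : C.carrier) : VFunctor (V := V) (bicolim W X).carrier E.carrier :=
  (sliceData μ c).toCocone.lift

/-- The values on objects of the `V`-functor given by a cocone under `C ⊗ X -`. -/
def tensorObj (c : C.carrier) (s : Pt W X) : E.carrier := (leg μ s.d s.w).obj (c, s.x)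

/-- The action of the hom-objects of `C`. -/
def tensorAct (s : Pt W X) (c c' : C.carrier) :
    (c ⟶[V] c') ⟶ (tensorObj μ c s ⟶[V] tensorObj μ c' s) :=
  tensL (𝟙 _) s.x ≫ (leg μ s.d s.w).map _ _

theorem tAct_sliceLift {d : D} (w : W.obj (op d)) (c : C.carrier) (x x' : (X.obj d).carrier) :
    tAct w x x' ≫ (sliceLift μ c).map _ _ = tensR c (𝟙 _) ≫ (leg μ d w).map (c, x) (c, x') :=
  tAct_lift _ w x x'

theorem tMor_sliceLift {d : D} {w w' : W.obj (op d)} (f : w ⟶ w') (c : C.carrier)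
    (x : (X.obj d).carrier) : tMor f x ≫ (sliceLift μ c).map _ _ = legMor μ f (c, x) :=
  tMor_lift _ f x

theorem tCst_sliceLift {d d' : D} (a : d ⟶ d') (w : W.obj (op d')) (c : C.carrier)
    (x : (X.obj d).carrier) : tCst a w x ≫ (sliceLift μ c).map _ _ = cst μ a w (c, x) :=
  tCst_lift _ a w x

/-- For fixed `c` and `c'` the actions form a family with parameter `C(c, c')`, so naturality on the
bicolimit is a question about generators. At the hom-objects of `X d` it is the image under a leg of
`μ` of the interchange in `C ⊗ X d`. At the arrows of `W` and at the constraints it is the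
`V`-naturality of the cells of `μ` in the variable of `C`. -/
theorem comm_tensorAct (c c' : C.carrier) (s t : (bicolim W X).carrier) :
    Comm (tensorAct μ s c c') ((sliceLift μ c).map s t) ((sliceLift μ c').map s t)
      (tensorAct μ t c c') := by
  refine comm_bicolim (F := sliceLift μ c) (G := sliceLift μ c')
    (fun s => tensorAct μ s c c') ?_ ?_ ?_ s t
  · intro d w x x'
    exact ((comm_tensL_tensR (𝟙 (c ⟶[V] c')) (𝟙 (x ⟶[V] x'))).map
      (leg μ d w).toEnrichedFunctor).congr (tAct_sliceLift μ w c x x') (tAct_sliceLift μ w c' x x')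
  · intro d w w' f x
    refine Comm.congr ?_ (tMor_sliceLift μ f c x) (tMor_sliceLift μ f c' x)
    refine Comm.unit_iff.2 ?_
    have h := congrArg (tensL (𝟙 (c ⟶[V] c')) x ≫ ·) (legMor_naturality μ f (c, x) (c', x))
    exact (Category.assoc _ _ _).trans (h.trans (Category.assoc _ _ _).symm)
  · intro d d' a w x
    refine Comm.congr ?_ (tCst_sliceLift μ a w c x) (tCst_sliceLift μ a w c' x)
    refine Comm.unit_iff.2 ?_
    have h := congrArg (tensL (𝟙 (c ⟶[V] c')) x ≫ ·) (cst_naturality μ a w (c, x) (c', x))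
    refine (Category.assoc _ _ _).trans (h.trans ((Category.assoc _ _ _).symm.trans ?_))
    refine congrArg (· ≫ pre _ _) ?_
    refine (Category.assoc _ _ _).symm.trans ?_
    exact congrArg (· ≫ (leg μ d' w).map _ _) (tensL_map_tensor C (fmap X a) (𝟙 (c ⟶[V] c')) x)

/-- The `V`-functor `C ⊗ bicolim W X ⟶ E` given by a cocone under `C ⊗ X -`. -/
noncomputable def tensorLift :
    VFunctor (V := V) (C.carrier × (bicolim W X).carrier) E.carrier :=
  VFunctor.glue (fun c s => tensorObj μ c s) (fun s c c' => tensorAct μ s c c')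
    (fun c s t => (sliceLift μ c).map s t)
    (fun s c => ((inclL (A := (X.obj s.d).carrier) s.x).comp (leg μ s.d s.w)).map_id c)
    (fun c s => (sliceLift μ c).map_id s)
    (fun s c c' c'' => ((inclL (A := (X.obj s.d).carrier) s.x).comp (leg μ s.d s.w)).map_comp c c' c'')
    (fun c s t r => (sliceLift μ c).map_comp s t r)
    (fun c c' s t => comm_tensorAct μ c c' s t)

end Slices

/-! ### `C ⊗ -` preserves the constructed bicolimit. -/

section TensorUniversal

open Bicategory
open scoped CategoryTheory.Pseudofunctor.StrongTrans MonoidalCategory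

variable {V : Type v} [Category.{u} V] [MonoidalCategory V] [SymmetricCategory V]
variable {D : Type u} [Bicategory.{u, u} D] {W : Pseudofunctor Dᵒᵖ Cat.{u, u}}
  {X : Pseudofunctor D (VCat.{u, v} V)} {E : VCat.{u, v} V} {C : VCat.{u, v} V}
variable [Limits.HasColimits V] [MonoidalClosed V]

section

variable (μ : Cocone W (X.comp (tensorLeft C)) E)

/-- In the glued action on `(1, g)` the factor from `C` is the action of the identity of `c`, hence
trivial. -/
theorem tensR_tensorLift (c : C.carrier) {s t : (bicolim W X).carrier} {Y : V}
    (g : Y ⟶ (s ⟶[V] t)) :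
    tensR c g ≫ (tensorLift μ).map (c, s) (c, t) = g ≫ (sliceLift μ c).map s t := by
  refine (Category.assoc _ _ _).trans ?_
  refine (congrArg (_ ≫ ·) (comp_star_comp (eId V c) g (tensorAct μ s c c)
    ((sliceLift μ c).map s t)).symm).trans ?_
  rw [show eId V c ≫ tensorAct μ s c c = eId V (tensorObj μ c s) from
    ((inclL (A := (X.obj s.d).carrier) s.x).comp (leg μ s.d s.w)).map_id c]
  refine (congrArg (_ ≫ ·) (eId_star _)).trans ?_
  exact Iso.inv_hom_id_assoc _ _

/-- Both sides are the product of the same two partial actions: on the left by the construction of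
`glue`, on the right by `map_eq_star`. -/
theorem leg_tensorLift (d : D) (w : W.obj (op d)) (y y' : C.carrier × (X.obj d).carrier) :
    (((VFunctor.id C.carrier).tensor (uLeg (W := W) d w)).comp (tensorLift μ)).map y y' =
      (leg μ d w).map y y' := by
  obtain ⟨c, x⟩ := y
  obtain ⟨c', x'⟩ := y'
  refine (comp_star_comp (𝟙 (c ⟶[V] c')) (tAct w x x') (tensorAct μ ⟨d, w, x⟩ c c')
    ((sliceLift μ c').map (pt d w x) (pt d w x'))).symm.trans ?_
  refine Eq.trans ?_ (map_eq_star (leg μ d w) c c' x x').symm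
  exact congrArg₂ star (Category.id_comp _) (tAct_sliceLift μ w c' x x')

/-- The cocone induced by `tensorLift μ` is isomorphic to `μ`. -/
noncomputable def tensorLiftIso :
    (uData (W := W) (X := X)).toCocone.map (tensorLeft C) ≫
      homToMap (X.comp (tensorLeft C)) (E := (tensorLeft C).obj (bicolim W X))
        (tensorLift μ : VFunctor (V := V) _ _) ≅ μ :=
  Cocone.isoMk
    (fun d w => VFunctor.isoMk (fun y => eId V ((leg μ d w).obj y))
      (fun y => eId V ((leg μ d w).obj y))
      (fun y y' => id_naturality _ _ (leg_tensorLift μ d w y y'))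
      (fun y => eId_comp_post _) (fun y => eId_comp_post _))
    (fun {d w w'} f y => by
      refine Eq.trans ?_ (eId_comp_post _).symm
      refine (congrArg (_ ≫ ·) (post_eId _ _)).trans ((Category.comp_id _).trans ?_)
      exact (tensR_tensorLift μ y.1 (tMor f y.2)).trans (tMor_sliceLift μ f y.1 y.2))
    (fun {d d'} a w y => by
      refine Eq.trans ?_ (eId_comp_post _).symm
      refine (congrArg (_ ≫ ·) (post_eId _ _)).trans ((Category.comp_id _).trans ?_)
      refine (cst_tensor C _ _ a w y.1 y.2).trans ?_
      exact (tensR_tensorLift μ y.1 (tCst a w y.2)).trans (tCst_sliceLift μ a w y.1 y.2))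

end

/-- Naturality on `C ⊗ bicolim W X` splits into the two variables. In the direction of `C` it is the
`V`-naturality of the components of `Γ`. In the direction of the bicolimit it is tested on
generators, where it becomes `V`-naturality in `x`, naturality in `w` and the modification axiom. -/
theorem comm_of_modification {F G : (tensorLeft C).obj (bicolim W X) ⟶ E}
    (Γ : (uData (W := W) (X := X)).toCocone.map (tensorLeft C) ≫ homToMap _ F ⟶
      (uData (W := W) (X := X)).toCocone.map (tensorLeft C) ≫ homToMap _ G)
    (y y' : C.carrier × (bicolim W X).carrier) :
    Comm (E := E.carrier) (modApp Γ y.2.d y.2.w (y.1, y.2.x)) (F.map y y') (G.map y y')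
      (modApp Γ y'.2.d y'.2.w (y'.1, y'.2.x)) := by
  refine comm_of_comm (H := F) (H' := G)
    (fun y => (modApp Γ y.2.d y.2.w (y.1, y.2.x) : 𝟙_ V ⟶ (F.obj y ⟶[V] G.obj y))) ?_ ?_ y y'
  · intro c c' s
    refine Comm.unit_iff'.2 ?_
    have h := congrArg (tensL (𝟙 (c ⟶[V] c')) s.x ≫ ·)
      (modApp_naturality Γ s.d s.w (c, s.x) (c', s.x))
    -- The legs of the universal cocone preserve identities, so in the direction of `C` the legs of
    -- the induced cocone act as `H` itself.
    have e : ∀ H : (tensorLeft C).obj (bicolim W X) ⟶ E,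
        tensL (𝟙 (c ⟶[V] c')) s.x ≫ (((VFunctor.id C.carrier).tensor (uLeg (W := W) s.d s.w)).comp
          H).map (c, s.x) (c', s.x) = tensL (𝟙 (c ⟶[V] c')) s ≫ H.map (c, s) (c', s) := fun H =>
      (Category.assoc _ _ _).symm.trans (congrArg (· ≫ H.map (c, s) (c', s))
        (tensL_map_tensor C (uLeg (W := W) s.d s.w) (𝟙 (c ⟶[V] c')) s.x))
    refine (congrArg (· ≫ post _ _) (e F)).symm.trans ?_
    refine (Category.assoc _ _ _).trans (h.trans ((Category.assoc _ _ _).symm.trans ?_))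
    exact congrArg (· ≫ pre _ _) (e G)
  · intro c s t
    refine comm_bicolim (F := (inclR c).comp F) (G := (inclR c).comp G)
      (fun s => modApp Γ s.d s.w (c, s.x)) ?_ ?_ ?_ s t
    · intro d w x x'
      refine Comm.unit_iff'.2 ?_
      have h := congrArg (tensR c (𝟙 (x ⟶[V] x')) ≫ ·)
        (modApp_naturality Γ d w (c, x) (c, x'))
      have e : ∀ H : (tensorLeft C).obj (bicolim W X) ⟶ E,
          tensR c (𝟙 (x ⟶[V] x')) ≫ (((VFunctor.id C.carrier).tensor (uLeg (W := W) d w)).comp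
            H).map (c, x) (c, x') = tAct w x x' ≫ ((inclR c).comp H).map _ _ := fun H => by
        refine (Category.assoc _ _ _).symm.trans (Eq.trans ?_ (Category.assoc _ _ _))
        refine congrArg (· ≫ H.map (c, pt d w x) (c, pt d w x')) ?_
        refine (tensR_map_tensor C (uLeg (W := W) d w) c (𝟙 (x ⟶[V] x'))).trans ?_
        exact (congrArg (tensR c) ((Category.id_comp _).trans (Category.comp_id _).symm)).trans
          (comp_tensR c _ _)
      refine (congrArg (· ≫ post _ _) (e F)).symm.trans ?_
      refine (Category.assoc _ _ _).trans (h.trans ((Category.assoc _ _ _).symm.trans ?_))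
      exact congrArg (· ≫ pre _ _) (e G)
    · intro d w w' f x
      have e : ∀ H : (tensorLeft C).obj (bicolim W X) ⟶ E,
          tMor f x ≫ ((inclR c).comp H).map _ _ =
            tensR c (tMor f x) ≫ H.map (c, pt d w x) (c, pt d w' x) := fun H =>
        (Category.assoc _ _ _).symm.trans (congrArg (· ≫ H.map (c, pt d w x) (c, pt d w' x))
          ((comp_tensR c _ _).symm.trans (congrArg (tensR c) (Category.comp_id _))))
      refine Comm.congr (Comm.unit_iff.2 ?_) (e F) (e G)
      -- `comp_post_eq_comp_pre` turns the composite written with `post` into the one written with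
      -- `pre`, as the form `Comm` takes on the unit requires.
      exact (legMor_modApp Γ f (c, x)).symm.trans (comp_post_eq_comp_pre _ _)
    · intro d d' a w x
      have e : ∀ H : (tensorLeft C).obj (bicolim W X) ⟶ E,
          tCst a w x ≫ ((inclR c).comp H).map _ _ =
            cst ((uData (W := W) (X := X)).toCocone.map (tensorLeft C) ≫ homToMap _ H)
              a w (c, x) := fun H =>
        (Category.assoc _ _ _).symm.trans
          ((congrArg (· ≫ H.map (c, pt d _ x) (c, pt d' w _)) ((comp_tensR c _ _).symm.trans
            (congrArg (tensR c) (Category.comp_id _)))).trans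
              (cst_tensor C (uData (W := W) (X := X)).toCocone H a w c x).symm)
      refine Comm.congr (Comm.unit_iff.2 ?_) (e F) (e G)
      exact (cst_modApp Γ a w (c, x)).symm.trans (comp_post_eq_comp_pre _ _)

/-- Full faithfulness holds because 2-cells and modifications have the same components, with
equivalent naturality conditions by `comm_of_modification`. Essential surjectivity is the extension
`tensorLift`. -/
theorem uData_tensorLeft_isBicolimit :
    ((uData (W := W) (X := X)).toCocone.map (tensorLeft C)).IsBicolimit := by
  intro E
  refine { faithful := ⟨fun {F G} α β h => ?_⟩, full := ⟨fun {F G} Γ => ?_⟩, essSurj := ⟨fun μ => ?_⟩ }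
  · refine VFunctor.hom_ext fun y => ?_
    exact congrArg (fun Γ => modApp Γ y.2.d y.2.w (y.1, y.2.x)) h
  · refine ⟨{ app := fun y => modApp (μ := _ ≫ homToMap _ F) (ν := _ ≫ homToMap _ G) Γ y.2.d y.2.w (y.1, y.2.x), naturality := fun y y' => Comm.unit_iff'.1 (comm_of_modification Γ y y') }, ?_⟩
    exact cocone_hom_ext fun d w x => rfl
  · exact ⟨tensorLift μ, ⟨tensorLiftIso μ⟩⟩

end TensorUniversal

/-! ### Invertible modifications, and modifications from components. -/

section Modifications

open Bicategory
open scoped CategoryTheory.Pseudofunctor.StrongTrans MonoidalCategory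

variable {V : Type v} [Category.{u} V] [MonoidalCategory V]
variable {D : Type u} [Bicategory.{u, u} D] {W : Pseudofunctor Dᵒᵖ Cat.{u, u}}
  {X : Pseudofunctor D (VCat.{u, v} V)} {E : VCat.{u, v} V} {μ ν ρ : Cocone W X E}

theorem modApp_hom_inv (e : μ ≅ ν) (d : D) (w : W.obj (op d)) (x : (X.obj d).carrier) :
    modApp e.hom d w x ≫ post _ (modApp e.inv d w x) = eId V _ :=
  congrArg (fun Γ => modApp Γ d w x) e.hom_inv_id

theorem modApp_inv_hom (e : μ ≅ ν) (d : D) (w : W.obj (op d)) (x : (X.obj d).carrier) :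
    modApp e.inv d w x ≫ post _ (modApp e.hom d w x) = eId V _ :=
  congrArg (fun Γ => modApp Γ d w x) e.inv_hom_id

/-- A modification between weighted cocones from its components. -/
def modMk (m : ∀ (d : D) (w : W.obj (op d)) (x : (X.obj d).carrier),
      𝟙_ V ⟶ ((leg μ d w).obj x ⟶[V] (leg ν d w).obj x))
    (naturality : ∀ (d : D) (w : W.obj (op d)) (x x' : (X.obj d).carrier),
      (leg μ d w).map x x' ≫ post _ (m d w x') = (leg ν d w).map x x' ≫ pre (m d w x) _)
    (mor : ∀ {d : D} {w w' : W.obj (op d)} (f : w ⟶ w') (x : (X.obj d).carrier),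
      legMor μ f x ≫ post _ (m d w' x) = m d w x ≫ post _ (legMor ν f x))
    (constraint : ∀ {d d' : D} (a : d ⟶ d') (w : W.obj (op d')) (x : (X.obj d).carrier),
      cst μ a w x ≫ post _ (m d' w ((fmap X a).obj x)) =
        m d ((wmap W a).obj w) x ≫ post _ (cst ν a w x)) : μ ⟶ ν where
  as :=
    { app := fun d => NatTrans.toCatHom₂ (C := W.obj d) (D := X.obj d.unop ⟶ E)
        { app := fun w => { app := m d.unop w, naturality := naturality d.unop w }
          naturality := fun _ _ f => VFunctor.hom_ext fun x => mor f x }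
      naturality := fun {_ _} f => cat_ext fun w => VFunctor.hom_ext fun x =>
        (constraint f.unop w x).symm }

end Modifications

/-! ### The symmetry of the tensor product of `V`-categories. -/

section Swap

open MonoidalCategory

variable {V : Type v} [Category.{u} V] [MonoidalCategory V] [SymmetricCategory V]
variable (A B : Type u) [EnrichedCategory V A] [EnrichedCategory V B]

/-- The symmetry `A ⊗ B ⟶ B ⊗ A` of the tensor product of `V`-categories. -/
def VFunctor.swap : VFunctor (V := V) (A × B) (B × A) :=
  VFunctor.glue (fun a b => (b, a)) (fun b a a' => tensR b (𝟙 (a ⟶[V] a')))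
    (fun a b b' => tensL (𝟙 (b ⟶[V] b')) a) (fun b a => (inclR b).map_id a)
    (fun a b => (inclL a).map_id b) (fun b a a' a'' => (inclR b).map_comp a a' a'')
    (fun a b b' b'' => (inclL a).map_comp b b' b'') (fun _ _ _ _ => (comm_tensL_tensR _ _).symm)

variable {A B}

theorem swap_map (y y' : A × B) :
    (VFunctor.swap (V := V) A B).map y y' = (β_ (y.1 ⟶[V] y'.1) (y.2 ⟶[V] y'.2)).hom := by
  refine (tensR_star_tensL (𝟙 (y.2 ⟶[V] y'.2)) (𝟙 (y.1 ⟶[V] y'.1))).trans ?_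
  exact (congrArg (_ ≫ ·) (id_tensorHom_id _ _)).trans (Category.comp_id _)

theorem swap_map_swap_map (y y' : A × B) :
    (VFunctor.swap (V := V) A B).map y y' ≫ (VFunctor.swap (V := V) B A).map (y.2, y.1) (y'.2, y'.1) =
      𝟙 (y ⟶[V] y') :=
  (congrArg₂ (· ≫ ·) (swap_map y y') (swap_map (y.2, y.1) (y'.2, y'.1))).trans
    (SymmetricCategory.symmetry _ _)

/-- The braiding is natural, and the copy of it on the two unit objects is the identity. -/
theorem pair_swap_map {a a' : A} {b b' : B} (f : 𝟙_ V ⟶ (a ⟶[V] a')) (g : 𝟙_ V ⟶ (b ⟶[V] b')) :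
    pair f g ≫ (VFunctor.swap (V := V) A B).map (a, b) (a', b') = pair g f := by
  refine (congrArg (_ ≫ ·) (swap_map (a, b) (a', b'))).trans ?_
  refine (Category.assoc _ _ _).trans ?_
  refine (congrArg (_ ≫ ·) (BraidedCategory.braiding_naturality f g)).trans ?_
  have h : (β_ (𝟙_ V) (𝟙_ V)).hom = 𝟙 _ := by
    rw [braiding_tensorUnit_left, unitors_equal, Iso.hom_inv_id]
  rw [h, Category.id_comp]
  rfl

variable {A' B' : Type u} [EnrichedCategory V A'] [EnrichedCategory V B']

theorem tensor_swap_map (F : VFunctor (V := V) A A') (G : VFunctor (V := V) B B') (y y' : A × B) :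
    (F.tensor G).map y y' ≫ (VFunctor.swap (V := V) A' B').map _ _ =
      (VFunctor.swap (V := V) A B).map y y' ≫ (G.tensor F).map (y.2, y.1) (y'.2, y'.1) := by
  refine (congrArg (_ ≫ ·) (swap_map _ _)).trans (Eq.trans ?_ (congrArg (· ≫ _) (swap_map _ _).symm))
  exact BraidedCategory.braiding_naturality _ _

end Swap

/-! ### Passing from cocones under `X - ⊗ C` to cocones under `C ⊗ X -`. -/

section TensorRight

open Bicategory
open scoped CategoryTheory.Pseudofunctor.StrongTrans MonoidalCategory

variable {V : Type v} [Category.{u} V] [MonoidalCategory V] [SymmetricCategory V]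
variable {D : Type u} [Bicategory.{u, u} D] {W : Pseudofunctor Dᵒᵖ Cat.{u, u}}
  {X : Pseudofunctor D (VCat.{u, v} V)} {E : VCat.{u, v} V} {C : VCat.{u, v} V}

theorem fmapId_tensorRight (d : D) (c : C.carrier) (x : (X.obj d).carrier) :
    fmapId (X.comp (tensorRight C)) d (x, c) = pair (fmapId X d x) (eId V c) := by
  have h : fmapId (X.comp (tensorRight C)) d (x, c) =
    pair (fmapId X d x) (eId V c) ≫ post _ (eId V _ ≫ post _ (eId V _)) := rfl
  rw [h, eId_comp_post, post_eId, Category.comp_id]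

theorem fmapComp_tensorRight {d d' d'' : D} (a : d ⟶ d') (b : d' ⟶ d'') (c : C.carrier)
    (x : (X.obj d).carrier) :
    fmapComp (X.comp (tensorRight C)) a b (x, c) = pair (fmapComp X a b x) (eId V c) := by
  have h : fmapComp (X.comp (tensorRight C)) a b (x, c) =
    pair (fmapComp X a b x) (eId V c) ≫ post _ (eId V _ ≫ post _ (eId V _)) := rfl
  rw [h, eId_comp_post, post_eId, Category.comp_id]

theorem cst_tensorRight {L : VCat.{u, v} V} (l : Cocone W X L) (F : (tensorRight C).obj L ⟶ E)
    {d d' : D} (a : d ⟶ d') (w : W.obj (op d')) (c : C.carrier) (x : (X.obj d).carrier) :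
    cst (l.map (tensorRight C) ≫ homToMap _ F) a w (x, c) =
      pair (cst l a w x) (eId V c) ≫ F.map ((leg l d ((wmap W a).obj w)).obj x, c)
        ((leg l d' w).obj ((fmap X a).obj x), c) := by
  have h : cst (l.map (tensorRight C) ≫ homToMap _ F) a w (x, c) =
    eId V _ ≫ post _ (((eId V _ ≫ post _ (pair (cst l a w x) (eId V c) ≫ post _
      (eId V _ ≫ post _ ((eId V _ ≫ post _ (eId V ((leg l d' w).obj ((fmap X a).obj x), c))) ≫
        post _ (eId V _))))) ≫ F.map _ _) ≫
      post _ (eId V _ ≫ post _ (eId V _ ≫ post _ (eId V _)))) := rfl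
  rw [h]
  simp only [post_eId, eId_comp_post, Category.comp_id]
  rfl

/-- The weighted cocone under `C ⊗ X -` given by a weighted cocone under `X - ⊗ C`. -/
def swapData (μ : Cocone W (X.comp (tensorRight C)) E) :
    CoconeData W (X.comp (tensorLeft C)) E where
  leg d w := (VFunctor.swap C.carrier (X.obj d).carrier).comp (leg μ d w)
  mor f y := legMor μ f (y.2, y.1)
  cst a w y := cst μ a w (y.2, y.1)
  cstInv a w y := cstInv μ a w (y.2, y.1)
  mor_naturality f y y' := by
    have h := congrArg ((VFunctor.swap C.carrier _).map y y' ≫ ·)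
      (legMor_naturality μ f (y.2, y.1) (y'.2, y'.1))
    exact (Category.assoc _ _ _).trans (h.trans (Category.assoc _ _ _).symm)
  mor_id w y := legMor_id μ w (y.2, y.1)
  mor_comp f g y := legMor_comp μ f g (y.2, y.1)
  cst_naturality {d d'} a w y y' := by
    have h := congrArg ((VFunctor.swap C.carrier _).map y y' ≫ ·)
      (cst_naturality μ a w (y.2, y.1) (y'.2, y'.1))
    refine (Category.assoc _ _ _).trans (h.trans ((Category.assoc _ _ _).symm.trans ?_))
    refine congrArg (· ≫ pre _ _) ?_
    refine (Category.assoc _ _ _).symm.trans (Eq.trans ?_ (Category.assoc _ _ _))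
    exact congrArg (· ≫ (leg μ d' w).map _ _)
      (tensor_swap_map (VFunctor.id C.carrier) (fmap X a) y y').symm
  cst_mor a _ _ f y := legMor_cst μ a f (y.2, y.1)
  cst_cstInv a w y := cst_cstInv μ a w (y.2, y.1)
  cstInv_cst a w y := cstInv_cst μ a w (y.2, y.1)
  cst_map₂ {d d' a b} η w y := by
    refine (cst_map₂ μ η w (y.2, y.1)).trans (congrArg (_ ≫ post _ ·) ?_)
    refine Eq.trans ?_ (Category.assoc _ _ _)
    exact congrArg (· ≫ (leg μ d' w).map _ _) (pair_swap_map (eId V y.1) (fmap₂ X η y.2)).symm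
  cst_id d w y := by
    refine Eq.trans (congrArg (_ ≫ post _ ·) ?_) (cst_id μ d w (y.2, y.1))
    refine (Category.assoc _ _ _).symm.trans ?_
    refine congrArg (· ≫ (leg μ d w).map _ _) ?_
    refine Eq.trans ?_ (fmapId_tensorRight d y.1 y.2).symm
    exact (congrArg (· ≫ _) (fmapId_tensorLeft C d y.1 y.2)).trans
      (pair_swap_map (eId V y.1) (fmapId X d y.2))
  cst_comp {d d' d''} a b w y := by
    refine Eq.trans (congrArg (_ ≫ post _ ·) ?_) (cst_comp μ a b w (y.2, y.1))
    refine (Category.assoc _ _ _).symm.trans ?_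
    refine congrArg (· ≫ (leg μ d'' w).map _ _) ?_
    refine Eq.trans ?_ (fmapComp_tensorRight a b y.1 y.2).symm
    exact (congrArg (· ≫ _) (fmapComp_tensorLeft C a b y.1 y.2)).trans
      (pair_swap_map (eId V y.1) (fmapComp X a b y.2))

end TensorRight

/-! ### Preservation by `- ⊗ C` from preservation by `C ⊗ -`. -/

section TensorSwap

open Bicategory
open scoped CategoryTheory.Pseudofunctor.StrongTrans MonoidalCategory

variable {V : Type v} [Category.{u} V] [MonoidalCategory V] [SymmetricCategory V]
variable {D : Type u} [Bicategory.{u, u} D] {W : Pseudofunctor Dᵒᵖ Cat.{u, u}}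
  {X : Pseudofunctor D (VCat.{u, v} V)} {E L : VCat.{u, v} V} {C : VCat.{u, v} V}
  (l : Cocone W X L)

/-- The cocone under `C ⊗ X -` induced by `l` and a `V`-functor out of `C ⊗ L`. -/
abbrev coconeLeft (F : VFunctor (V := V) (C.carrier × L.carrier) E.carrier) :
    Cocone W (X.comp (tensorLeft C)) E :=
  l.map (tensorLeft C) ≫ homToMap (X.comp (tensorLeft C)) (E := (tensorLeft C).obj L) F

/-- The cocone under `X - ⊗ C` induced by `l` and a `V`-functor out of `L ⊗ C`. -/
abbrev coconeRight (F : VFunctor (V := V) (L.carrier × C.carrier) E.carrier) :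
    Cocone W (X.comp (tensorRight C)) E :=
  l.map (tensorRight C) ≫ homToMap (X.comp (tensorRight C)) (E := (tensorRight C).obj L) F

/-- The symmetry is invertible on hom-objects, so naturality may be tested after precomposing with
it. -/
theorem swap_comp_map {A B : Type u} [EnrichedCategory V A] [EnrichedCategory V B]
    {F G : VFunctor (V := V) (A × B) E.carrier}
    (m : ∀ y, 𝟙_ V ⟶ (F.obj y ⟶[V] G.obj y)) (y y' : A × B)
    (h : ((VFunctor.swap B A).comp F).map (y.2, y.1) (y'.2, y'.1) ≫ post _ (m y') =
      ((VFunctor.swap B A).comp G).map (y.2, y.1) (y'.2, y'.1) ≫ pre (m y) _) :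
    F.map y y' ≫ post _ (m y') = G.map y y' ≫ pre (m y) _ := by
  have e : ∀ H : VFunctor (V := V) (A × B) E.carrier,
      (VFunctor.swap A B).map y y' ≫ ((VFunctor.swap B A).comp H).map (y.2, y.1) (y'.2, y'.1) =
        H.map y y' := fun H =>
    (Category.assoc _ _ _).symm.trans ((congrArg (· ≫ H.map y y') (swap_map_swap_map y y')).trans
      (Category.id_comp _))
  refine (congrArg (· ≫ post _ _) (e F)).symm.trans ?_
  refine (Category.assoc _ _ _).trans ((congrArg (_ ≫ ·) h).trans ?_)
  exact (Category.assoc _ _ _).symm.trans (congrArg (· ≫ pre _ _) (e G))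

section

variable (F : VFunctor (V := V) (L.carrier × C.carrier) E.carrier)

/-- This lemma and the next two compare legs, arrows and constraints of the two induced cocones; up
to exchanging the coordinates they agree, by naturality of the braiding. -/
theorem leg_coconeLeft_swap (d : D) (w : W.obj (op d)) (y y' : C.carrier × (X.obj d).carrier) :
    (leg (coconeLeft l ((VFunctor.swap _ _).comp F)) d w).map y y' =
      (VFunctor.swap _ _).map y y' ≫ (leg (coconeRight l F) d w).map (y.2, y.1) (y'.2, y'.1) := by
  refine (Category.assoc _ _ _).symm.trans (Eq.trans ?_ (Category.assoc _ _ _))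
  exact congrArg (· ≫ F.map _ _) (tensor_swap_map (VFunctor.id C.carrier) (leg l d w) y y')

theorem legMor_coconeLeft_swap {d : D} {w w' : W.obj (op d)} (f : w ⟶ w')
    (y : C.carrier × (X.obj d).carrier) :
    legMor (coconeLeft l ((VFunctor.swap _ _).comp F)) f y =
      legMor (coconeRight l F) f (y.2, y.1) := by
  refine (Category.assoc _ _ _).symm.trans ?_
  exact congrArg (· ≫ F.map _ _) (pair_swap_map (eId V y.1) (legMor l f y.2))

theorem cst_coconeLeft_swap {d d' : D} (a : d ⟶ d') (w : W.obj (op d'))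
    (y : C.carrier × (X.obj d).carrier) :
    cst (coconeLeft l ((VFunctor.swap _ _).comp F)) a w y =
      cst (coconeRight l F) a w (y.2, y.1) := by
  refine (cst_tensor C l _ a w y.1 y.2).trans (Eq.trans ?_ (cst_tensorRight l F a w y.1 y.2).symm)
  refine (Category.assoc _ _ _).symm.trans ?_
  exact congrArg (· ≫ F.map _ _) (pair_swap_map (eId V y.1) (cst l a w y.2))

end

section

variable (F : VFunctor (V := V) (C.carrier × L.carrier) E.carrier)

theorem leg_coconeRight_swap (d : D) (w : W.obj (op d)) (y y' : (X.obj d).carrier × C.carrier) :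
    (leg (coconeRight l ((VFunctor.swap _ _).comp F)) d w).map y y' =
      (VFunctor.swap _ _).map y y' ≫ (leg (coconeLeft l F) d w).map (y.2, y.1) (y'.2, y'.1) := by
  refine (Category.assoc _ _ _).symm.trans (Eq.trans ?_ (Category.assoc _ _ _))
  exact congrArg (· ≫ F.map _ _) (tensor_swap_map (leg l d w) (VFunctor.id C.carrier) y y')

theorem legMor_coconeRight_swap {d : D} {w w' : W.obj (op d)} (f : w ⟶ w')
    (y : (X.obj d).carrier × C.carrier) :
    legMor (coconeRight l ((VFunctor.swap _ _).comp F)) f y =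
      legMor (coconeLeft l F) f (y.2, y.1) := by
  refine (Category.assoc _ _ _).symm.trans ?_
  exact congrArg (· ≫ F.map _ _) (pair_swap_map (legMor l f y.1) (eId V y.2))

theorem cst_coconeRight_swap {d d' : D} (a : d ⟶ d') (w : W.obj (op d'))
    (y : (X.obj d).carrier × C.carrier) :
    cst (coconeRight l ((VFunctor.swap _ _).comp F)) a w y =
      cst (coconeLeft l F) a w (y.2, y.1) := by
  refine (cst_tensorRight l _ a w y.2 y.1).trans (Eq.trans ?_ (cst_tensor C l F a w y.2 y.1).symm)
  refine (Category.assoc _ _ _).symm.trans ?_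
  exact congrArg (· ≫ F.map _ _) (pair_swap_map (cst l a w y.1) (eId V y.2))

end

variable {l}

/-- The modification under `C ⊗ X -` given by a modification under `X - ⊗ C`. -/
def swapModification {F G : VFunctor (V := V) (L.carrier × C.carrier) E.carrier}
    (Γ : coconeRight l F ⟶ coconeRight l G) :
    coconeLeft l ((VFunctor.swap _ _).comp F) ⟶ coconeLeft l ((VFunctor.swap _ _).comp G) :=
  modMk (fun d w y => modApp Γ d w (y.2, y.1))
    (fun d w y y' => by
      refine (congrArg (· ≫ post _ _) (leg_coconeLeft_swap l F d w y y')).trans ?_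
      refine Eq.trans ?_ (congrArg (· ≫ pre _ _) (leg_coconeLeft_swap l G d w y y')).symm
      refine (Category.assoc _ _ _).trans (Eq.trans ?_ (Category.assoc _ _ _).symm)
      exact congrArg (_ ≫ ·) (modApp_naturality Γ d w (y.2, y.1) (y'.2, y'.1)))
    (fun {d w w'} f y => by
      refine (congrArg (· ≫ post _ _) (legMor_coconeLeft_swap l F f y)).trans ?_
      refine Eq.trans ?_ (congrArg (_ ≫ post _ ·) (legMor_coconeLeft_swap l G f y)).symm
      exact legMor_modApp Γ f (y.2, y.1))
    (fun {d d'} a w y => by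
      refine (congrArg (· ≫ post _ _) (cst_coconeLeft_swap l F a w y)).trans ?_
      refine Eq.trans ?_ (congrArg (_ ≫ post _ ·) (cst_coconeLeft_swap l G a w y)).symm
      exact cst_modApp Γ a w (y.2, y.1))

/-- An isomorphism of cocones under `X - ⊗ C` given by one under `C ⊗ X -`. -/
def swapIso {F : VFunctor (V := V) (C.carrier × L.carrier) E.carrier}
    {μ : Cocone W (X.comp (tensorRight C)) E} (e : coconeLeft l F ≅ (swapData μ).toCocone) :
    coconeRight l ((VFunctor.swap _ _).comp F) ≅ μ :=
  Cocone.isoMk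
    (fun d w => VFunctor.isoMk (fun y => modApp e.hom d w (y.2, y.1))
      (fun y => modApp e.inv d w (y.2, y.1))
      (fun y y' => by
        refine swap_comp_map (F := leg (coconeRight l ((VFunctor.swap _ _).comp F)) d w)
          (G := leg μ d w) (fun y => modApp e.hom d w (y.2, y.1)) y y' ?_
        refine Eq.trans ?_ (modApp_naturality e.hom d w (y.2, y.1) (y'.2, y'.1))
        refine congrArg (· ≫ post _ _) ?_
        refine (congrArg (_ ≫ ·) (leg_coconeRight_swap l F d w y y')).trans ?_
        refine (Category.assoc _ _ _).symm.trans ?_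
        exact (congrArg (· ≫ _) (swap_map_swap_map (y.2, y.1) (y'.2, y'.1))).trans
          (Category.id_comp _))
      (fun y => modApp_hom_inv e d w (y.2, y.1)) (fun y => modApp_inv_hom e d w (y.2, y.1)))
    (fun {d w w'} f y =>
      (congrArg (· ≫ post _ _) (legMor_coconeRight_swap l F f y)).trans
        (legMor_modApp e.hom f (y.2, y.1)))
    (fun {d d'} a w y =>
      (congrArg (· ≫ post _ _) (cst_coconeRight_swap l F a w y)).trans
        (cst_modApp e.hom a w (y.2, y.1)))

/-- The symmetry, applied to the vertex and to every stage of the diagram, conjugates one comparison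
functor into the other. Each of the three properties is transported along it, and a component at `y`
becomes the component at `(y.2, y.1)`. -/
theorem isBicolimit_map_tensorRight (h : (l.map (tensorLeft C)).IsBicolimit) :
    (l.map (tensorRight C)).IsBicolimit := by
  intro E
  have hE := h E
  refine
    { faithful := ⟨fun {F G} α β hαβ => ?_⟩
      full := ⟨fun {F G} Γ => ?_⟩
      essSurj := ⟨fun μ => ?_⟩ }
  · have e : VFunctor.whiskerLeft (VFunctor.swap _ _) α =
        VFunctor.whiskerLeft (VFunctor.swap _ _) β :=
      ((l.map (tensorLeft C)).comparison.app E).toFunctor.map_injective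
        (cocone_hom_ext fun d w y => congrArg (fun Γ => modApp Γ d w (y.2, y.1)) hαβ)
    exact VFunctor.hom_ext fun y => congrArg (fun γ => VNatTrans.app γ (y.2, y.1)) e
  · obtain ⟨α, hα⟩ := hE.full.map_surjective
      (X := (VFunctor.swap C.carrier L.carrier).comp F)
      (Y := (VFunctor.swap C.carrier L.carrier).comp G) (swapModification Γ)
    refine ⟨{ app := fun y => VNatTrans.app α (y.2, y.1), naturality := fun y y' => ?_ }, ?_⟩
    · exact swap_comp_map (F := F) (G := G) (fun y => VNatTrans.app α (y.2, y.1)) y y'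
        (VNatTrans.naturality α (y.2, y.1) (y'.2, y'.1))
    · exact cocone_hom_ext fun d w y => congrArg (fun Γ => modApp Γ d w (y.2, y.1)) hα
  -- The cocone `μ` is swapped to one under `C ⊗ X -`, represented there by a `V`-functor, and that
  -- `V`-functor is swapped back.
  · let e := ((l.map (tensorLeft C)).comparison.app E).toFunctor.objObjPreimageIso
      (swapData μ).toCocone
    exact ⟨_, ⟨swapIso e⟩⟩

end TensorSwap

/-! ### The constructed cocone is a bicolimit. -/

section Universal

open Bicategory
open scoped CategoryTheory.Pseudofunctor.StrongTrans MonoidalCategory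

variable {V : Type v} [Category.{u} V] [MonoidalCategory V]
variable {D : Type u} [Bicategory.{u, u} D] {W : Pseudofunctor Dᵒᵖ Cat.{u, u}}
  {X : Pseudofunctor D (VCat.{u, v} V)} {E L : VCat.{u, v} V}

theorem cst_comp_homToMap (l : Cocone W X L) (F : VFunctor (V := V) L.carrier E.carrier)
    {d d' : D} (a : d ⟶ d') (w : W.obj (op d')) (x : (X.obj d).carrier) :
    cst (l ≫ homToMap X (E := L) F) a w x = cst l a w x ≫ F.map _ _ := by
  have h : cst (l ≫ homToMap X (E := L) F) a w x =
    eId V _ ≫ post _ ((cst l a w x ≫ F.map _ _) ≫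
      post _ (eId V _ ≫ post _ (eId V _ ≫ post _ (eId V _)))) := rfl
  rw [h]
  simp only [post_eId, eId_comp_post, Category.comp_id]
  rfl

variable [SymmetricCategory V] [Limits.HasColimits V] [MonoidalClosed V]

/-- The cocone induced by `ν.lift` is isomorphic to `ν`. -/
noncomputable def Cocone.liftIso (ν : Cocone W X E) :
    (uData (W := W) (X := X)).toCocone ≫ homToMap X (E := bicolim W X) ν.lift ≅ ν :=
  Cocone.isoMk
    (fun d w => VFunctor.isoMk (fun x => eId V ((leg ν d w).obj x))
      (fun x => eId V ((leg ν d w).obj x))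
      (fun x x' => id_naturality _ _ (tAct_lift ν w x x'))
      (fun x => eId_comp_post _) (fun x => eId_comp_post _))
    (fun {d w w'} f x => by
      refine Eq.trans ?_ (eId_comp_post _).symm
      refine (congrArg (_ ≫ ·) (post_eId _ _)).trans ((Category.comp_id _).trans ?_)
      exact tMor_lift ν f x)
    (fun {d d'} a w x => by
      refine Eq.trans ?_ (eId_comp_post _).symm
      refine (congrArg (_ ≫ ·) (post_eId _ _)).trans ((Category.comp_id _).trans ?_)
      exact (cst_comp_homToMap _ _ a w x).trans (tCst_lift ν a w x))

variable (W X) in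
-- A 2-cell and the modification it induces have the same components, which gives faithfulness. For
-- fullness, `comm_bicolim` reduces `V`-naturality to generators, where it is the definition of a
-- modification. `Cocone.lift` gives essential surjectivity.
theorem uData_isBicolimit : (uData (W := W) (X := X)).toCocone.IsBicolimit := by
  intro E
  refine
    { faithful := ⟨fun {F G} α β h => ?_⟩
      full := ⟨fun {F G} Γ => ?_⟩
      essSurj := ⟨fun ν => ⟨Cocone.lift ν, ⟨Cocone.liftIso ν⟩⟩⟩ }
  · exact VFunctor.hom_ext fun s => congrArg (fun Γ => modApp Γ s.d s.w s.x) h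
  · have key : ∀ s t : (bicolim W X).carrier,
        Comm (E := E.carrier) (modApp Γ s.d s.w s.x) (F.map s t) (G.map s t)
          (modApp Γ t.d t.w t.x) := by
      refine comm_bicolim (F := F) (G := G) (fun s => modApp Γ s.d s.w s.x) ?_ ?_ ?_
      · intro d w x x'
        exact Comm.unit_iff'.2 (modApp_naturality Γ d w x x')
      · intro d w w' f x
        exact Comm.unit_iff.2 ((legMor_modApp Γ f x).symm.trans (comp_post_eq_comp_pre _ _))
      · intro d d' a w x
        refine Comm.congr (Comm.unit_iff.2 ?_)
          (cst_comp_homToMap (uData (W := W) (X := X)).toCocone F a w x).symm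
          (cst_comp_homToMap (uData (W := W) (X := X)).toCocone G a w x).symm
        exact (cst_modApp Γ a w x).symm.trans (comp_post_eq_comp_pre _ _)
    refine ⟨{ app := fun s => modApp (μ := _ ≫ homToMap _ F) (ν := _ ≫ homToMap _ G) Γ s.d s.w s.x,
              naturality := fun s t => Comm.unit_iff'.1 (key s t) }, ?_⟩
    exact cocone_hom_ext fun d w x => rfl

end Universal

/-! ### Uniqueness of bicolimits and its compatibility with pseudofunctors. -/

section Vertex

open Bicategory
open scoped CategoryTheory.Pseudofunctor.StrongTrans

variable {D : Type u} [Bicategory.{u, u} D] {B : Type v} [Bicategory.{u, u} B]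
  {W : Pseudofunctor Dᵒᵖ Cat.{u, u}} {X : Pseudofunctor D B}

/-- The inverse is precomposition with `t`; the unit comes from `e'` and the counit from `e`. The
equivalence need not be adjoint. -/
theorem precomp_isEquivalence {a b : B} {s : a ⟶ b} {t : b ⟶ a} (e : s ≫ t ≅ 𝟙 a)
    (e' : t ≫ s ≅ 𝟙 b) (c : B) : (precomp c s).IsEquivalence :=
  (CategoryTheory.Equivalence.mk (precomp c s) (precomp c t)
    (NatIso.ofComponents (fun x => (λ_ x).symm ≪≫ whiskerRightIso e'.symm x ≪≫ α_ t s x)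
      (fun f => by
        show f ≫ (λ_ _).inv ≫ e'.inv ▷ _ ≫ (α_ _ _ _).hom =
          ((λ_ _).inv ≫ e'.inv ▷ _ ≫ (α_ _ _ _).hom) ≫ t ◁ s ◁ f
        rw [leftUnitor_inv_naturality_assoc, whisker_exchange_assoc]
        simp))
    (NatIso.ofComponents (fun x => (α_ s t x).symm ≪≫ whiskerRightIso e x ≪≫ λ_ x)
      (fun f => by
        show s ◁ t ◁ f ≫ (α_ _ _ _).inv ≫ e.hom ▷ _ ≫ (λ_ _).hom =
          ((α_ _ _ _).inv ≫ e.hom ▷ _ ≫ (λ_ _).hom) ≫ f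
        rw [Category.assoc, Category.assoc, ← leftUnitor_naturality, ← whisker_exchange_assoc]
        simp))).isEquivalence_functor

/-- The comparison functor of a cocone isomorphic to the image of a cocone `l` under `s` factors
through the comparison functor of `l`. -/
def Cocone.comparisonIso {L L' : B} {l : Cocone W X L} {l' : Cocone W X L'} {s : L ⟶ L'}
    (e : l' ≅ l ≫ homToMap X s) (E : B) :
    (l'.comparison.app E).toFunctor ≅ precomp E s ⋙ (l.comparison.app E).toFunctor :=
  NatIso.ofComponents
    (fun (F : L' ⟶ E) => whiskerRightIso e (homToMap X F) ≪≫ α_ _ _ _ ≪≫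
      whiskerLeftIso l ((restrictedYoneda X).mapComp s F).symm)
    (fun {F G : L' ⟶ E} (α : F ⟶ G) => by
      show l' ◁ homToMap₂ X α ≫ e.hom ▷ homToMap X G ≫ (α_ _ _ _).hom ≫
          l ◁ ((restrictedYoneda X).mapComp s G).inv =
        (e.hom ▷ homToMap X F ≫ (α_ _ _ _).hom ≫
          l ◁ ((restrictedYoneda X).mapComp s F).inv) ≫ l ◁ homToMap₂ X (s ◁ α)
      have h : ((restrictedYoneda X).mapComp s F).inv ≫ homToMap₂ X (s ◁ α) =
          homToMap X s ◁ homToMap₂ X α ≫ ((restrictedYoneda X).mapComp s G).inv :=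
        (Iso.inv_comp_eq _).2 ((restrictedYoneda X).map₂_whisker_left s α)
      rw [whisker_exchange_assoc, comp_whiskerLeft]
      simp only [Category.assoc, Iso.inv_hom_id_assoc]
      exact congrArg (fun t => e.hom ▷ homToMap X F ≫ (α_ _ _ _).hom ≫ t)
        ((whiskerLeft_comp l _ _).symm.trans
          ((congrArg (l ◁ ·) h.symm).trans (whiskerLeft_comp l _ _))))

/-- By `comparisonIso`, the comparison functor of `l'` is isomorphic to precomposition with the
equivalence `s` followed by the comparison functor of `l`. -/
theorem Cocone.IsBicolimit.of_iso {L L' : B} {l : Cocone W X L} {l' : Cocone W X L'}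
    (hl : l.IsBicolimit) {s : L ⟶ L'} {t : L' ⟶ L} (e : s ≫ t ≅ 𝟙 L) (e' : t ≫ s ≅ 𝟙 L')
    (i : l' ≅ l ≫ homToMap X s) : l'.IsBicolimit := fun E =>
  have h := hl E
  have h' := precomp_isEquivalence e e' E
  have h'' := @Functor.isEquivalence_trans _ _ _ _ _ _ (precomp E s)
    (l.comparison.app E).toFunctor h' h
  @Functor.isEquivalence_of_iso _ _ _ _ _ _ (Cocone.comparisonIso i E).symm h''

/-- The usual uniqueness argument: essential surjectivity of each comparison functor provides `s`
and `t`, and full faithfulness provides the isomorphisms between their composites and the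
identities. -/
theorem Cocone.IsBicolimit.exists_iso {L L' : B} {l : Cocone W X L} {l' : Cocone W X L'}
    (hl : l.IsBicolimit) (hl' : l'.IsBicolimit) :
    ∃ (s : L ⟶ L') (t : L' ⟶ L), Nonempty (s ≫ t ≅ 𝟙 L) ∧ Nonempty (t ≫ s ≅ 𝟙 L') ∧
      Nonempty (l' ≅ l ≫ homToMap X s) := by
  -- Stated for an arbitrary pair of cocones, so that it can be used twice with the roles exchanged.
  have key : ∀ {L L' : B} {l : Cocone W X L} {l' : Cocone W X L'} (hl : l.IsBicolimit)
      {s : L ⟶ L'} {t : L' ⟶ L} (i : l' ≅ l ≫ homToMap X s) (j : l ≅ l' ≫ homToMap X t),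
      Nonempty (s ≫ t ≅ 𝟙 L) := by
    intro L L' l l' hl s t i j
    have := hl L
    -- Both `s ≫ t` and the identity carry `l` to a cocone isomorphic to `l`.
    have k : l ≫ homToMap X (s ≫ t) ≅ l ≫ homToMap X (𝟙 L) :=
      whiskerLeftIso l ((restrictedYoneda X).mapComp s t) ≪≫ (α_ _ _ _).symm ≪≫
        whiskerRightIso i.symm _ ≪≫ j.symm ≪≫ (ρ_ l).symm ≪≫
          whiskerLeftIso l ((restrictedYoneda X).mapId L).symm
    exact ⟨(l.comparison.app L).toFunctor.preimageIso k⟩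
  have := hl L'
  have := hl' L
  let i := ((l.comparison.app L').toFunctor.objObjPreimageIso l').symm
  let j := ((l'.comparison.app L).toFunctor.objObjPreimageIso l).symm
  exact ⟨_, _, key hl i j, key hl' j i, ⟨i⟩⟩

variable {B' : Type v'} [Bicategory.{u, u} B']

/-- The compatibility of `homToComp` with postcomposition. -/
def homToCompMap (T : Pseudofunctor B B') (X : Pseudofunctor D B) {L L' : B} (s : L ⟶ L') :
    homToMap X s ≫ homToComp T X L' ≅ homToComp T X L ≫ homToMap (X.comp T) (T.map s) :=
  Pseudofunctor.StrongTrans.isoMk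
    (fun d => Cat.Hom.isoMk (NatIso.ofComponents (fun (x : X.obj d.unop ⟶ L) => T.mapComp x s)
      (fun {x y : X.obj d.unop ⟶ L} (f : x ⟶ y) => by
        show T.map₂ (f ▷ s) ≫ (T.mapComp y s).hom = (T.mapComp x s).hom ≫ T.map₂ f ▷ T.map s
        simp)))
    (fun {a b} f => cat_ext fun (x : X.obj a.unop ⟶ L) => by
      show (T.mapComp (X.map f.unop ≫ x) s).hom ≫ (𝟙 _ ≫
          (T.mapComp (X.map f.unop) x).hom ▷ T.map s ≫ 𝟙 _ ≫
            (α_ (T.map (X.map f.unop)) (T.map x) (T.map s)).hom ≫ 𝟙 _) =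
        (𝟙 _ ≫ T.map₂ (α_ (X.map f.unop) x s).hom ≫ 𝟙 _ ≫
          (T.mapComp (X.map f.unop) (x ≫ s)).hom ≫ 𝟙 _) ≫
          T.map (X.map f.unop) ◁ (T.mapComp x s).hom
      simp)

/-- Preservation of a single bicolimiting cocone implies preservation of all with the same weight
and diagram: the equivalence `s` between the vertices is sent to an equivalence `T.map s`, along
which the image of `l'` is obtained from that of `l`. -/
theorem Cocone.IsBicolimit.map_of_map (T : Pseudofunctor B B') {L L' : B} {l : Cocone W X L}
    {l' : Cocone W X L'} (hl : l.IsBicolimit) (hl' : l'.IsBicolimit)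
    (h : (l.map T).IsBicolimit) : (l'.map T).IsBicolimit := by
  obtain ⟨s, t, ⟨e⟩, ⟨e'⟩, ⟨i⟩⟩ := hl.exists_iso hl'
  refine h.of_iso (s := T.map s) (t := T.map t)
    ((T.mapComp s t).symm ≪≫ T.map₂Iso e ≪≫ T.mapId L)
    ((T.mapComp t s).symm ≪≫ T.map₂Iso e' ≪≫ T.mapId L') ?_
  exact whiskerRightIso i (homToComp T X L') ≪≫ α_ _ _ _ ≪≫ whiskerLeftIso l (homToCompMap T X s) ≪≫
    (α_ _ _ _).symm

end Vertex

end VCatBicolimits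

theorem proposition2p3 {V : Type v} [Category.{u} V] [MonoidalCategory V] [SymmetricCategory V]
    [MonoidalClosed V] [Limits.HasColimits V] :
    VCatBicolimits.HasBicolimits (VCatBicolimits.VCat.{u, v} V) ∧
      ∀ C : VCatBicolimits.VCat.{u, v} V,
        VCatBicolimits.PreservesBicolimits (VCatBicolimits.tensorLeft C) ∧
        VCatBicolimits.PreservesBicolimits (VCatBicolimits.tensorRight C) :=
  have left (C : VCatBicolimits.VCat.{u, v} V) :
      VCatBicolimits.PreservesBicolimits (VCatBicolimits.tensorLeft C) := fun _ _ W X _ _ hl =>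
    (VCatBicolimits.uData_isBicolimit W X).map_of_map _ hl
      VCatBicolimits.uData_tensorLeft_isBicolimit
  ⟨fun _ _ W X => ⟨_, _, VCatBicolimits.uData_isBicolimit W X⟩, fun C => ⟨left C,
    fun _ _ _ _ _ _ hl => VCatBicolimits.isBicolimit_map_tensorRight (left C _ _ _ _ _ hl)⟩⟩
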